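/- **Setting.** Let $\mathbb T^2=(\mathbb R/\mathbb Z)^2$, $e_n(x)=e^{2\pi i n\cdot x}$, $\langle n\rangle=(1+|n|^2)^{1/2}$, let $\|f\|_{H^s}=\|\langle n\rangle^s\widehat f(n)\|_{\ell^2(\mathbb Z^2)}$, $\mathcal H^s=H^s\times H^{s-1}$ with $\|(f_0,f_1)\|_{\mathcal H^s}^2=\|f_0\|_{H^s}^2+\|f_1\|_{H^{s-1}}^2$, and let $D=\sqrt{-\Delta}$, $J=\sqrt{1-\tfrac34\Delta}$, $$S(t)=e^{-\frac D2t}\frac{\sin(tJ)}{J},\qquad V(t)(f_0,f_1)=e^{-\frac D2t}\Big(\cos(tJ)+\frac{D}{2J}\sin(tJ)\Big)f_0+S(t)f_1 .$$ A solution on $[0,T]$ of the viscous nonlinear wave equation $$\partial_t^2u+(1-\Delta)u+D\partial_tu+|u|^{p-1}u=0,\qquad (u,\partial_tu)|_{t=0}=(f_0,f_1)\tag{1}$$ is a curve $u$ of distributions on $\mathbb T^2$, given by a measurable function on $[0,T]\times\mathbb T^2$ with $|u|^{p-1}u$ integrable there, such that $u(t)=V(t)(f_0,f_1)-\int_0^tS(t-t')(|u|^{p-1}u)(t')\,dt'$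 for all $t\in[0,T]$. *Randomization.* Let $\{g_{n,j}\}_{n\in\mathbb Z^2,\,j=0,1}$ be mean-zero complex random variables on a probability space $(\Omega,P)$ with $g_{-n,j}=\overline{g_{n,j}}$ (so $g_{0,j}$ is real), such that $\{g_{0,j},\operatorname{Re}g_{n,j},\operatorname{Im}g_{n,j}\}_{n\in\mathcal I,\,j=0,1}$ are independent, where $\mathcal I=(\mathbb Z_{>0}\times\{0\})\cup(\mathbb Z\times\mathbb Z_{>0})$, and such that for some constant $K>0$ the laws $\mu_{n,j}$ of $g_{n,j}$ satisfy $\int e^{\gamma\cdot x}\,d\mu_{n,j}(x)\le e^{K|\gamma|^2}$ for all $n,j$ and all $\gamma\in\mathbb R^2$ ($\gamma\in\mathbb R$ if $n=0$). For real-valued distributions $u_0,u_1$ put $u_j^\omega=\sum_n g_{n,j}(\omega)\widehat u_j(n)e_n$. **Theorem.** Let $p>1$ and $-\frac1p<s\le0$. Then for every sufficiently small $\delta>0$ (depending on $p,s$) the following holds. Put $$(q,r,\sigma)=\Big(2+\delta,\tfrac{4+2\delta}{1+\delta},0\Big)\ \text{if }1<p<2,\qquad (q,r,\sigma)=\Big(p+\delta,\,2p,\,1-\tfrac1{p+\delta}-\tfrac1p\Big)\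 \text{if }p\ge2 .$$ For every $K>0$ there are constants $C,c,\gamma,T_0>0$, depending only on $p,s,\delta,K$, such that for every randomization as above with constant $K$ and all real-valued $(u_0,u_1)\in\mathcal H^s$, equation (1) is almost surely locally well-posed with initial data $(u_0^\omega,u_1^\omega)$: for almost every $\omega$ there are a $T>0$ and a unique solution on $[0,T]$ in the class displayed in (ii). More precisely, for each $0<T\le T_0$ there is an event $\Omega_T\subset\Omega$ with the following properties. (i) If $(u_0,u_1)\neq0$, then $$P(\Omega_T^c)<C\exp\Big(-\frac{c}{T^\gamma\|(u_0,u_1)\|_{\mathcal H^s}^2}\Big);$$ if $(u_0,u_1)=0$, then $P(\Omega_T^c)=0$. (ii) For each $\omega\in\Omega_T$, $(u_0^\omega,u_1^\omega)\in\mathcal H^s$, and there is a unique solution $u=u^\omega$ of (1) on $[0,T]$ with $(u,\partial_tu)|_{t=0}=(u_0^\omega,u_1^\omega)$ in the class $$V(t)(u_0^\omega,u_1^\omega)+C([0,T];H^\sigma(\mathbb T^2))\cap L^q([0,T];L^r(\mathbb T^2)).$$ The solution is real-valued, and it is unique among all complex-valued solutions in this class. -/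

import Mathlib

open MeasureTheory ProbabilityTheory Filter Topology
open scoped ENNReal

noncomputable section

namespace ViscousNLW

/-- The torus `𝕋² = (ℝ/ℤ)²`. -/
abbrev Torus : Type := UnitAddTorus (Fin 2)

/-- The normalized Lebesgue measure on `𝕋²` (the measure underlying `mFourierCoeff`). -/
def torusMeasure : Measure Torus := Measure.pi fun _ => AddCircle.haarAddCircle

/-- The frequency lattice `ℤ²`, dual to `𝕋²`. -/
abbrev Freq : Type := Fin 2 → ℤ

/-- A periodic distribution on `𝕋²`, described by its family of Fourier coefficients
with respect to the characters `e_n(x) = exp (2πi n·x)`. -/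
abbrev Coeffs : Type := Freq → ℂ

/-- The squared Euclidean length `|n|²` of a frequency. -/
def freqSq (n : Freq) : ℝ := (n 0 : ℝ) ^ 2 + (n 1 : ℝ) ^ 2

/-- The Japanese bracket `⟨n⟩ = (1 + |n|²)^{1/2}`. -/
def bracket (n : Freq) : ℝ := Real.sqrt (1 + freqSq n)

/-! ### Sobolev spaces -/

/-- The norm `‖a‖_{H^s} = ‖⟨n⟩^s a(n)‖_{ℓ²(ℤ²)}`, with values in `[0, ∞]`. -/
def sobolevNorm (s : ℝ) (a : Coeffs) : ℝ≥0∞ :=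
  (∑' n : Freq, ENNReal.ofReal ((bracket n ^ s * ‖a n‖) ^ 2)) ^ (1 / 2 : ℝ)

/-- Membership in `H^s(𝕋²)`. -/
def MemH (s : ℝ) (a : Coeffs) : Prop := sobolevNorm s a < ∞

/-- Membership of a pair in `𝓗^s = H^s × H^{s-1}`. -/
def MemHH (s : ℝ) (a b : Coeffs) : Prop := MemH s a ∧ MemH (s - 1) b

/-- The norm of a pair in `𝓗^s = H^s × H^{s-1}`. -/
def normHH (s : ℝ) (a b : Coeffs) : ℝ :=
  Real.sqrt ((sobolevNorm s a).toReal ^ 2 + (sobolevNorm (s - 1) b).toReal ^ 2)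

/-- The distribution with Fourier coefficients `a` is real-valued. -/
def IsRealDistribution (a : Coeffs) : Prop := ∀ n, a (-n) = starRingEnd ℂ (a n)

/-- `v ∈ C([0,T]; H^σ)`. -/
def MemCH (T σ : ℝ) (v : ℝ → Coeffs) : Prop :=
  (∀ t ∈ Set.Icc 0 T, MemH σ (v t)) ∧
    ∀ t₀ ∈ Set.Icc 0 T,
      Tendsto (fun t => sobolevNorm σ (v t - v t₀)) (𝓝[Set.Icc 0 T] t₀) (𝓝 0)

/-! ### Space-time functions -/

/-- The curve of distributions `v` on `[0,T]` is given by the measurable function `f` on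
`[0,T] × 𝕋²`: for almost every time `t`, `v(t)` is the integrable function `f(t,·)`. -/
def IsGivenBy (T : ℝ) (v : ℝ → Coeffs) (f : ℝ × Torus → ℂ) : Prop :=
  AEStronglyMeasurable f ((volume.restrict (Set.Icc 0 T)).prod torusMeasure) ∧
    ∀ᵐ t ∂(volume.restrict (Set.Icc 0 T)),
      Integrable (fun x : Torus => f (t, x)) torusMeasure ∧
        ∀ n, UnitAddTorus.mFourierCoeff (fun x : Torus => f (t, x)) n = v t n

/-- `v ∈ L^q([0,T]; L^r(𝕋²))`. -/
def MemLL (T q r : ℝ) (v : ℝ → Coeffs) : Prop :=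
  ∃ f : ℝ × Torus → ℂ, IsGivenBy T v f ∧
    eLpNorm (fun t : ℝ => eLpNorm (fun x : Torus => f (t, x)) (ENNReal.ofReal r) torusMeasure)
      (ENNReal.ofReal q) (volume.restrict (Set.Icc 0 T)) < ∞

/-! ### The linear propagators -/

/-- The symbol `2π|n|` of `D = √(-Δ)`. -/
def symD (n : Freq) : ℝ := 2 * Real.pi * Real.sqrt (freqSq n)

/-- The symbol of `⟦D⟧ = √(1 - (3/4)Δ)`. -/
def symJ (n : Freq) : ℝ := Real.sqrt (1 + 3 / 4 * symD n ^ 2)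

/-- The symbol of `S(t) = e^{-Dt/2} sin(t⟦D⟧) / ⟦D⟧`. -/
def symS (t : ℝ) (n : Freq) : ℝ :=
  Real.exp (-(symD n / 2) * t) * (Real.sin (t * symJ n) / symJ n)

/-- The linear propagator
`V(t)(a,b) = e^{-Dt/2} (cos(t⟦D⟧) + (D / 2⟦D⟧) sin(t⟦D⟧)) a + S(t) b`. -/
def propV (t : ℝ) (a b : Coeffs) : Coeffs := fun n =>
  ((Real.exp (-(symD n / 2) * t) *
      (Real.cos (t * symJ n) + symD n / (2 * symJ n) * Real.sin (t * symJ n)) : ℝ) : ℂ) * a n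
    + ((symS t n : ℝ) : ℂ) * b n

/-! ### Solutions -/

/-- The nonlinearity `|z|^{p-1} z`. -/
def nonlin (p : ℝ) (z : ℂ) : ℂ := ((‖z‖ ^ (p - 1) : ℝ) : ℂ) * z

/-- `u` solves `∂_t² u + (1-Δ)u + D ∂_t u + |u|^{p-1}u = 0`, `(u, ∂_t u)(0) = (a, b)` on `[0,T]`,
i.e. it satisfies the Duhamel formula
`u(t) = V(t)(a,b) - ∫_0^t S(t-t') (|u|^{p-1}u)(t') dt'` as an identity of distributions for all
`t ∈ [0,T]`. For the integral to make sense, `u` is a function on `[0,T] × 𝕋²` for which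
`|u|^{p-1}u` is integrable there. -/
def IsSolution (p T : ℝ) (a b : Coeffs) (u : ℝ → Coeffs) : Prop :=
  ∃ f : ℝ × Torus → ℂ, IsGivenBy T u f ∧
    Integrable (fun y => nonlin p (f y))
      ((volume.restrict (Set.Icc 0 T)).prod torusMeasure) ∧
    ∀ t ∈ Set.Icc 0 T, ∀ n : Freq,
      u t n = propV t a b n -
        ∫ t' in (0 : ℝ)..t, ((symS (t - t') n : ℝ) : ℂ) *
          UnitAddTorus.mFourierCoeff (fun x : Torus => nonlin p (f (t', x))) n

/-- `u ∈ V(t)(a,b) + C([0,T]; H^σ) ∩ L^q([0,T]; L^r)`. -/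
def InClass (T q r σ : ℝ) (a b : Coeffs) (u : ℝ → Coeffs) : Prop :=
  MemCH T σ (fun t => u t - propV t a b) ∧ MemLL T q r (fun t => u t - propV t a b)

/-- There is a unique solution on `[0,T]` with initial data `(a,b)` in the class
`V(t)(a,b) + C([0,T]; H^σ) ∩ L^q([0,T]; L^r)`. Moreover the solution is real-valued and attains
its initial data `(u, ∂_t u)(0) = (a,b)`; uniqueness is among complex-valued solutions. -/
def HasUniqueSolution (p T q r σ : ℝ) (a b : Coeffs) : Prop :=
  ∃ u : ℝ → Coeffs,
    IsSolution p T a b u ∧ InClass T q r σ a b u ∧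
    (∀ t ∈ Set.Icc 0 T, IsRealDistribution (u t)) ∧
    u 0 = a ∧ (∀ n, HasDerivWithinAt (fun t => u t n) (b n) (Set.Icc 0 T) 0) ∧
    ∀ w : ℝ → Coeffs, IsSolution p T a b w → InClass T q r σ a b w →
      ∀ t ∈ Set.Icc 0 T, w t = u t

/-! ### The exponents -/

/-- The exponent `q`: `2 + δ` for `1 < p < 2`, and `p + δ` for `p ≥ 2`. -/
def expQ (p δ : ℝ) : ℝ := if p < 2 then 2 + δ else p + δ

/-- The exponent `r`: `(4 + 2δ)/(1 + δ)` for `1 < p < 2`, and `2p` for `p ≥ 2`. -/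
def expR (p δ : ℝ) : ℝ := if p < 2 then (4 + 2 * δ) / (1 + δ) else 2 * p

/-- The regularity `σ`: `0` for `1 < p < 2`, and `1 - 1/(p+δ) - 1/p` for `p ≥ 2`. -/
def expσ (p δ : ℝ) : ℝ := if p < 2 then 0 else 1 - 1 / (p + δ) - 1 / p

/-! ### The randomization -/

/-- The index set `(ℤ₊ × {0}) ∪ (ℤ × ℤ₊)`; `ℤ²` is the disjoint union of it, its negative and
the origin. -/
def posHalf : Set Freq := {n | (0 < n 0 ∧ n 1 = 0) ∨ 0 < n 1}

/-- The assumptions on the random variables `g_{n,j}` (written `g j n`), with constant `K` in the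
exponential moment bound `∫ e^{γ·x} dμ_{n,j}(x) ≤ e^{K|γ|²}`.
At `n = 0` the condition `g_{-n,j} = conj g_{n,j}` says that `g_{0,j}` is real. Hence the extra
members `Im g_{0,j} = 0` of the independent family below are constants and impose nothing, and at
`n = 0` the moment bound for `(γ₁, γ₂) ∈ ℝ²` is the one for `γ₁ ∈ ℝ`. -/
structure IsRandomization {Ω : Type*} [MeasurableSpace Ω] (P : Measure Ω) (K : ℝ)
    (g : Fin 2 → Freq → Ω → ℂ) : Prop where
  measurable : ∀ j n, Measurable (g j n)
  mean_zero : ∀ j n, Integrable (g j n) P ∧ ∫ ω, g j n ω ∂P = 0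
  conj_symm : ∀ j n ω, g j (-n) ω = starRingEnd ℂ (g j n ω)
  indep : iIndepFun
    (fun (k : Fin 2 × {n : Freq // n = 0 ∨ n ∈ posHalf} × Bool) (ω : Ω) =>
      if k.2.2 then (g k.1 k.2.1 ω).re else (g k.1 k.2.1 ω).im) P
  exp_moment : ∀ j n (γ₁ γ₂ : ℝ),
    ∫⁻ ω, ENNReal.ofReal (Real.exp (γ₁ * (g j n ω).re + γ₂ * (g j n ω).im)) ∂P
      ≤ ENNReal.ofReal (Real.exp (K * (γ₁ ^ 2 + γ₂ ^ 2)))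

/-- The randomization `a^ω = ∑_n g_n(ω) a(n) e_n`. -/
def randomize {Ω : Type*} (g : Freq → Ω → ℂ) (a : Coeffs) (ω : Ω) : Coeffs :=
  fun n => g n ω * a n

end ViscousNLW

end

/-!
Write `z(t) = V(t)(a, b)` for the linear evolution of data `(a, b)` and `v = u - z`, so that
`v(t) = -∫_0^t S(t - t') (|u|^{p-1}u)(t') dt'`.

*Deterministic part.* The operator `S(t)` gains one derivative uniformly in `t ≥ 0`, so
`‖v(t)‖_{H¹} ≤ ∫_0^t ‖u(t')‖_{L^{2p}}^p dt'` (`sobolevNorm_duhamel_le`), and `H¹(𝕋²) ⊂ L^{2p}(𝕋²)`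
(`eLpNorm_le_sobolevNorm`). Hence everything closes as soon as `z ∈ L^p([0,T]; L^{2p})`. If this norm
of `z` and `T` are below a threshold depending only on `p`, a contraction in the unit ball of
`C([0,T]; H¹)` gives a solution (`exists_isRegularSolution`). It lies in the class of the theorem
because `σ ≤ 1` and `H¹(𝕋²) ⊂ L^r(𝕋²)`. Conversely `q ≥ p` and, for small `δ`, `r ≥ 2p`, so every
solution `w` in that class lies in `L^p([0,T]; L^{2p})` (`IsSolution.exists_isRegularSolution`). The
energy estimate then puts `w - z` into `C([0,T]; H¹)`, and Grönwall's inequality with an integrable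
weight gives uniqueness (`IsRegularSolution.unique`). The conjugate of a solution with real data
is a solution, so uniqueness implies that the solution is real-valued.

*Probabilistic part.* For fixed `(t, x)` the value `z^ω(t, x)` is a sum of independent sub-Gaussian
variables. By the smoothing `e^{-tD/2} ≤ C t^s ⟨D⟩^s` its variance is at most a multiple of
`t^{2s} ‖(u₀, u₁)‖²`, and its moments of order `2m` are bounded by Khintchine's inequality
(`IsRandomization.lintegral_enorm_pow_le`). Since `sp > -1`, the function `t^{sp}` is integrable on
`[0,T]`. Chebyshev's inequality with moment `m` and Hölder's inequality
(`measure_lintegral_sliceNorm_gt_le`), optimized in `m` (`lt_exp_of_forall_le_pow`), bound the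
probability that the `L^p([0,T]; L^{2p})` norm of `z^ω` is above the threshold.

A family of Fourier coefficients is turned into a function by summing the dyadic blocks of its
Fourier series pointwise (`synth`). In contrast to a choice of representative for each `ω` and `t`,
this is measurable in `ω`, `t` and `x` jointly.
-/

noncomputable section

namespace ViscousNLW

open UnitAddTorus (mFourier mFourierCoeff)

/-! ### Fourier analysis on the torus -/

instance : IsProbabilityMeasure torusMeasure := by
  unfold torusMeasure; infer_instance

theorem mFourierCoeff_def (f : Torus → ℂ) (n : Freq) :
    mFourierCoeff f n = ∫ x, mFourier (-n) x * f x ∂torusMeasure := rfl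

theorem norm_mFourier_apply (n : Freq) (x : Torus) : ‖mFourier n x‖ = 1 := by
  simp [mFourier]
  rw [Circle.norm_coe, Circle.norm_coe, one_mul]

theorem enorm_mFourier_apply (n : Freq) (x : Torus) : ‖mFourier n x‖ₑ = 1 := by
  rw [← ofReal_norm, norm_mFourier_apply, ENNReal.ofReal_one]

theorem Integrable.continuousMap_mul {f : Torus → ℂ} (hf : Integrable f torusMeasure)
    (g : C(Torus, ℂ)) : Integrable (fun x => g x * f x) torusMeasure :=
  hf.bdd_mul g.continuous.aestronglyMeasurable
    (Eventually.of_forall fun x => g.norm_coe_le_norm x)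

theorem mFourierCoeff_add {f g : Torus → ℂ} (hf : Integrable f torusMeasure)
    (hg : Integrable g torusMeasure) (n : Freq) :
    mFourierCoeff (fun x => f x + g x) n = mFourierCoeff f n + mFourierCoeff g n := by
  simp only [mFourierCoeff_def, mul_add]
  exact integral_add (Integrable.continuousMap_mul hf _) (Integrable.continuousMap_mul hg _)

theorem mFourierCoeff_sub {f g : Torus → ℂ} (hf : Integrable f torusMeasure)
    (hg : Integrable g torusMeasure) (n : Freq) :
    mFourierCoeff (fun x => f x - g x) n = mFourierCoeff f n - mFourierCoeff g n := by
  simp only [mFourierCoeff_def, mul_sub]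
  exact integral_sub (Integrable.continuousMap_mul hf _) (Integrable.continuousMap_mul hg _)

theorem mFourierCoeff_congr {f g : Torus → ℂ} (h : f =ᵐ[torusMeasure] g) (n : Freq) :
    mFourierCoeff f n = mFourierCoeff g n := by
  simp only [mFourierCoeff_def]
  exact integral_congr_ae (h.mono fun x hx => by simp only [hx])

theorem enorm_mFourierCoeff_le (f : Torus → ℂ) (n : Freq) :
    ‖mFourierCoeff f n‖ₑ ≤ ∫⁻ x, ‖f x‖ₑ ∂torusMeasure := by
  rw [mFourierCoeff_def]
  refine (enorm_integral_le_lintegral_enorm _).trans (le_of_eq ?_)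
  simp [enorm_mFourier_apply]

/-- The Fourier coefficients determine an integrable function. -/
theorem ae_eq_zero_of_mFourierCoeff_eq_zero {f : Torus → ℂ} (hf : Integrable f torusMeasure)
    (h : ∀ n, mFourierCoeff f n = 0) : f =ᵐ[torusMeasure] 0 := by
  -- Trigonometric polynomials are dense in `C(𝕋²)`, so `f` is orthogonal to `C(𝕋²)`.
  let Λ : C(Torus, ℂ) →L[ℂ] ℂ := LinearMap.mkContinuous
    { toFun := fun g => ∫ x, g x * f x ∂torusMeasure
      map_add' := fun g₁ g₂ => by
        simp only [ContinuousMap.add_apply, add_mul]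
        exact integral_add (Integrable.continuousMap_mul hf _) (Integrable.continuousMap_mul hf _)
      map_smul' := fun c g => by
        simp only [ContinuousMap.smul_apply, smul_eq_mul, mul_assoc, RingHom.id_apply]
        exact integral_const_mul _ _ } (∫ x, ‖f x‖ ∂torusMeasure) (fun g => by
      simp only [LinearMap.coe_mk, AddHom.coe_mk]
      refine (norm_integral_le_integral_norm _).trans ?_
      rw [mul_comm, ← integral_const_mul]
      refine integral_mono (Integrable.continuousMap_mul hf _).norm (hf.norm.const_mul _)
        fun x => ?_
      simp only [norm_mul]
      gcongr
      exact g.norm_coe_le_norm x)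
  have hΛ : ∀ g : C(Torus, ℂ), Λ g = ∫ x, g x * f x ∂torusMeasure := fun g => rfl
  have hker : (⊤ : Submodule ℂ C(Torus, ℂ)) ≤ Λ.ker := by
    rw [← UnitAddTorus.span_mFourier_closure_eq_top]
    refine Submodule.topologicalClosure_minimal _ ?_ Λ.isClosed_ker
    rw [Submodule.span_le]
    rintro _ ⟨n, rfl⟩
    have := h (-n)
    rw [mFourierCoeff_def, neg_neg] at this
    exact this
  have hzero : ∀ g : C(Torus, ℂ), ∫ x, g x * f x ∂torusMeasure = 0 := fun g =>
    hker (Submodule.mem_top (x := g))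
  refine ae_eq_zero_of_forall_setIntegral_isClosed_eq_zero hf fun s hs => ?_
  have hδ : ∀ k : ℕ, (0 : ℝ) < 1 / ((k : ℝ) + 1) := fun k => by positivity
  have hlim := thickenedIndicator_tendsto_indicator_closure hδ
    (tendsto_one_div_add_atTop_nhds_zero_nat (𝕜 := ℝ)) s
  rw [hs.closure_eq, tendsto_pi_nhds] at hlim
  rw [← integral_indicator hs.measurableSet]
  have key : Tendsto (fun k : ℕ => ∫ x, (thickenedIndicator (hδ k) s x : ℂ) * f x ∂torusMeasure)
      atTop (𝓝 (∫ x, s.indicator f x ∂torusMeasure)) := by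
    refine tendsto_integral_of_dominated_convergence (fun x => ‖f x‖) (fun k => ?_) hf.norm
      (fun k => Eventually.of_forall fun x => ?_) (Eventually.of_forall fun x => ?_)
    · refine AEStronglyMeasurable.mul ?_ hf.1
      have : Continuous fun x : Torus => ((thickenedIndicator (hδ k) s x : ℝ) : ℂ) := by
        fun_prop
      exact this.aestronglyMeasurable
    · rw [norm_mul]
      refine mul_le_of_le_one_left (norm_nonneg _) ?_
      have := thickenedIndicator_le_one (hδ k) s x
      simpa using this
    · have h1 : Tendsto (fun k : ℕ => (thickenedIndicator (hδ k) s x : ℂ)) atTop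
          (𝓝 (((s.indicator (fun _ => (1 : NNReal)) x : NNReal) : ℝ) : ℂ)) :=
        (Complex.continuous_ofReal.tendsto _).comp
          ((NNReal.continuous_coe.tendsto _).comp (hlim x))
      have h2 := h1.mul_const (f x)
      by_cases hx : x ∈ s <;> simpa only [hx, Set.indicator_of_mem, Set.indicator_of_notMem,
        not_false_eq_true, NNReal.coe_one, NNReal.coe_zero, Complex.ofReal_one,
        Complex.ofReal_zero, one_mul, zero_mul] using h2
  refine tendsto_nhds_unique key ?_
  have : ∀ k : ℕ, ∫ x, (thickenedIndicator (hδ k) s x : ℂ) * f x ∂torusMeasure = 0 := fun k =>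
    hzero ⟨fun x => ((thickenedIndicator (hδ k) s x : ℝ) : ℂ), by fun_prop⟩
  simp only [this, tendsto_const_nhds]

theorem ae_eq_of_mFourierCoeff_eq {f g : Torus → ℂ} (hf : Integrable f torusMeasure)
    (hg : Integrable g torusMeasure) (h : ∀ n, mFourierCoeff f n = mFourierCoeff g n) :
    f =ᵐ[torusMeasure] g := by
  have := ae_eq_zero_of_mFourierCoeff_eq_zero (hf.sub hg) fun n => by
    rw [show f - g = fun x => f x - g x from rfl, mFourierCoeff_sub hf hg, h n, sub_self]
  filter_upwards [this] with x hx
  simpa [sub_eq_zero] using hx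

/-- Parseval's identity. -/
theorem tsum_enorm_mFourierCoeff_sq {f : Torus → ℂ} (hf : MemLp f 2 torusMeasure) :
    ∑' n, ‖mFourierCoeff f n‖ₑ ^ 2 = eLpNorm f 2 torusMeasure ^ 2 := by
  have h : HasSum (fun n => ‖mFourierCoeff (hf.toLp f) n‖ ^ 2)
      (∫ x, ‖hf.toLp f x‖ ^ 2 ∂torusMeasure) :=
    UnitAddTorus.hasSum_sq_mFourierCoeff (hf.toLp f)
  have hc : ∀ n, mFourierCoeff (hf.toLp f) n = mFourierCoeff f n := fun n =>
    mFourierCoeff_congr hf.coeFn_toLp n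
  have hi : ∫ x, ‖hf.toLp f x‖ ^ 2 ∂torusMeasure = ∫ x, ‖f x‖ ^ 2 ∂torusMeasure :=
    integral_congr_ae (hf.coeFn_toLp.mono fun x hx => by simp only [hx])
  simp only [hc, hi] at h
  have h2 : ∀ z : ℂ, ‖z‖ₑ ^ 2 = ENNReal.ofReal (‖z‖ ^ 2) := fun z => by
    rw [ENNReal.ofReal_pow (norm_nonneg _), ofReal_norm]
  rw [eLpNorm_eq_lintegral_rpow_enorm_toReal (by norm_num) (by norm_num)]
  simp only [ENNReal.toReal_ofNat, ENNReal.rpow_ofNat]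
  rw [← ENNReal.rpow_natCast, ← ENNReal.rpow_mul]
  simp only [h2]
  rw [show (1 / 2 * ((2 : ℕ) : ℝ)) = 1 by norm_num, ENNReal.rpow_one,
    ← ENNReal.ofReal_tsum_of_nonneg (fun n => by positivity) h.summable, h.tsum_eq,
    ofReal_integral_eq_lintegral_ofReal ?_ (Eventually.of_forall fun x => by positivity)]
  exact hf.integrable_norm_pow (by norm_num)

/-- The trigonometric polynomial `∑_{n ∈ F} a_n e_n`. -/
def trigPoly (F : Finset Freq) (a : Coeffs) (x : Torus) : ℂ := ∑ n ∈ F, a n * mFourier n x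

theorem continuous_trigPoly (F : Finset Freq) (a : Coeffs) : Continuous (trigPoly F a) := by
  unfold trigPoly; fun_prop

theorem mFourierCoeff_mFourier (m n : Freq) :
    mFourierCoeff (mFourier m) n = if m = n then 1 else 0 := by
  have h := (orthonormal_iff_ite.1 (UnitAddTorus.orthonormal_mFourier (d := Fin 2))) n m
  rw [ContinuousMap.inner_toLp] at h
  rw [mFourierCoeff_def]
  simp only [eq_comm (a := m)]
  rw [← h]
  refine integral_congr_ae (Eventually.of_forall fun x => ?_)
  simp [UnitAddTorus.mFourier_neg, mul_comm]

theorem mFourierCoeff_trigPoly (F : Finset Freq) (a : Coeffs) (n : Freq) :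
    mFourierCoeff (trigPoly F a) n = if n ∈ F then a n else 0 := by
  have : ∀ m, ∫ x, mFourier (-n) x * (a m * mFourier m x) ∂torusMeasure
      = a m * if m = n then 1 else 0 := fun m => by
    rw [← mFourierCoeff_mFourier, mFourierCoeff_def, ← integral_const_mul]
    congr 1; ext x; ring
  rw [mFourierCoeff_def]
  simp only [trigPoly, Finset.mul_sum]
  rw [integral_finsetSum]
  · simp [this]
  · intro m _
    exact (by fun_prop : Continuous fun x : Torus =>
      mFourier (-n) x * (a m * mFourier m x)).integrable_of_hasCompactSupport
        (HasCompactSupport.of_compactSpace _)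

theorem memLp_trigPoly (F : Finset Freq) (a : Coeffs) (r : ℝ≥0∞) :
    MemLp (trigPoly F a) r torusMeasure := by
  refine MemLp.of_bound (continuous_trigPoly F a).aestronglyMeasurable (∑ n ∈ F, ‖a n‖)
    (Eventually.of_forall fun x => ?_)
  refine (norm_sum_le _ _).trans (le_of_eq ?_)
  simp [norm_mFourier_apply]

theorem eLpNorm_trigPoly_sq (F : Finset Freq) (a : Coeffs) :
    eLpNorm (trigPoly F a) 2 torusMeasure ^ 2 = ∑ n ∈ F, ‖a n‖ₑ ^ 2 := by
  rw [← tsum_enorm_mFourierCoeff_sq (memLp_trigPoly F a 2), tsum_eq_sum (s := F)]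
  · exact Finset.sum_congr rfl fun n hn => by rw [mFourierCoeff_trigPoly, if_pos hn]
  · intro n hn
    rw [mFourierCoeff_trigPoly, if_neg hn]; simp

/-! ### Symbols of the linear propagators -/

theorem freqSq_nonneg (n : Freq) : 0 ≤ freqSq n := by unfold freqSq; positivity

theorem one_le_bracket (n : Freq) : 1 ≤ bracket n :=
  Real.one_le_sqrt.2 (by linarith [freqSq_nonneg n])

theorem bracket_pos (n : Freq) : 0 < bracket n := zero_lt_one.trans_le (one_le_bracket n)

theorem freqSq_neg (n : Freq) : freqSq (-n) = freqSq n := by simp [freqSq]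

theorem symD_neg (n : Freq) : symD (-n) = symD n := by simp [symD, freqSq_neg]

theorem symJ_neg (n : Freq) : symJ (-n) = symJ n := by simp [symJ, symD_neg]

theorem symS_neg (t : ℝ) (n : Freq) : symS t (-n) = symS t n := by
  simp [symS, symJ_neg, symD_neg]

theorem symD_nonneg (n : Freq) : 0 ≤ symD n := by unfold symD; positivity

theorem symD_sq (n : Freq) : symD n ^ 2 = 4 * Real.pi ^ 2 * freqSq n := by
  rw [symD, mul_pow, Real.sq_sqrt (freqSq_nonneg n)]; ring

theorem bracket_le_symJ (n : Freq) : bracket n ≤ symJ n := by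
  refine Real.sqrt_le_sqrt ?_
  rw [symD_sq]
  nlinarith [freqSq_nonneg n, Real.pi_gt_three, mul_nonneg (freqSq_nonneg n)
    (sub_nonneg.2 Real.pi_gt_three.le)]

theorem symJ_pos (n : Freq) : 0 < symJ n := (bracket_pos n).trans_le (bracket_le_symJ n)

theorem symD_le_two_mul_symJ (n : Freq) : symD n ≤ 2 * symJ n := by
  have h : symD n ^ 2 ≤ (2 * symJ n) ^ 2 := by
    rw [mul_pow, symJ, Real.sq_sqrt (by positivity)]
    nlinarith [sq_nonneg (symD n)]
  exact le_of_sq_le_sq h (by linarith [symJ_pos n])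

theorem bracket_mul_abs_symS_le (t : ℝ) (n : Freq) :
    bracket n * |symS t n| ≤ Real.exp (-(symD n / 2) * t) := by
  rw [symS, abs_mul, abs_div, Real.abs_exp, abs_of_pos (symJ_pos n)]
  have h1 : bracket n * (|Real.sin (t * symJ n)| / symJ n) ≤ 1 := by
    rw [← mul_div_assoc, div_le_one (symJ_pos n)]
    calc _ ≤ symJ n * 1 := mul_le_mul (bracket_le_symJ n) (Real.abs_sin_le_one _)
            (abs_nonneg _) (symJ_pos n).le
      _ = _ := mul_one _
  calc _ = Real.exp (-(symD n / 2) * t) * (bracket n * (|Real.sin (t * symJ n)| / symJ n)) := by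
        ring
    _ ≤ _ := mul_le_of_le_one_right (Real.exp_pos _).le h1

theorem bracket_mul_abs_symS_le_one {t : ℝ} (ht : 0 ≤ t) (n : Freq) :
    bracket n * |symS t n| ≤ 1 := by
  refine (bracket_mul_abs_symS_le t n).trans (Real.exp_le_one_iff.2 ?_)
  nlinarith [symD_nonneg n]

theorem continuous_symS (n : Freq) : Continuous fun t => symS t n := by
  unfold symS; fun_prop

theorem symS_zero (n : Freq) : symS 0 n = 0 := by simp [symS]

/-- The symbol of the part of the propagator `V(t)` that acts on the first datum. -/
def symV (t : ℝ) (n : Freq) : ℝ :=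
  Real.exp (-(symD n / 2) * t) *
    (Real.cos (t * symJ n) + symD n / (2 * symJ n) * Real.sin (t * symJ n))

theorem propV_apply (t : ℝ) (a b : Coeffs) (n : Freq) :
    propV t a b n = (symV t n : ℂ) * a n + (symS t n : ℂ) * b n := rfl

theorem symV_neg (t : ℝ) (n : Freq) : symV t (-n) = symV t n := by
  simp [symV, symJ_neg, symD_neg]

theorem continuous_symV (n : Freq) : Continuous fun t => symV t n := by
  unfold symV; fun_prop

theorem abs_symV_le (t : ℝ) (n : Freq) :
    |symV t n| ≤ 2 * Real.exp (-(symD n / 2) * t) := by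
  rw [symV, abs_mul, Real.abs_exp, mul_comm]
  refine mul_le_mul_of_nonneg_right ?_ (Real.exp_pos _).le
  have h : |symD n / (2 * symJ n)| ≤ 1 := by
    rw [abs_of_nonneg (div_nonneg (symD_nonneg n) (by linarith [symJ_pos n])),
      div_le_one (by linarith [symJ_pos n])]
    exact symD_le_two_mul_symJ n
  calc _ ≤ |Real.cos (t * symJ n)| + |symD n / (2 * symJ n)| * |Real.sin (t * symJ n)| := by
        rw [← abs_mul]; exact abs_add_le _ _
    _ ≤ 1 + 1 * 1 := by
        gcongr
        · exact Real.abs_cos_le_one _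
        · exact Real.abs_sin_le_one _
    _ = 2 := by norm_num

theorem propV_zero (a b : Coeffs) : propV 0 a b = a := by
  ext n; simp [propV_apply, symV, symS]

/-! ### Sobolev norms -/

theorem sobolevNorm_sq (s : ℝ) (a : Coeffs) :
    sobolevNorm s a ^ 2 = ∑' n, (ENNReal.ofReal (bracket n ^ s) * ‖a n‖ₑ) ^ 2 := by
  rw [sobolevNorm, ← ENNReal.rpow_natCast, ← ENNReal.rpow_mul]
  norm_num
  refine tsum_congr fun n => ?_
  rw [ENNReal.ofReal_pow (by have := bracket_pos n; positivity),
    ENNReal.ofReal_mul (Real.rpow_nonneg (bracket_pos n).le _), ofReal_norm, mul_pow]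

theorem sobolevNorm_one_sq (a : Coeffs) :
    sobolevNorm 1 a ^ 2 = ∑' n, (ENNReal.ofReal (bracket n) * ‖a n‖ₑ) ^ 2 := by
  simp [sobolevNorm_sq]

theorem sobolevNorm_mono {s s' : ℝ} (h : s ≤ s') (a : Coeffs) :
    sobolevNorm s a ≤ sobolevNorm s' a := by
  refine (ENNReal.pow_le_pow_left_iff two_ne_zero).1 ?_
  rw [sobolevNorm_sq, sobolevNorm_sq]
  gcongr with n
  exact one_le_bracket n

theorem bracket_mul_enorm_le_sobolevNorm (s : ℝ) (a : Coeffs) (n : Freq) :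
    ENNReal.ofReal (bracket n ^ s) * ‖a n‖ₑ ≤ sobolevNorm s a := by
  refine (ENNReal.pow_le_pow_left_iff two_ne_zero).1 ?_
  rw [sobolevNorm_sq]
  exact ENNReal.le_tsum (f := fun n => (ENNReal.ofReal (bracket n ^ s) * ‖a n‖ₑ) ^ 2) n

theorem sobolevNorm_neg (s : ℝ) (a : Coeffs) : sobolevNorm s (-a) = sobolevNorm s a := by
  simp [sobolevNorm]

theorem sobolevNorm_eq_zero {s : ℝ} {a : Coeffs} (h : sobolevNorm s a = 0) : a = 0 := by
  ext n
  have := bracket_mul_enorm_le_sobolevNorm s a n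
  rw [h, nonpos_iff_eq_zero, mul_eq_zero] at this
  rcases this with h | h
  · rw [ENNReal.ofReal_eq_zero] at h
    exact absurd h (not_le.2 (Real.rpow_pos_of_pos (bracket_pos n) s))
  · simpa using h

/-! ### Dyadic decomposition and the Sobolev embedding -/

/-- The dyadic level of a frequency: the least `j` with `max |n₁| |n₂| ≤ 2^j`. -/
def level (n : Freq) : ℕ := Nat.clog 2 (max (n 0).natAbs (n 1).natAbs)

/-- The finite set of frequencies of dyadic level `j`. -/
def block (j : ℕ) : Finset Freq :=
  (Finset.Icc (fun _ => -(2 : ℤ) ^ j) (fun _ => (2 : ℤ) ^ j)).filter fun n => level n = j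

theorem mem_block {j : ℕ} {n : Freq} : n ∈ block j ↔ level n = j := by
  rw [block, Finset.mem_filter, and_iff_right_iff_imp]
  intro h
  have h1 : max (n 0).natAbs (n 1).natAbs ≤ 2 ^ j := by
    rw [← h]; exact Nat.le_pow_clog one_lt_two _
  have h2 : ∀ i, |n i| ≤ 2 ^ j := by
    intro i
    rw [Int.abs_eq_natAbs]
    have : (n i).natAbs ≤ 2 ^ j := by
      fin_cases i
      · exact (le_max_left _ _).trans h1
      · exact (le_max_right _ _).trans h1
    exact_mod_cast this
  rw [Finset.mem_Icc]
  exact ⟨fun i => (abs_le.1 (h2 i)).1, fun i => (abs_le.1 (h2 i)).2⟩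

theorem card_block_le (j : ℕ) : (block j).card ≤ 9 * 4 ^ j := by
  refine (Finset.card_filter_le _ _).trans ?_
  rw [Pi.card_Icc]
  simp only [Int.card_Icc, Finset.prod_const, Finset.card_univ, Fintype.card_fin]
  have : ((2 : ℤ) ^ j + 1 - -2 ^ j).toNat = 2 * 2 ^ j + 1 := by
    rw [show (2 : ℤ) ^ j + 1 - -2 ^ j = ((2 * 2 ^ j + 1 : ℕ) : ℤ) by push_cast; ring]
    exact Int.toNat_natCast _
  rw [this, show (4 : ℕ) = 2 ^ 2 by norm_num, ← pow_mul, mul_comm 2 j, pow_mul]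
  nlinarith [Nat.one_le_two_pow (n := j)]

theorem two_pow_level_le (n : Freq) : (2 : ℝ) ^ level n ≤ 2 * bracket n := by
  rcases Nat.eq_zero_or_pos (level n) with h | h
  · rw [h]; linarith [one_le_bracket n, pow_zero (2 : ℝ)]
  · have h1 : 2 ^ (level n).pred < max (n 0).natAbs (n 1).natAbs := by
      refine Nat.pow_pred_clog_lt_self one_lt_two ?_
      by_contra hc
      have := Nat.clog_of_right_le_one (not_lt.1 hc) 2
      rw [level, this] at h
      exact lt_irrefl _ h
    have h2 : ((max (n 0).natAbs (n 1).natAbs : ℕ) : ℝ) ≤ bracket n := by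
      refine Real.le_sqrt_of_sq_le ?_
      have e0 : (((n 0).natAbs : ℕ) : ℝ) ^ 2 = (n 0 : ℝ) ^ 2 := by
        rw [Nat.cast_natAbs, Int.cast_abs, sq_abs]
      have e1 : (((n 1).natAbs : ℕ) : ℝ) ^ 2 = (n 1 : ℝ) ^ 2 := by
        rw [Nat.cast_natAbs, Int.cast_abs, sq_abs]
      unfold freqSq
      rcases max_choice (n 0).natAbs (n 1).natAbs with h | h <;> rw [h]
      · nlinarith [sq_nonneg (n 1 : ℝ)]
      · nlinarith [sq_nonneg (n 0 : ℝ)]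
    have h3 : ((2 ^ (level n).pred : ℕ) : ℝ) ≤ ((max (n 0).natAbs (n 1).natAbs : ℕ) : ℝ) :=
      Nat.cast_le.2 h1.le
    have h4 : (2 : ℝ) ^ level n = 2 * 2 ^ (level n).pred := by
      rw [← pow_succ', Nat.pred_eq_sub_one, Nat.sub_add_cancel h]
    push_cast at h3 h2
    rw [h4]; linarith

/-- The frequencies of level `j` satisfy `2^j ≤ 2⟨n⟩`, so the `ℓ²` mass of a dyadic block decays
like `4^{-j}` when `a ∈ H¹`. -/
theorem sum_block_sq_le (j : ℕ) (a : Coeffs) :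
    4 ^ j * ∑ n ∈ block j, ‖a n‖ₑ ^ 2 ≤ 4 * sobolevNorm 1 a ^ 2 := by
  rw [sobolevNorm_one_sq, Finset.mul_sum, ← ENNReal.tsum_mul_left]
  refine le_trans (Finset.sum_le_sum fun n hn => ?_) (ENNReal.sum_le_tsum (block j))
  have h := two_pow_level_le n
  rw [mem_block.1 hn] at h
  have h' : (2 : ℝ≥0∞) ^ j ≤ 2 * ENNReal.ofReal (bracket n) := by
    have := ENNReal.ofReal_le_ofReal h
    rwa [ENNReal.ofReal_mul zero_le_two, ENNReal.ofReal_pow zero_le_two, ENNReal.ofReal_ofNat]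
      at this
  calc (4 : ℝ≥0∞) ^ j * ‖a n‖ₑ ^ 2 = (2 ^ j) ^ 2 * ‖a n‖ₑ ^ 2 := by
        rw [← pow_mul, mul_comm j 2, pow_mul]; norm_num
    _ ≤ (2 * ENNReal.ofReal (bracket n)) ^ 2 * ‖a n‖ₑ ^ 2 := by gcongr
    _ = _ := by ring

/-- Bernstein's inequality for a dyadic block: interpolate the `L^r` norm between `L²` and `L^∞`. -/
theorem eLpNorm_trigPoly_block_le {r : ℝ} (hr : 2 ≤ r) (j : ℕ) (a : Coeffs) :
    eLpNorm (trigPoly (block j) a) (ENNReal.ofReal r) torusMeasure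
      ≤ 6 * sobolevNorm 1 a * ((4⁻¹ : ℝ≥0∞) ^ (1 / r)) ^ j := by
  set E := sobolevNorm 1 a
  have hr0 : 0 < r := by linarith
  set S := ∑ n ∈ block j, ‖a n‖ₑ with hS
  set α := ∑ n ∈ block j, ‖a n‖ₑ ^ 2 with hα
  have hα' : α ≤ (6 * E) ^ 2 * 4⁻¹ ^ j := by
    have h1 : α = 4⁻¹ ^ j * (4 ^ j * α) := by
      rw [← mul_assoc, ← mul_pow, ENNReal.inv_mul_cancel (by norm_num) (by norm_num), one_pow,
        one_mul]
    rw [h1, mul_comm]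
    gcongr
    refine (sum_block_sq_le j a).trans ?_
    rw [mul_pow]
    gcongr
    norm_num
  have hS' : S ≤ 6 * E := by
    refine (ENNReal.pow_le_pow_left_iff two_ne_zero).1 ?_
    have h1 := ENNReal.rpow_sum_le_const_mul_sum_rpow (block j) (fun n => ‖a n‖ₑ)
      (one_le_two : (1 : ℝ) ≤ 2)
    norm_num at h1
    calc S ^ 2 ≤ (block j).card * α := h1
      _ ≤ ((9 * 4 ^ j : ℕ) : ℝ≥0∞) * α := by gcongr; exact card_block_le j
      _ = 9 * (4 ^ j * α) := by push_cast; ring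
      _ ≤ 9 * (4 * E ^ 2) := mul_le_mul_right (sum_block_sq_le j a) _
      _ = _ := by ring
  have hb : ∀ x, ‖trigPoly (block j) a x‖ₑ ≤ S := fun x => by
    refine (enorm_sum_le _ _).trans (le_of_eq ?_)
    simp [hS, enorm_mul, enorm_mFourier_apply]
  have h2 : ∫⁻ x, ‖trigPoly (block j) a x‖ₑ ^ 2 ∂torusMeasure = α := by
    rw [hα, ← eLpNorm_trigPoly_sq, eLpNorm_eq_lintegral_rpow_enorm_toReal (by norm_num)
      (by norm_num), ← ENNReal.rpow_natCast, ← ENNReal.rpow_mul]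
    norm_num
  rw [eLpNorm_eq_lintegral_rpow_enorm_toReal (by simpa using hr0) ENNReal.ofReal_ne_top,
    ENNReal.toReal_ofReal hr0.le]
  have key : ∫⁻ x, ‖trigPoly (block j) a x‖ₑ ^ r ∂torusMeasure ≤ (6 * E) ^ r * 4⁻¹ ^ j := by
    calc _ ≤ ∫⁻ x, (6 * E) ^ (r - 2) * ‖trigPoly (block j) a x‖ₑ ^ 2 ∂torusMeasure := by
          refine lintegral_mono fun x => ?_
          have : ‖trigPoly (block j) a x‖ₑ ^ r =
              ‖trigPoly (block j) a x‖ₑ ^ (r - 2) * ‖trigPoly (block j) a x‖ₑ ^ 2 := by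
            rw [← ENNReal.rpow_natCast, ← ENNReal.rpow_add_of_nonneg _ _ (by linarith)
              (by norm_num)]
            congr 1; push_cast; ring
          rw [this]
          gcongr
          exact (hb x).trans hS'
      _ = (6 * E) ^ (r - 2) * α := by
          rw [lintegral_const_mul _ (by
            have := (continuous_trigPoly (block j) a).measurable; fun_prop), h2]
      _ ≤ (6 * E) ^ (r - 2) * ((6 * E) ^ 2 * 4⁻¹ ^ j) := by gcongr
      _ = _ := by
          rw [← mul_assoc, ← ENNReal.rpow_natCast (6 * E) 2,
            ← ENNReal.rpow_add_of_nonneg _ _ (by linarith) (by norm_num)]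
          congr 2; push_cast; ring
  calc _ ≤ ((6 * E) ^ r * 4⁻¹ ^ j) ^ (1 / r) := by gcongr
    _ = _ := by
        rw [ENNReal.mul_rpow_of_nonneg _ _ (by positivity), ← ENNReal.rpow_mul,
          mul_one_div_cancel hr0.ne', ENNReal.rpow_one, ← ENNReal.rpow_natCast,
          ← ENNReal.rpow_mul, ← ENNReal.rpow_natCast, ← ENNReal.rpow_mul, mul_comm (1 / r)]

/-! ### Functions with prescribed Fourier coefficients -/

/-- The function with Fourier coefficients `a`, defined pointwise as the sum of the dyadic blocks
of its Fourier series. It is a measurable function of `x` and of any parameters on which `a`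
depends measurably; where the series of blocks does not converge absolutely its value is `0`. -/
def synth (a : Coeffs) (x : Torus) : ℂ := ∑' j, trigPoly (block j) a x

theorem measurable_trigPoly {α : Type*} [MeasurableSpace α] {v : α → Coeffs} {x : α → Torus}
    (F : Finset Freq) (hv : ∀ n, Measurable fun y => v y n) (hx : Measurable x) :
    Measurable fun y => trigPoly F (v y) (x y) := by
  unfold trigPoly
  exact Finset.measurable_sum _ fun n _ =>
    (hv n).mul ((mFourier n).continuous.measurable.comp hx)

theorem measurable_synth {α : Type*} [MeasurableSpace α] {v : α → Coeffs} {x : α → Torus}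
    (hv : ∀ n, Measurable fun y => v y n) (hx : Measurable x) :
    Measurable fun y => synth (v y) (x y) :=
  Measurable.tsum fun j => measurable_trigPoly (block j) hv hx

theorem measurable_synth_apply (a : Coeffs) : Measurable (synth a) :=
  measurable_synth (v := fun _ => a) (fun _ => measurable_const) measurable_id

theorem aestronglyMeasurable_trigPoly (F : Finset Freq) (a : Coeffs) :
    AEStronglyMeasurable (trigPoly F a) torusMeasure :=
  (continuous_trigPoly F a).aestronglyMeasurable

/-- The condition that the dyadic blocks of `a` are absolutely summable in `L¹(𝕋²)`. -/
def BlockSummable (a : Coeffs) : Prop :=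
  ∑' j, eLpNorm (trigPoly (block j) a) 1 torusMeasure ≠ ∞

theorem BlockSummable.ae_summable {a : Coeffs} (h : BlockSummable a) :
    ∀ᵐ x ∂torusMeasure, Summable fun j => ‖trigPoly (block j) a x‖ :=
  summable_norm_of_tsum_eLpNorm_ne_top le_rfl (fun _ => aestronglyMeasurable_trigPoly _ a) h

/-- Minkowski's inequality for the dyadic decomposition. -/
theorem eLpNorm_synth_le_tsum {a : Coeffs} (h : BlockSummable a) {r : ℝ≥0∞} (hr : 1 ≤ r) :
    eLpNorm (synth a) r torusMeasure ≤ ∑' j, eLpNorm (trigPoly (block j) a) r torusMeasure := by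
  have hlim : ∀ᵐ x ∂torusMeasure, Tendsto
      (fun N => (∑ j ∈ Finset.range N, trigPoly (block j) a) x) atTop (𝓝 (synth a x)) := by
    filter_upwards [h.ae_summable] with x hx
    simpa only [Finset.sum_apply, synth] using hx.of_norm.hasSum.tendsto_sum_nat
  refine (Lp.eLpNorm_lim_le_liminf_eLpNorm (fun N => ?_) _ hlim).trans ?_
  · exact Finset.aestronglyMeasurable_sum _ fun j _ => aestronglyMeasurable_trigPoly _ a
  · refine liminf_le_of_le (by isBoundedDefault) fun b hb => ?_
    obtain ⟨N, hN⟩ := hb.exists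
    refine hN.trans ((eLpNorm_sum_le (fun j _ => aestronglyMeasurable_trigPoly _ a) hr).trans ?_)
    exact ENNReal.sum_le_tsum _

theorem BlockSummable.integrable_synth {a : Coeffs} (h : BlockSummable a) :
    Integrable (synth a) torusMeasure :=
  memLp_one_iff_integrable.1 ⟨(measurable_synth_apply a).aestronglyMeasurable,
    (eLpNorm_synth_le_tsum h le_rfl).trans_lt h.lt_top⟩

theorem BlockSummable.mFourierCoeff_synth {a : Coeffs} (h : BlockSummable a) (n : Freq) :
    mFourierCoeff (synth a) n = a n := by
  rw [mFourierCoeff_def]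
  have h1 : ∀ j, ∫ x, mFourier (-n) x * trigPoly (block j) a x ∂torusMeasure
      = if level n = j then a n else 0 := fun j => by
    rw [← mFourierCoeff_def, mFourierCoeff_trigPoly]
    simp only [mem_block]
  simp only [synth, ← tsum_mul_left]
  rw [integral_tsum]
  · simp only [h1, @eq_comm _ (level n)]
    exact tsum_ite_eq (level n) fun _ => a n
  · intro j
    exact ((mFourier (-n)).continuous.mul (continuous_trigPoly _ a)).aestronglyMeasurable
  · simp only [enorm_mul, enorm_mFourier_apply, one_mul, ← eLpNorm_one_eq_lintegral_enorm]
    exact h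

/-- The constant in the Sobolev embedding `H¹(𝕋²) ⊂ L^r(𝕋²)`. -/
def sobolevConst (r : ℝ) : ℝ≥0∞ := 6 * (1 - (4⁻¹ : ℝ≥0∞) ^ (1 / r))⁻¹

theorem sobolevConst_ne_top {r : ℝ} (hr : 0 < r) : sobolevConst r ≠ ∞ := by
  refine ENNReal.mul_ne_top (by norm_num) (ENNReal.inv_ne_top.2 ?_)
  rw [Ne, tsub_eq_zero_iff_le, not_le]
  exact ENNReal.rpow_lt_one (by simp) (by positivity)

theorem tsum_eLpNorm_block_le {r : ℝ} (hr : 2 ≤ r) (a : Coeffs) :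
    ∑' j, eLpNorm (trigPoly (block j) a) (ENNReal.ofReal r) torusMeasure
      ≤ sobolevConst r * sobolevNorm 1 a := by
  refine (ENNReal.tsum_le_tsum fun j => eLpNorm_trigPoly_block_le hr j a).trans (le_of_eq ?_)
  rw [ENNReal.tsum_mul_left, ENNReal.tsum_geometric, sobolevConst]
  ring

theorem BlockSummable.of_memH {a : Coeffs} (h : MemH 1 a) : BlockSummable a := by
  refine ne_top_of_le_ne_top (ENNReal.mul_ne_top (sobolevConst_ne_top two_pos) h.ne)
    (le_trans ?_ (tsum_eLpNorm_block_le le_rfl a))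
  refine ENNReal.tsum_le_tsum fun j => eLpNorm_le_eLpNorm_of_exponent_le ?_
    (aestronglyMeasurable_trigPoly _ a)
  rw [ENNReal.ofReal_ofNat]; norm_num

/-- **Sobolev embedding** `H¹(𝕋²) ⊂ L^r(𝕋²)` for `2 ≤ r < ∞`. -/
theorem eLpNorm_le_sobolevNorm {r : ℝ} (hr : 2 ≤ r) {f : Torus → ℂ}
    (hf : Integrable f torusMeasure) :
    eLpNorm f (ENNReal.ofReal r) torusMeasure
      ≤ sobolevConst r * sobolevNorm 1 (mFourierCoeff f) := by
  by_cases h : MemH 1 (mFourierCoeff f)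
  · have hb := BlockSummable.of_memH h
    have : f =ᵐ[torusMeasure] synth (mFourierCoeff f) :=
      ae_eq_of_mFourierCoeff_eq hf hb.integrable_synth fun n => (hb.mFourierCoeff_synth n).symm
    rw [eLpNorm_congr_ae this]
    refine (eLpNorm_synth_le_tsum hb ?_).trans (tsum_eLpNorm_block_le hr _)
    rw [← ENNReal.ofReal_one]; exact ENNReal.ofReal_le_ofReal (by linarith)
  · rw [MemH, lt_top_iff_ne_top, not_not] at h
    rw [h, ENNReal.mul_top]
    · exact le_top
    · simp only [sobolevConst]
      refine mul_ne_zero (by norm_num) (ENNReal.inv_ne_zero.2 ?_)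
      exact ne_top_of_le_ne_top ENNReal.one_ne_top tsub_le_self

/-! ### The nonlinearity -/

theorem continuous_nonlin {p : ℝ} (hp : 1 < p) : Continuous (nonlin p) := by
  unfold nonlin
  refine (Complex.continuous_ofReal.comp (continuous_norm.rpow_const fun z => ?_)).mul
    continuous_id
  exact Or.inr (by linarith)

theorem norm_nonlin {p : ℝ} (hp : 1 < p) (z : ℂ) : ‖nonlin p z‖ = ‖z‖ ^ p := by
  rw [nonlin, norm_mul, Complex.norm_real, Real.norm_of_nonneg (by positivity)]
  rcases eq_or_ne z 0 with rfl | hz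
  · rw [norm_zero, mul_zero, Real.zero_rpow (by linarith)]
  · rw [← Real.rpow_add_one (norm_ne_zero_iff.2 hz), sub_add_cancel]

theorem enorm_nonlin {p : ℝ} (hp : 1 < p) (z : ℂ) : ‖nonlin p z‖ₑ = ‖z‖ₑ ^ p := by
  rw [← ofReal_norm, norm_nonlin hp, ← ofReal_norm,
    ENNReal.ofReal_rpow_of_nonneg (norm_nonneg _) (by linarith)]

theorem nonlin_conj (p : ℝ) (z : ℂ) :
    nonlin p (starRingEnd ℂ z) = starRingEnd ℂ (nonlin p z) := by
  simp [nonlin]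

theorem norm_nonlin_sub_le {p : ℝ} (hp : 1 < p) (z w : ℂ) :
    ‖nonlin p z - nonlin p w‖ ≤ p * (‖z‖ + ‖w‖) ^ (p - 1) * ‖z - w‖ := by
  wlog h : ‖w‖ ≤ ‖z‖ generalizing z w
  · have := this w z (le_of_not_ge h)
    rwa [norm_sub_rev, norm_sub_rev w z, add_comm ‖w‖] at this
  rcases eq_or_lt_of_le (norm_nonneg z) with hz | hz
  · have hw : ‖w‖ = 0 := le_antisymm (h.trans hz.symm.le) (norm_nonneg _)
    rw [norm_eq_zero.1 hz.symm, norm_eq_zero.1 hw]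
    simp
  set x := ‖z‖
  set y := ‖w‖
  have hy : 0 ≤ y := norm_nonneg _
  have hxy : x - y ≤ ‖z - w‖ := norm_sub_norm_le z w
  have hxp : 0 ≤ x ^ (p - 1) := by positivity
  -- Bernoulli's inequality at `y / x`
  have hbern : x ^ (p - 1) * y - y ^ (p - 1) * y ≤ (p - 1) * x ^ (p - 1) * (x - y) := by
    have h1 := one_add_mul_self_le_rpow_one_add (s := y / x - 1)
      (by linarith [div_nonneg hy hz.le]) hp.le
    rw [show 1 + (y / x - 1) = y / x by ring, Real.div_rpow hy hz.le,
      le_div_iff₀ (by positivity)] at h1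
    have e1 : x ^ p = x ^ (p - 1) * x := by
      rw [← Real.rpow_add_one hz.ne', sub_add_cancel]
    have e2 : y ^ (p - 1) * y = y ^ p := by
      rcases eq_or_lt_of_le hy with h | h
      · rw [← h, mul_zero, Real.zero_rpow (by linarith)]
      · rw [← Real.rpow_add_one h.ne', sub_add_cancel]
    rw [e2]
    have e3 : (1 + p * (y / x - 1)) * x ^ p = x ^ (p - 1) * (x + p * (y - x)) := by
      rw [e1]; field_simp
    rw [e3] at h1
    nlinarith
  have hmono : y ^ (p - 1) ≤ x ^ (p - 1) := Real.rpow_le_rpow hy h (by linarith)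
  have e : nonlin p z - nonlin p w
      = ((x ^ (p - 1) : ℝ) : ℂ) * (z - w) + ((x ^ (p - 1) - y ^ (p - 1) : ℝ) : ℂ) * w := by
    simp only [nonlin]; push_cast; ring
  rw [e]
  calc _ ≤ x ^ (p - 1) * ‖z - w‖ + (x ^ (p - 1) - y ^ (p - 1)) * y := by
        refine (norm_add_le _ _).trans (le_of_eq ?_)
        rw [norm_mul, norm_mul, Complex.norm_real, Complex.norm_real, Real.norm_of_nonneg hxp,
          Real.norm_of_nonneg (sub_nonneg.2 hmono)]
    _ ≤ x ^ (p - 1) * ‖z - w‖ + (p - 1) * x ^ (p - 1) * ‖z - w‖ := by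
        have : (p - 1) * x ^ (p - 1) * (x - y) ≤ (p - 1) * x ^ (p - 1) * ‖z - w‖ :=
          mul_le_mul_of_nonneg_left hxy (mul_nonneg (by linarith) hxp)
        linarith
    _ = p * x ^ (p - 1) * ‖z - w‖ := by ring
    _ ≤ _ := by
        gcongr
        linarith

theorem enorm_nonlin_sub_le {p : ℝ} (hp : 1 < p) (z w : ℂ) :
    ‖nonlin p z - nonlin p w‖ₑ ≤ ENNReal.ofReal p * (‖z‖ₑ + ‖w‖ₑ) ^ (p - 1) * ‖z - w‖ₑ := by
  have h := ENNReal.ofReal_le_ofReal (norm_nonlin_sub_le hp z w)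
  rw [ENNReal.ofReal_mul (by positivity), ENNReal.ofReal_mul (by linarith),
    ← ENNReal.ofReal_rpow_of_nonneg (by positivity) (by linarith),
    ENNReal.ofReal_add (norm_nonneg _) (norm_nonneg _)] at h
  simpa only [ofReal_norm] using h

theorem eLpNorm_nonlin {p : ℝ} (hp : 1 < p) (f : Torus → ℂ) :
    eLpNorm (fun x => nonlin p (f x)) 2 torusMeasure
      = eLpNorm f (ENNReal.ofReal (2 * p)) torusMeasure ^ p := by
  have hp0 : 0 < p := by linarith
  rw [eLpNorm_eq_lintegral_rpow_enorm_toReal (by norm_num) (by norm_num),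
    eLpNorm_eq_lintegral_rpow_enorm_toReal (by simpa using hp0) ENNReal.ofReal_ne_top,
    ENNReal.toReal_ofReal (by positivity), ← ENNReal.rpow_mul]
  simp only [enorm_nonlin hp, ← ENNReal.rpow_mul, ENNReal.toReal_ofNat]
  rw [mul_comm p 2]
  congr 1
  field_simp

theorem eLpNorm_nonlin_sub_le {p : ℝ} (hp : 1 < p) {f g : Torus → ℂ}
    (hf : AEStronglyMeasurable f torusMeasure) (hg : AEStronglyMeasurable g torusMeasure) :
    eLpNorm (fun x => nonlin p (f x) - nonlin p (g x)) 2 torusMeasure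
      ≤ ENNReal.ofReal p * (eLpNorm f (ENNReal.ofReal (2 * p)) torusMeasure
          + eLpNorm g (ENNReal.ofReal (2 * p)) torusMeasure) ^ (p - 1)
        * eLpNorm (fun x => f x - g x) (ENNReal.ofReal (2 * p)) torusMeasure := by
  have hp0 : 0 < p := by linarith
  have hp1 : 0 < p - 1 := by linarith
  set A : Torus → ℝ≥0∞ := fun x => ‖f x‖ₑ + ‖g x‖ₑ with hA
  set B : Torus → ℝ≥0∞ := fun x => ‖f x - g x‖ₑ with hB
  have hAm : AEMeasurable A torusMeasure := hf.enorm.add hg.enorm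
  have hBm : AEMeasurable B torusMeasure := (hf.sub hg).enorm
  have h2p : ENNReal.ofReal (2 * p) ≠ 0 := by simpa using hp0
  have nrm : ∀ h : Torus → ℂ, eLpNorm h (ENNReal.ofReal (2 * p)) torusMeasure
      = (∫⁻ x, ‖h x‖ₑ ^ (2 * p) ∂torusMeasure) ^ (1 / (2 * p)) := fun h => by
    rw [eLpNorm_eq_lintegral_rpow_enorm_toReal h2p ENNReal.ofReal_ne_top,
      ENNReal.toReal_ofReal (by positivity)]
  have hAn : (∫⁻ x, A x ^ (2 * p) ∂torusMeasure) ^ (1 / (2 * p))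
      ≤ eLpNorm f (ENNReal.ofReal (2 * p)) torusMeasure
        + eLpNorm g (ENNReal.ofReal (2 * p)) torusMeasure := by
    rw [nrm, nrm]
    exact ENNReal.lintegral_Lp_add_le hf.enorm hg.enorm (by linarith)
  have hconj : (p / (p - 1)).HolderConjugate p := (Real.HolderConjugate.conjExponent hp).symm
  have hold := ENNReal.lintegral_mul_le_Lp_mul_Lq torusMeasure hconj
    (hAm.pow_const (2 * (p - 1))) (hBm.pow_const (2 : ℝ))
  simp only [Pi.mul_apply, ← ENNReal.rpow_mul] at hold
  rw [show 2 * (p - 1) * (p / (p - 1)) = 2 * p by field_simp] at hold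
  have hpt : ∀ x, ‖nonlin p (f x) - nonlin p (g x)‖ₑ ^ (2 : ℝ)
      ≤ ENNReal.ofReal p ^ (2 : ℝ) * (A x ^ (2 * (p - 1)) * B x ^ (2 : ℝ)) := fun x => by
    refine (ENNReal.rpow_le_rpow (enorm_nonlin_sub_le hp (f x) (g x)) zero_le_two).trans
      (le_of_eq ?_)
    rw [ENNReal.mul_rpow_of_nonneg _ _ zero_le_two, ENNReal.mul_rpow_of_nonneg _ _ zero_le_two,
      ← ENNReal.rpow_mul, mul_comm (p - 1) 2, mul_assoc]
  rw [eLpNorm_eq_lintegral_rpow_enorm_toReal (by norm_num) (by norm_num), ENNReal.toReal_ofNat]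
  calc _ ≤ (ENNReal.ofReal p ^ (2 : ℝ) * ((∫⁻ x, A x ^ (2 * p) ∂torusMeasure) ^ (1 / (p / (p - 1)))
          * (∫⁻ x, B x ^ (2 * p) ∂torusMeasure) ^ (1 / p))) ^ (1 / 2 : ℝ) := by
        refine ENNReal.rpow_le_rpow ?_ (by norm_num)
        refine (lintegral_mono hpt).trans ?_
        rw [lintegral_const_mul' _ _ (ENNReal.rpow_ne_top_of_nonneg zero_le_two ENNReal.ofReal_ne_top)]
        gcongr
    _ = ENNReal.ofReal p * ((∫⁻ x, A x ^ (2 * p) ∂torusMeasure) ^ (1 / (2 * p))) ^ (p - 1)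
          * eLpNorm (fun x => f x - g x) (ENNReal.ofReal (2 * p)) torusMeasure := by
        rw [nrm, ENNReal.mul_rpow_of_nonneg _ _ (by norm_num),
          ENNReal.mul_rpow_of_nonneg _ _ (by norm_num), ← ENNReal.rpow_mul, ← ENNReal.rpow_mul,
          ← ENNReal.rpow_mul, ← ENNReal.rpow_mul, ← mul_assoc]
        congr 2
        · norm_num
        · congr 1; field_simp
        · field_simp
    _ ≤ _ := by gcongr

/-! ### The Duhamel operator -/

theorem abs_symS_le {t : ℝ} (ht : 0 ≤ t) (n : Freq) : |symS t n| ≤ t := by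
  have hJ := symJ_pos n
  rw [symS, abs_mul, abs_div, Real.abs_exp, abs_of_pos hJ]
  have h1 : |Real.sin (t * symJ n)| / symJ n ≤ t := by
    rw [div_le_iff₀ hJ]
    exact Real.abs_sin_le_abs.trans (le_of_eq (abs_of_nonneg (by positivity)))
  refine (mul_le_of_le_one_left (by positivity) (Real.exp_le_one_iff.2 ?_)).trans h1
  nlinarith [symD_nonneg n]

/-- The spatial norm `‖F(t)‖_{L^r(𝕋²)}` of a space-time function. -/
def sliceNorm (r : ℝ) (F : ℝ × Torus → ℂ) (t : ℝ) : ℝ≥0∞ :=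
  eLpNorm (fun x => F (t, x)) (ENNReal.ofReal r) torusMeasure

theorem measurable_sliceNorm {r : ℝ} (hr : 0 < r) {F : ℝ × Torus → ℂ} (hF : Measurable F) :
    Measurable (sliceNorm r F) := by
  have : ∀ t, sliceNorm r F t = (∫⁻ x, ‖F (t, x)‖ₑ ^ r ∂torusMeasure) ^ (1 / r) := fun t => by
    rw [sliceNorm, eLpNorm_eq_lintegral_rpow_enorm_toReal (by simpa using hr)
      ENNReal.ofReal_ne_top, ENNReal.toReal_ofReal hr.le]
  rw [funext this]
  exact ((hF.enorm.pow_const r).lintegral_prod_right').pow_const _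

theorem measurable_slice {F : ℝ × Torus → ℂ} (hF : Measurable F) (t : ℝ) :
    Measurable fun x => F (t, x) := hF.comp measurable_prodMk_left

theorem measurable_mFourierCoeff_slice {F : ℝ × Torus → ℂ} (hF : Measurable F) (n : Freq) :
    Measurable fun t => mFourierCoeff (fun x => F (t, x)) n := by
  have h : StronglyMeasurable (Function.uncurry fun (t : ℝ) (x : Torus) =>
      mFourier (-n) x * F (t, x)) := by
    refine Measurable.stronglyMeasurable ?_
    exact ((mFourier (-n)).continuous.measurable.comp measurable_snd).mul hF
  exact (h.integral_prod_right (ν := torusMeasure)).measurable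

/-- The Duhamel integral `∫_0^t S(t - t') F(t') dt'`. -/
def duhamel (F : ℝ × Torus → ℂ) (t : ℝ) : Coeffs := fun n =>
  ∫ t' in (0 : ℝ)..t, ((symS (t - t') n : ℝ) : ℂ) * mFourierCoeff (fun x => F (t', x)) n

theorem tsum_enorm_mFourierCoeff_slice_sq {F : ℝ × Torus → ℂ} (hF : Measurable F) {t : ℝ}
    (ht : sliceNorm 2 F t ≠ ∞) :
    ∑' n, ‖mFourierCoeff (fun x => F (t, x)) n‖ₑ ^ 2 = sliceNorm 2 F t ^ 2 := by
  rw [sliceNorm, ENNReal.ofReal_ofNat] at *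
  exact tsum_enorm_mFourierCoeff_sq ⟨(measurable_slice hF t).aestronglyMeasurable, ht.lt_top⟩

theorem enorm_mFourierCoeff_slice_le {F : ℝ × Torus → ℂ} (hF : Measurable F) {t : ℝ} (n : Freq) :
    ‖mFourierCoeff (fun x => F (t, x)) n‖ₑ ≤ sliceNorm 2 F t := by
  refine (enorm_mFourierCoeff_le _ n).trans ?_
  rw [← eLpNorm_one_eq_lintegral_enorm, sliceNorm]
  refine eLpNorm_le_eLpNorm_of_exponent_le ?_ (measurable_slice hF t).aestronglyMeasurable
  rw [ENNReal.ofReal_ofNat]; norm_num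

theorem bracket_mul_enorm_duhamel_le (F : ℝ × Torus → ℂ) {t T : ℝ} (ht : t ∈ Set.Icc 0 T)
    (n : Freq) :
    ENNReal.ofReal (bracket n) * ‖duhamel F t n‖ₑ
      ≤ ∫⁻ t' in Set.Icc 0 T, ‖mFourierCoeff (fun x => F (t', x)) n‖ₑ := by
  rw [duhamel, intervalIntegral.integral_of_le ht.1]
  calc _ ≤ ENNReal.ofReal (bracket n) * ∫⁻ t' in Set.Ioc 0 t, ‖((symS (t - t') n : ℝ) : ℂ)
          * mFourierCoeff (fun x => F (t', x)) n‖ₑ := by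
        gcongr; exact enorm_integral_le_lintegral_enorm _
    _ = ∫⁻ t' in Set.Ioc 0 t, ENNReal.ofReal (bracket n) * ‖((symS (t - t') n : ℝ) : ℂ)
          * mFourierCoeff (fun x => F (t', x)) n‖ₑ := by
        rw [lintegral_const_mul' _ _ ENNReal.ofReal_ne_top]
    _ ≤ ∫⁻ t' in Set.Ioc 0 t, ‖mFourierCoeff (fun x => F (t', x)) n‖ₑ := by
        refine setLIntegral_mono_ae' measurableSet_Ioc (Eventually.of_forall fun t' ht' => ?_)
        rw [enorm_mul, ← mul_assoc]
        refine mul_le_of_le_one_left' ?_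
        rw [← ofReal_norm, Complex.norm_real, Real.norm_eq_abs,
          ← ENNReal.ofReal_mul (bracket_pos n).le, ← ENNReal.ofReal_one]
        exact ENNReal.ofReal_le_ofReal (bracket_mul_abs_symS_le_one (sub_nonneg.2 ht'.2) n)
    _ ≤ _ := lintegral_mono_set
        (Set.Ioc_subset_Icc_self.trans (Set.Icc_subset_Icc_right ht.2))

/-- The energy estimate, in the form of a summable majorant of the squared Fourier modes that is
uniform in time. -/
theorem exists_duhamel_majorant {F : ℝ × Torus → ℂ} (hF : Measurable F) {T : ℝ}
    (hT : ∫⁻ t in Set.Icc 0 T, sliceNorm 2 F t ≠ ∞) :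
    ∃ β : Freq → ℝ≥0∞, ∑' n, β n ≤ (∫⁻ t in Set.Icc 0 T, sliceNorm 2 F t) ^ 2 ∧
      ∀ t ∈ Set.Icc 0 T, ∀ n, (ENNReal.ofReal (bracket n) * ‖duhamel F t n‖ₑ) ^ 2 ≤ β n := by
  set m := sliceNorm 2 F with hm
  set M := ∫⁻ t in Set.Icc 0 T, m t with hM
  have hmm : Measurable m := measurable_sliceNorm two_pos hF
  have hc : ∀ n, Measurable fun t => ‖mFourierCoeff (fun x => F (t, x)) n‖ₑ := fun n =>
    (measurable_mFourierCoeff_slice hF n).enorm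
  have hfin : ∀ᵐ t ∂(volume.restrict (Set.Icc 0 T)), m t < ∞ := ae_lt_top hmm hT
  -- Cauchy–Schwarz in time with the weight `m`, which turns the `L¹_t L²_x` norm of `F`
  -- into an `ℓ²` sum over the modes
  refine ⟨fun n => M * ∫⁻ t in Set.Icc 0 T,
    ‖mFourierCoeff (fun x => F (t, x)) n‖ₑ ^ 2 * (m t)⁻¹, ?_, fun t ht n => ?_⟩
  · rw [ENNReal.tsum_mul_left, ← lintegral_tsum fun n => by
      exact (((hc n).pow_const 2).mul hmm.inv).aemeasurable, sq]
    gcongr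
    refine lintegral_mono_ae (hfin.mono fun t ht => ?_)
    rw [ENNReal.tsum_mul_right, tsum_enorm_mFourierCoeff_slice_sq hF ht.ne]
    change m t ^ 2 * (m t)⁻¹ ≤ m t
    rw [sq, mul_assoc]
    exact mul_le_of_le_one_right' (ENNReal.mul_inv_le_one _)
  · have h1 : ∫⁻ t' in Set.Icc 0 T, ‖mFourierCoeff (fun x => F (t', x)) n‖ₑ
        ≤ ∫⁻ t' in Set.Icc 0 T, m t' ^ (1 / 2 : ℝ)
          * (‖mFourierCoeff (fun x => F (t', x)) n‖ₑ * (m t')⁻¹ ^ (1 / 2 : ℝ)) := by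
      refine lintegral_mono_ae (hfin.mono fun t' ht' => ?_)
      rcases eq_or_ne (m t') 0 with h0 | h0
      · have := enorm_mFourierCoeff_slice_le hF (t := t') n
        rw [← hm, h0, nonpos_iff_eq_zero] at this
        simp only [this, zero_le]
      · rw [mul_comm, mul_assoc, ← ENNReal.mul_rpow_of_nonneg _ _ (by norm_num),
          ENNReal.inv_mul_cancel h0 ht'.ne, ENNReal.one_rpow, mul_one]
    have h2 := ENNReal.lintegral_mul_le_Lp_mul_Lq (volume.restrict (Set.Icc 0 T))
      Real.HolderConjugate.two_two (hmm.pow_const (1 / 2 : ℝ)).aemeasurable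
      ((hc n).mul (hmm.inv.pow_const (1 / 2 : ℝ))).aemeasurable
    have h3 := ((bracket_mul_enorm_duhamel_le F ht n).trans h1).trans h2
    refine (pow_le_pow_left' h3 2).trans (le_of_eq ?_)
    rw [mul_pow, ← ENNReal.rpow_natCast, ← ENNReal.rpow_natCast, ← ENNReal.rpow_mul,
      ← ENNReal.rpow_mul]
    norm_num
    congr 1
    · refine lintegral_congr fun t => ?_
      rw [← ENNReal.rpow_natCast, ← ENNReal.rpow_mul]; norm_num
    · refine lintegral_congr fun t => ?_
      rw [mul_pow, ← ENNReal.rpow_natCast (n := 2) (x := (m t)⁻¹ ^ (1 / 2 : ℝ)),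
        ← ENNReal.rpow_mul]
      norm_num

/-- The energy estimate `‖∫_0^t S(t - t') F(t') dt'‖_{H¹} ≤ ∫_0^t ‖F(t')‖_{L²} dt'`. -/
theorem sobolevNorm_duhamel_le {F : ℝ × Torus → ℂ} (hF : Measurable F) {t : ℝ} (ht : 0 ≤ t) :
    sobolevNorm 1 (duhamel F t) ≤ ∫⁻ t' in Set.Icc 0 t, sliceNorm 2 F t' := by
  by_cases hT : ∫⁻ t' in Set.Icc 0 t, sliceNorm 2 F t' = ∞
  · rw [hT]; exact le_top
  obtain ⟨β, h1, h2⟩ := exists_duhamel_majorant hF hT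
  refine (ENNReal.pow_le_pow_left_iff two_ne_zero).1 (le_trans ?_ h1)
  rw [sobolevNorm_one_sq]
  exact ENNReal.tsum_le_tsum fun n => h2 t ⟨ht, le_rfl⟩ n

theorem integrableOn_mFourierCoeff_slice {F : ℝ × Torus → ℂ} (hF : Measurable F) {T : ℝ}
    (hT : ∫⁻ t in Set.Icc 0 T, sliceNorm 2 F t ≠ ∞) (n : Freq) :
    IntegrableOn (fun t => mFourierCoeff (fun x => F (t, x)) n) (Set.Icc 0 T) :=
  ⟨(measurable_mFourierCoeff_slice hF n).aestronglyMeasurable,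
    (lintegral_mono fun _ => enorm_mFourierCoeff_slice_le hF n).trans_lt hT.lt_top⟩

theorem continuousOn_duhamel {F : ℝ × Torus → ℂ} (hF : Measurable F) {T : ℝ}
    (hT : ∫⁻ t in Set.Icc 0 T, sliceNorm 2 F t ≠ ∞) (n : Freq) :
    ContinuousOn (fun t => duhamel F t n) (Set.Icc 0 T) := by
  -- `S(0) = 0`, so the kernel extends continuously by zero to negative times
  have hint := integrableOn_mFourierCoeff_slice hF hT n
  have hcont : Continuous fun t => ∫ t' in Set.Icc 0 T,
      ((symS (max (t - t') 0) n : ℝ) : ℂ) * mFourierCoeff (fun x => F (t', x)) n := by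
    refine continuous_of_dominated (bound := fun t' => ‖mFourierCoeff (fun x => F (t', x)) n‖)
      (fun t => ?_) (fun t => Eventually.of_forall fun t' => ?_) hint.norm
      (Eventually.of_forall fun t' => ?_)
    · refine AEStronglyMeasurable.mul ?_ hint.aestronglyMeasurable
      have := continuous_symS n
      exact (by fun_prop : Continuous fun t' => ((symS (max (t - t') 0) n : ℝ) : ℂ)).aestronglyMeasurable
    · rw [norm_mul, Complex.norm_real, Real.norm_eq_abs]
      refine mul_le_of_le_one_left (norm_nonneg _) ?_
      have h1 := bracket_mul_abs_symS_le_one (le_max_right (t - t') 0) n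
      exact (le_mul_of_one_le_left (abs_nonneg _) (one_le_bracket n)).trans h1
    · have := continuous_symS n
      fun_prop
  refine hcont.continuousOn.congr fun t ht => ?_
  simp only [duhamel]
  rw [intervalIntegral.integral_of_le ht.1, ← integral_Icc_eq_integral_Ioc]
  refine Eq.trans ?_ (setIntegral_eq_of_subset_of_forall_sdiff_eq_zero measurableSet_Icc
    (Set.Icc_subset_Icc_right ht.2) fun t' ht' => ?_).symm
  · refine setIntegral_congr_fun measurableSet_Icc fun t' ht' => ?_
    simp only [max_eq_left (sub_nonneg.2 ht'.2)]
  · have : t - t' ≤ 0 := by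
      by_contra hc
      exact ht'.2 ⟨ht'.1.1, by linarith⟩
    rw [max_eq_right this, symS_zero]; simp

theorem tendsto_sobolevNorm_duhamel_sub {F : ℝ × Torus → ℂ} (hF : Measurable F) {T : ℝ}
    (hT : ∫⁻ t in Set.Icc 0 T, sliceNorm 2 F t ≠ ∞) {t₀ : ℝ} (ht₀ : t₀ ∈ Set.Icc 0 T) :
    Tendsto (fun t => sobolevNorm 1 (duhamel F t - duhamel F t₀)) (𝓝[Set.Icc 0 T] t₀) (𝓝 0) := by
  obtain ⟨β, h1, h2⟩ := exists_duhamel_majorant hF hT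
  have hsq : Tendsto (fun t => sobolevNorm 1 (duhamel F t - duhamel F t₀) ^ 2)
      (𝓝[Set.Icc 0 T] t₀) (𝓝 0) := by
    simp only [sobolevNorm_one_sq, ← lintegral_count]
    have h0 : ∫⁻ _ : Freq, (0 : ℝ≥0∞) ∂Measure.count = 0 := lintegral_zero
    rw [← h0]
    refine tendsto_lintegral_filter_of_dominated_convergence (fun n => 4 * β n)
      (Eventually.of_forall fun t => measurable_of_countable _) ?_ ?_ ?_
    · filter_upwards [self_mem_nhdsWithin] with t ht
      refine Eventually.of_forall fun n => ?_
      have ha := h2 t ht n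
      have hb := h2 t₀ ht₀ n
      calc (ENNReal.ofReal (bracket n) * ‖duhamel F t n - duhamel F t₀ n‖ₑ) ^ 2
          ≤ (ENNReal.ofReal (bracket n) * ‖duhamel F t n‖ₑ
            + ENNReal.ofReal (bracket n) * ‖duhamel F t₀ n‖ₑ) ^ 2 := by
            rw [← mul_add]; gcongr; exact enorm_sub_le
        _ ≤ 2 * ((ENNReal.ofReal (bracket n) * ‖duhamel F t n‖ₑ) ^ 2
            + (ENNReal.ofReal (bracket n) * ‖duhamel F t₀ n‖ₑ) ^ 2) := by
            have := ENNReal.rpow_add_le_mul_rpow_add_rpow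
              (ENNReal.ofReal (bracket n) * ‖duhamel F t n‖ₑ)
              (ENNReal.ofReal (bracket n) * ‖duhamel F t₀ n‖ₑ) (one_le_two : (1 : ℝ) ≤ 2)
            norm_num at this
            exact this
        _ ≤ 2 * (β n + β n) := by gcongr
        _ = 4 * β n := by ring
    · rw [lintegral_count, ENNReal.tsum_mul_left]
      exact ENNReal.mul_ne_top (by norm_num) (ne_top_of_le_ne_top (ENNReal.pow_ne_top hT) h1)
    · refine Eventually.of_forall fun n => ?_
      have hc : Tendsto (fun t => duhamel F t n - duhamel F t₀ n) (𝓝[Set.Icc 0 T] t₀) (𝓝 0) := by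
        have := (continuousOn_duhamel hF hT n t₀ ht₀).tendsto.sub_const (duhamel F t₀ n)
        rwa [sub_self] at this
      have h3 := (continuous_enorm.tendsto _).comp hc
      rw [enorm_zero] at h3
      have h4 := ENNReal.Tendsto.const_mul (a := ENNReal.ofReal (bracket n)) h3
        (Or.inr ENNReal.ofReal_ne_top)
      have h5 := ENNReal.Tendsto.pow (n := 2) h4
      simpa using h5
  have h := (ENNReal.continuous_rpow_const (y := 1 / 2)).tendsto 0 |>.comp hsq
  have e : ∀ x : ℝ≥0∞, (x ^ 2) ^ (1 / 2 : ℝ) = x := fun x => by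
    rw [← ENNReal.rpow_natCast, ← ENNReal.rpow_mul]; norm_num
  simp only [Function.comp_def, e] at h
  rwa [ENNReal.zero_rpow_of_pos (by norm_num)] at h

theorem memCH_duhamel {F : ℝ × Torus → ℂ} (hF : Measurable F) {T σ : ℝ} (hσ : σ ≤ 1)
    (hT : ∫⁻ t in Set.Icc 0 T, sliceNorm 2 F t ≠ ∞) : MemCH T σ (duhamel F) := by
  refine ⟨fun t ht => ?_, fun t₀ ht₀ => ?_⟩
  · refine (sobolevNorm_mono hσ _).trans_lt ((sobolevNorm_duhamel_le hF ht.1).trans_lt ?_)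
    exact (lintegral_mono_set (Set.Icc_subset_Icc_right ht.2)).trans_lt hT.lt_top
  · exact tendsto_of_tendsto_of_tendsto_of_le_of_le tendsto_const_nhds
      (tendsto_sobolevNorm_duhamel_sub hF hT ht₀) (fun _ => zero_le)
      fun _ => sobolevNorm_mono hσ _

/-- The Duhamel integral vanishes to first order at `t = 0`, because `S(0) = 0`. -/
theorem hasDerivWithinAt_duhamel {F : ℝ × Torus → ℂ} (hF : Measurable F) {T : ℝ} (hT0 : 0 ≤ T)
    (hT : ∫⁻ t in Set.Icc 0 T, sliceNorm 2 F t ≠ ∞) (n : Freq) :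
    HasDerivWithinAt (fun t => duhamel F t n) 0 (Set.Icc 0 T) 0 := by
  have hint := integrableOn_mFourierCoeff_slice hF hT n
  have hprim : Tendsto (fun t => ∫ t' in Set.Icc 0 t, ‖mFourierCoeff (fun x => F (t', x)) n‖)
      (𝓝[Set.Icc 0 T] 0) (𝓝 0) := by
    have := intervalIntegral.continuousOn_primitive_Icc hint.norm 0 ⟨le_rfl, hT0⟩
    simpa [ContinuousWithinAt] using this
  rw [hasDerivWithinAt_iff_isLittleO, Asymptotics.isLittleO_iff]
  intro c hc
  filter_upwards [self_mem_nhdsWithin, hprim.eventually (ge_mem_nhds hc)] with t ht hct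
  have h0 : duhamel F 0 n = 0 := by simp [duhamel]
  simp only [h0, sub_zero, smul_zero]
  rw [duhamel, intervalIntegral.integral_of_le ht.1, ← integral_Icc_eq_integral_Ioc,
    Real.norm_of_nonneg ht.1]
  have hint' : IntegrableOn (fun t => ‖mFourierCoeff (fun x => F (t, x)) n‖) (Set.Icc 0 t) :=
    IntegrableOn.mono_set hint.norm (Set.Icc_subset_Icc_right ht.2)
  calc _ ≤ ∫ t' in Set.Icc 0 t, t * ‖mFourierCoeff (fun x => F (t', x)) n‖ := by
        refine norm_integral_le_of_norm_le (hint'.const_mul t) ?_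
        refine (ae_restrict_mem measurableSet_Icc).mono fun t' ht' => ?_
        rw [norm_mul, Complex.norm_real, Real.norm_eq_abs]
        gcongr
        refine (abs_symS_le (sub_nonneg.2 ht'.2) n).trans ?_
        linarith [ht'.1]
    _ ≤ c * t := by
        rw [integral_const_mul, mul_comm]
        gcongr
        exact ht.1

/-! ### The linear evolution of rough data -/

theorem bracket_le_one_add_symD (n : Freq) : bracket n ≤ 1 + symD n / 2 := by
  have h0 := Real.sqrt_nonneg (freqSq n)
  have h1 : bracket n ≤ 1 + Real.sqrt (freqSq n) := by
    refine Real.sqrt_le_iff.2 ⟨by positivity, ?_⟩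
    nlinarith [Real.sq_sqrt (freqSq_nonneg n)]
  have h2 : symD n / 2 = Real.pi * Real.sqrt (freqSq n) := by unfold symD; ring
  rw [h2]
  nlinarith [Real.pi_gt_three]

/-- Parabolic smoothing: the damping `e^{-tD/2}` gains any number of derivatives at `t > 0`. -/
theorem bracket_rpow_mul_exp_le {k t : ℝ} (hk : 0 < k) (ht : 0 < t) (n : Freq) :
    bracket n ^ k * Real.exp (-(symD n / 2) * t) ≤ (k / t) ^ k * Real.exp t := by
  have hb := bracket_pos n
  have h1 : (t / k * bracket n) ^ k ≤ Real.exp (t * bracket n) := by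
    have : t / k * bracket n ≤ Real.exp (t / k * bracket n) :=
      (by linarith [Real.add_one_le_exp (t / k * bracket n)])
    refine (Real.rpow_le_rpow (by positivity) this hk.le).trans (le_of_eq ?_)
    rw [← Real.exp_mul]; congr 1; field_simp
  have h2 : bracket n ^ k = (k / t) ^ k * (t / k * bracket n) ^ k := by
    rw [← Real.mul_rpow (by positivity) (by positivity)]; congr 1; field_simp
  rw [h2, mul_assoc]
  gcongr
  calc _ ≤ Real.exp (t * bracket n) * Real.exp (-(symD n / 2) * t) := by gcongr
    _ = Real.exp (t * bracket n - symD n / 2 * t) := by rw [← Real.exp_add]; ring_nf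
    _ ≤ Real.exp t := by
        refine Real.exp_le_exp.2 ?_
        nlinarith [bracket_le_one_add_symD n]

/-- For `0 < t ≤ 1` and `-1 ≤ s ≤ 0` the damping turns `s` derivatives into the factor `t^s`. -/
theorem exp_le_rpow_mul_bracket_rpow {s t : ℝ} (hs : -1 ≤ s) (hs0 : s ≤ 0) (ht : 0 < t)
    (ht1 : t ≤ 1) (n : Freq) :
    Real.exp (-(symD n / 2) * t) ≤ t ^ s * bracket n ^ s := by
  have hb := bracket_pos n
  have hD := symD_nonneg n
  have h1 : t * bracket n ≤ Real.exp (symD n / 2 * t) := by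
    have := Real.add_one_le_exp (symD n / 2 * t)
    nlinarith [bracket_le_one_add_symD n]
  have h2 : (t * bracket n) ^ (-s) ≤ Real.exp (symD n / 2 * t) := by
    refine (Real.rpow_le_rpow (by positivity) h1 (by linarith)).trans ?_
    rw [← Real.exp_mul]
    refine Real.exp_le_exp.2 (mul_le_of_le_one_right (by positivity) (by linarith))
  rw [← Real.mul_rpow ht.le hb.le, neg_mul, Real.exp_neg, ← neg_neg s,
    Real.rpow_neg (by positivity)]
  exact inv_anti₀ (by positivity) h2

theorem abs_symV_le_rpow {s t : ℝ} (hs : -1 ≤ s) (hs0 : s ≤ 0) (ht : 0 < t) (ht1 : t ≤ 1)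
    (n : Freq) : |symV t n| ≤ 2 * (t ^ s * bracket n ^ s) :=
  (abs_symV_le t n).trans
    (mul_le_mul_of_nonneg_left (exp_le_rpow_mul_bracket_rpow hs hs0 ht ht1 n) zero_le_two)

theorem abs_symS_le_rpow {s t : ℝ} (hs : -1 ≤ s) (hs0 : s ≤ 0) (ht : 0 < t) (ht1 : t ≤ 1)
    (n : Freq) : |symS t n| ≤ t ^ s * bracket n ^ (s - 1) := by
  have h := (bracket_mul_abs_symS_le t n).trans (exp_le_rpow_mul_bracket_rpow hs hs0 ht ht1 n)
  rw [Real.rpow_sub_one (bracket_pos n).ne', ← mul_div_assoc, le_div_iff₀ (bracket_pos n)]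
  linarith

theorem enorm_add_sq_le (x y : ℝ≥0∞) : (x + y) ^ 2 ≤ 2 * (x ^ 2 + y ^ 2) := by
  have := ENNReal.rpow_add_le_mul_rpow_add_rpow x y (one_le_two : (1 : ℝ) ≤ 2)
  norm_num at this
  exact this

/-- By parabolic smoothing the linear evolution of rough data lies in `H¹` at positive times. -/
theorem memH_one_propV {s t : ℝ} (hs : s < 1) (ht : 0 < t) {a b : Coeffs} (hab : MemHH s a b) :
    MemH 1 (propV t a b) := by
  have hk : 0 < 1 - s := by linarith
  set C := ((1 - s) / t) ^ (1 - s) * Real.exp t with hC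
  have hC0 : 0 ≤ C := by positivity
  have hpt : ∀ n, ENNReal.ofReal (bracket n) * ‖propV t a b n‖ₑ
      ≤ ENNReal.ofReal (2 * C) * (ENNReal.ofReal (bracket n ^ s) * ‖a n‖ₑ
        + ENNReal.ofReal (bracket n ^ (s - 1)) * ‖b n‖ₑ) := fun n => by
    have hb := bracket_pos n
    have key : bracket n * Real.exp (-(symD n / 2) * t) ≤ C * bracket n ^ s := by
      have h1 := bracket_rpow_mul_exp_le hk ht n
      have h2 : bracket n = bracket n ^ (1 - s) * bracket n ^ s := by
        rw [← Real.rpow_add hb]; simp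
      calc _ = (bracket n ^ (1 - s) * Real.exp (-(symD n / 2) * t)) * bracket n ^ s := by
            conv_lhs => rw [h2]
            ring
        _ ≤ _ := mul_le_mul_of_nonneg_right h1 (by positivity)
    have hV : bracket n * |symV t n| ≤ 2 * C * bracket n ^ s := by
      have := mul_le_mul_of_nonneg_left (abs_symV_le t n) hb.le
      linarith
    have hS : bracket n * |symS t n| ≤ 2 * C * bracket n ^ (s - 1) := by
      refine (bracket_mul_abs_symS_le t n).trans ?_
      rw [Real.rpow_sub_one hb.ne', ← mul_div_assoc, le_div_iff₀ hb]
      have : 0 ≤ C * bracket n ^ s := by positivity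
      linarith
    rw [← ofReal_norm, ← ofReal_norm, ← ofReal_norm, ← ENNReal.ofReal_mul hb.le,
      ← ENNReal.ofReal_mul (by positivity), ← ENNReal.ofReal_mul (by positivity),
      ← ENNReal.ofReal_add (by positivity) (by positivity), ← ENNReal.ofReal_mul (by positivity)]
    refine ENNReal.ofReal_le_ofReal ?_
    rw [propV_apply]
    calc _ ≤ bracket n * (|symV t n| * ‖a n‖ + |symS t n| * ‖b n‖) := by
          gcongr
          refine (norm_add_le _ _).trans (le_of_eq ?_)
          simp
      _ = (bracket n * |symV t n|) * ‖a n‖ + (bracket n * |symS t n|) * ‖b n‖ := by ring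
      _ ≤ (2 * C * bracket n ^ s) * ‖a n‖ + (2 * C * bracket n ^ (s - 1)) * ‖b n‖ := by gcongr
      _ = _ := by ring
  have hsq : sobolevNorm 1 (propV t a b) ^ 2 ≤ ENNReal.ofReal (2 * C) ^ 2
      * (2 * (sobolevNorm s a ^ 2 + sobolevNorm (s - 1) b ^ 2)) := by
    rw [sobolevNorm_one_sq, sobolevNorm_sq, sobolevNorm_sq, ← ENNReal.tsum_add,
      ← ENNReal.tsum_mul_left, ← ENNReal.tsum_mul_left]
    refine ENNReal.tsum_le_tsum fun n => ?_
    refine (pow_le_pow_left' (hpt n) 2).trans ?_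
    rw [mul_pow]
    gcongr
    exact enorm_add_sq_le _ _
  have hfin : sobolevNorm 1 (propV t a b) ^ 2 < ∞ := by
    refine hsq.trans_lt (ENNReal.mul_lt_top (by finiteness) ?_)
    have h1 := hab.1.ne
    have h2 := hab.2.ne
    finiteness
  exact lt_top_iff_ne_top.2 fun h => by simp [h] at hfin

theorem measurable_propV (a b : Coeffs) (n : Freq) : Measurable fun t => propV t a b n := by
  have h1 := continuous_symV n
  have h2 := continuous_symS n
  simp only [propV_apply]
  exact (by fun_prop : Continuous fun t => (symV t n : ℂ) * a n + (symS t n : ℂ) * b n).measurable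

/-- The space-time function synthesized from a curve of distributions. -/
def synthCurve (v : ℝ → Coeffs) (y : ℝ × Torus) : ℂ := synth (v y.1) y.2

theorem measurable_synthCurve {v : ℝ → Coeffs} (hv : ∀ n, Measurable fun t => v t n) :
    Measurable (synthCurve v) :=
  measurable_synth (v := fun y : ℝ × Torus => v y.1) (fun n => (hv n).comp measurable_fst)
    measurable_snd

theorem isGivenBy_synthCurve {T : ℝ} {v : ℝ → Coeffs} (hv : ∀ n, Measurable fun t => v t n)
    (h : ∀ᵐ t ∂(volume.restrict (Set.Icc 0 T)), MemH 1 (v t)) :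
    IsGivenBy T v (synthCurve v) := by
  refine ⟨(measurable_synthCurve hv).aestronglyMeasurable, h.mono fun t ht => ?_⟩
  have hb := BlockSummable.of_memH ht
  exact ⟨hb.integrable_synth, hb.mFourierCoeff_synth⟩

theorem IsGivenBy.add {T : ℝ} {v w : ℝ → Coeffs} {f g : ℝ × Torus → ℂ}
    (hf : IsGivenBy T v f) (hg : IsGivenBy T w g) :
    IsGivenBy T (fun t => v t + w t) (fun y => f y + g y) := by
  refine ⟨hf.1.add hg.1, ?_⟩
  filter_upwards [hf.2, hg.2] with t h1 h2
  refine ⟨h1.1.add h2.1, fun n => ?_⟩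
  rw [mFourierCoeff_add h1.1 h2.1, h1.2, h2.2]; rfl

theorem ae_pos_restrict_Icc (T : ℝ) : ∀ᵐ t ∂(volume.restrict (Set.Icc 0 T)), 0 < t := by
  rw [← restrict_Ioc_eq_restrict_Icc]
  exact (ae_restrict_mem measurableSet_Ioc).mono fun t ht => ht.1

theorem isGivenBy_propV {s T : ℝ} (hs : s < 1) {a b : Coeffs} (hab : MemHH s a b) :
    IsGivenBy T (fun t => propV t a b) (synthCurve fun t => propV t a b) :=
  isGivenBy_synthCurve (measurable_propV a b)
    ((ae_pos_restrict_Icc T).mono fun _ ht => memH_one_propV hs ht hab)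

theorem duhamel_sub {F G : ℝ × Torus → ℂ} (hF : Measurable F) (hG : Measurable G) {T : ℝ}
    (hFT : ∫⁻ t in Set.Icc 0 T, sliceNorm 2 F t ≠ ∞)
    (hGT : ∫⁻ t in Set.Icc 0 T, sliceNorm 2 G t ≠ ∞) {t : ℝ} (ht : t ∈ Set.Icc 0 T) :
    duhamel F t - duhamel G t = duhamel (fun y => F y - G y) t := by
  have hint : ∀ {F : ℝ × Torus → ℂ}, Measurable F →
      ∫⁻ t in Set.Icc 0 T, sliceNorm 2 F t ≠ ∞ → ∀ᵐ t' ∂(volume.restrict (Set.Ioc 0 t)),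
        Integrable (fun x => F (t', x)) torusMeasure := fun {F} hF hFT => by
    have h1 := ae_lt_top (measurable_sliceNorm two_pos hF) hFT
    refine (ae_restrict_of_ae_restrict_of_subset
      (Set.Ioc_subset_Icc_self.trans (Set.Icc_subset_Icc_right ht.2)) h1).mono fun t' ht' => ?_
    rw [sliceNorm, ENNReal.ofReal_ofNat] at ht'
    exact MemLp.integrable one_le_two ⟨(measurable_slice hF t').aestronglyMeasurable, ht'⟩
  have hii : ∀ {F : ℝ × Torus → ℂ}, Measurable F →
      ∫⁻ t in Set.Icc 0 T, sliceNorm 2 F t ≠ ∞ → ∀ n, IntegrableOn (fun t' =>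
        ((symS (t - t') n : ℝ) : ℂ) * mFourierCoeff (fun x => F (t', x)) n) (Set.Ioc 0 t) :=
    fun {F} hF hFT n => by
      have h1 := (integrableOn_mFourierCoeff_slice hF hFT n).mono_set
        (Set.Ioc_subset_Icc_self.trans (Set.Icc_subset_Icc_right ht.2))
      have h2 := continuous_symS n
      refine Integrable.bdd_mul (c := t) h1 (by fun_prop : Continuous fun t' =>
        ((symS (t - t') n : ℝ) : ℂ)).aestronglyMeasurable ?_
      refine (ae_restrict_mem measurableSet_Ioc).mono fun t' ht' => ?_
      rw [Complex.norm_real, Real.norm_eq_abs]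
      exact (abs_symS_le (sub_nonneg.2 ht'.2) n).trans (by linarith [ht'.1])
  ext n
  simp only [duhamel, Pi.sub_apply, intervalIntegral.integral_of_le ht.1]
  rw [← integral_sub (hii hF hFT n) (hii hG hGT n)]
  refine integral_congr_ae ?_
  filter_upwards [hint hF hFT, hint hG hGT] with t' h1 h2
  rw [mFourierCoeff_sub h1 h2, mul_sub]

/-- **Grönwall's inequality** with an integrable weight: a bounded `D` with
`D(t) ≤ ∫_0^t k D` vanishes. -/
theorem eq_zero_of_le_lintegral_mul {D k : ℝ → ℝ≥0∞} {T : ℝ} {B : ℝ≥0∞} (hB : B ≠ ∞)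
    (hk : ∫⁻ t in Set.Icc 0 T, k t ≠ ∞) (hDB : ∀ t ∈ Set.Icc 0 T, D t ≤ B)
    (hD : ∀ t ∈ Set.Icc 0 T, D t ≤ ∫⁻ t' in Set.Icc 0 t, k t' * D t') :
    ∀ t ∈ Set.Icc 0 T, D t = 0 := by
  -- on time steps `η` with `∫ k < 1/2` the bound contracts; proceed step by step
  obtain ⟨η, hη, hηk⟩ := exists_pos_setLIntegral_lt_of_measure_lt hk
    (by norm_num : (1 / 2 : ℝ≥0∞) ≠ 0)
  obtain ⟨e, he0, heη⟩ : ∃ e : ℝ, 0 < e ∧ ENNReal.ofReal e < η := by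
    obtain ⟨e, he⟩ := exists_between hη
    refine ⟨e.toReal, ENNReal.toReal_pos he.1.ne' (he.2.trans_le le_top).ne, ?_⟩
    rw [ENNReal.ofReal_toReal (he.2.trans_le le_top).ne]; exact he.2
  have step : ∀ N : ℕ, ∀ t ∈ Set.Icc 0 T, t ≤ N * e → D t = 0 := by
    intro N
    induction N with
    | zero =>
      intro t ht htN
      have h0 : t = 0 := le_antisymm (by simpa using htN) ht.1
      have := hD t ht
      rw [h0] at this ⊢
      simpa using this
    | succ N ih =>
      set I := {t | t ∈ Set.Icc 0 T ∧ t ≤ (N + 1 : ℕ) * e} with hI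
      set S := ⨆ t ∈ I, D t with hS
      have hSB : S ≤ B := iSup₂_le fun t ht => hDB t ht.1
      have hhalf : S ≤ S * (1 / 2) := by
        refine iSup₂_le fun t ht => (hD t ht.1).trans ?_
        calc ∫⁻ t' in Set.Icc 0 t, k t' * D t'
            ≤ ∫⁻ t' in Set.Icc 0 t, (Set.Ioc (N * e) t).indicator (fun t' => S * k t') t' := by
              refine setLIntegral_mono_ae' measurableSet_Icc
                (Eventually.of_forall fun t' ht' => ?_)
              have htT : t' ∈ Set.Icc 0 T := ⟨ht'.1, ht'.2.trans ht.1.2⟩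
              by_cases h : t' ≤ N * e
              · rw [ih t' htT h, mul_zero]; exact zero_le
              · rw [Set.indicator_of_mem (show t' ∈ Set.Ioc (N * e) t from ⟨not_le.1 h, ht'.2⟩), mul_comm]
                gcongr
                exact le_iSup₂_of_le t' ⟨htT, ht'.2.trans ht.2⟩ le_rfl
          _ = ∫⁻ t' in Set.Icc 0 t ∩ Set.Ioc (N * e) t, S * k t' := by
              rw [lintegral_indicator measurableSet_Ioc, Measure.restrict_restrict
                measurableSet_Ioc, Set.inter_comm]
          _ = S * ∫⁻ t' in Set.Icc 0 t ∩ Set.Ioc (N * e) t, k t' :=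
              lintegral_const_mul' _ _ (ne_top_of_le_ne_top hB hSB)
          _ ≤ S * ∫⁻ t' in Set.Ioc (N * e) t, k t' ∂(volume.restrict (Set.Icc 0 T)) := by
              rw [Measure.restrict_restrict measurableSet_Ioc]
              refine mul_le_mul' le_rfl (lintegral_mono_set ?_)
              refine Set.subset_inter Set.inter_subset_right ?_
              exact Set.inter_subset_left.trans (Set.Icc_subset_Icc_right ht.1.2)
          _ ≤ S * (1 / 2) := by
              gcongr
              refine (hηk _ ?_).le
              refine (Measure.restrict_apply_le _ _).trans_lt (lt_of_le_of_lt ?_ heη)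
              rw [Real.volume_Ioc]
              refine ENNReal.ofReal_le_ofReal ?_
              have := ht.2
              push_cast at this
              linarith
      have hS0 : S = 0 := by
        by_contra h0
        have h2 : S * (1 / 2) < S := by
          rw [one_div, ← div_eq_mul_inv]
          exact ENNReal.half_lt_self h0 (ne_top_of_le_ne_top hB hSB)
        exact absurd hhalf (not_le.2 h2)
      intro t ht htN
      have : D t ≤ S := le_iSup₂_of_le (f := fun t (_ : t ∈ I) => D t) t ⟨ht, htN⟩ le_rfl
      rwa [hS0, nonpos_iff_eq_zero] at this
  intro t ht
  obtain ⟨N, hN⟩ := exists_nat_ge (t / e)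
  exact step N t ht ((div_le_iff₀ he0).1 hN)

/-! ### Uniqueness -/

/-- `w` solves the Duhamel equation, and the function `f` that gives it lies in
`L^p([0,T]; L^{2p}(𝕋²))`, so that the nonlinearity lies in `L¹([0,T]; L²(𝕋²))`. -/
structure IsRegularSolution (p T : ℝ) (a b : Coeffs) (w : ℝ → Coeffs) (f : ℝ × Torus → ℂ) :
    Prop where
  measurable : Measurable f
  given : IsGivenBy T w f
  finite : ∫⁻ t in Set.Icc 0 T, sliceNorm (2 * p) f t ^ p ≠ ∞
  eq : ∀ t ∈ Set.Icc 0 T, w t = propV t a b - duhamel (fun y => nonlin p (f y)) t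

theorem sliceNorm_nonlin {p : ℝ} (hp : 1 < p) (f : ℝ × Torus → ℂ) (t : ℝ) :
    sliceNorm 2 (fun y => nonlin p (f y)) t = sliceNorm (2 * p) f t ^ p := by
  rw [sliceNorm, sliceNorm, ENNReal.ofReal_ofNat]
  exact eLpNorm_nonlin hp _

theorem measurable_nonlin_comp {p : ℝ} (hp : 1 < p) {f : ℝ × Torus → ℂ} (hf : Measurable f) :
    Measurable fun y => nonlin p (f y) := (continuous_nonlin hp).measurable.comp hf

theorem IsRegularSolution.lintegral_nonlin {p T : ℝ} (hp : 1 < p) {a b : Coeffs}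
    {w : ℝ → Coeffs} {f : ℝ × Torus → ℂ} (h : IsRegularSolution p T a b w f) :
    ∫⁻ t in Set.Icc 0 T, sliceNorm 2 (fun y => nonlin p (f y)) t ≠ ∞ := by
  simpa only [sliceNorm_nonlin hp] using h.finite

theorem ae_of_ae_restrict_Icc {T t : ℝ} (ht : t ∈ Set.Icc 0 T) {P : ℝ → Prop}
    (h : ∀ᵐ t' ∂(volume.restrict (Set.Icc 0 T)), P t') :
    ∀ᵐ t' ∂(volume.restrict (Set.Icc 0 t)), P t' :=
  ae_restrict_of_ae_restrict_of_subset (Set.Icc_subset_Icc_right ht.2) h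

theorem rpow_le_one_add_rpow {p q : ℝ} (hp : 0 ≤ p) (hpq : p ≤ q) (x : ℝ≥0∞) :
    x ^ p ≤ 1 + x ^ q := by
  rcases le_total x 1 with h | h
  · exact (ENNReal.rpow_le_one h hp).trans le_self_add
  · exact (ENNReal.rpow_le_rpow_of_exponent_le h hpq).trans le_add_self

/-- A solution in the class `V(t)(a,b) + L^q([0,T]; L^r)` is regular: the Fourier coefficients
identify the function given by the solution with the sum of the linear evolution and of the
function in `L^q([0,T]; L^r)`. -/
theorem IsSolution.exists_isRegularSolution {p q r s T : ℝ} (hp : 1 < p) (hs : s < 1)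
    (hpq : p ≤ q) (hpr : 2 * p ≤ r) {a b : Coeffs} (hab : MemHH s a b)
    (hz : ∫⁻ t in Set.Icc 0 T, sliceNorm (2 * p) (synthCurve fun t => propV t a b) t ^ p ≠ ∞)
    {w : ℝ → Coeffs} (hw : IsSolution p T a b w)
    (hL : MemLL T q r fun t => w t - propV t a b) :
    ∃ f, IsRegularSolution p T a b w f := by
  obtain ⟨f₀, hg₀, -, hd⟩ := hw
  obtain ⟨g, hg, hgfin⟩ := hL
  have hzg := isGivenBy_propV (T := T) hs hab
  set z := synthCurve fun t => propV t a b with hz_def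
  have hzm : Measurable z := measurable_synthCurve (measurable_propV a b)
  set f := hg₀.1.mk f₀ with hf
  have hfm : Measurable f := hg₀.1.stronglyMeasurable_mk.measurable
  have hae : ∀ᵐ t ∂(volume.restrict (Set.Icc 0 T)), ∀ᵐ x ∂torusMeasure, f₀ (t, x) = f (t, x) :=
    Measure.ae_ae_of_ae_prod hg₀.1.ae_eq_mk
  have hfg : IsGivenBy T w f := by
    refine ⟨hfm.aestronglyMeasurable, ?_⟩
    filter_upwards [hae, hg₀.2] with t h1 h2
    refine ⟨h2.1.congr h1, fun n => ?_⟩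
    rw [← h2.2 n]
    exact mFourierCoeff_congr (h1.mono fun x hx => hx.symm) n
  refine ⟨f, hfm, hfg, ?_, fun t ht => ?_⟩
  · have hle : ∀ᵐ t ∂(volume.restrict (Set.Icc 0 T)), sliceNorm (2 * p) f t ^ p
        ≤ 2 ^ (p - 1) * ((1 + sliceNorm r g t ^ q) + sliceNorm (2 * p) z t ^ p) := by
      filter_upwards [hfg.2, (hg.add hzg).2, hg.2, hzg.2] with t h1 h2 h3 h4
      have heq : (fun x => f (t, x)) =ᵐ[torusMeasure] fun x => g (t, x) + z (t, x) :=
        ae_eq_of_mFourierCoeff_eq h1.1 h2.1 fun n => by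
          rw [h1.2, h2.2]; simp
      have h5 : sliceNorm (2 * p) f t ≤ sliceNorm r g t + sliceNorm (2 * p) z t := by
        simp only [sliceNorm]
        rw [eLpNorm_congr_ae heq]
        refine (eLpNorm_add_le h3.1.1 h4.1.1 ?_).trans ?_
        · rw [← ENNReal.ofReal_one]; exact ENNReal.ofReal_le_ofReal (by linarith)
        · gcongr
          exact eLpNorm_le_eLpNorm_of_exponent_le (ENNReal.ofReal_le_ofReal hpr) h3.1.1
      calc _ ≤ (sliceNorm r g t + sliceNorm (2 * p) z t) ^ p := by gcongr
        _ ≤ 2 ^ (p - 1) * (sliceNorm r g t ^ p + sliceNorm (2 * p) z t ^ p) :=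
            ENNReal.rpow_add_le_mul_rpow_add_rpow _ _ hp.le
        _ ≤ _ := by
            gcongr
            exact rpow_le_one_add_rpow (by linarith) hpq _
    refine ne_top_of_le_ne_top ?_ (lintegral_mono_ae hle)
    rw [lintegral_const_mul' _ _ (by finiteness), lintegral_add_right _
      ((measurable_sliceNorm (by linarith) hzm).pow_const _), lintegral_add_left measurable_const]
    have hq : ∫⁻ t in Set.Icc 0 T, sliceNorm r g t ^ q ≠ ∞ := by
      have := lintegral_rpow_enorm_lt_top_of_eLpNorm_lt_top
        (by simpa using (by linarith : 0 < q)) ENNReal.ofReal_ne_top hgfin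
      rw [ENNReal.toReal_ofReal (by linarith)] at this
      exact this.ne
    have h1 : ∫⁻ _ in Set.Icc 0 T, (1 : ℝ≥0∞) ≠ ∞ := by simp
    finiteness
  · ext n
    rw [hd t ht n]
    simp only [Pi.sub_apply, duhamel]
    congr 1
    rw [intervalIntegral.integral_of_le ht.1, intervalIntegral.integral_of_le ht.1,
      ← integral_Icc_eq_integral_Ioc, ← integral_Icc_eq_integral_Ioc]
    refine integral_congr_ae ((ae_of_ae_restrict_Icc ht hae).mono fun t' ht' => ?_)
    simp only
    rw [mFourierCoeff_congr (g := fun x => nonlin p (f (t', x)))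
      (ht'.mono fun x hx => by simp only [hx]) n]

/-- The energy estimate for the difference of two nonlinearities, by Hölder's inequality. -/
theorem sliceNorm_nonlin_sub_le {p : ℝ} (hp : 1 < p) {f g : ℝ × Torus → ℂ} (hf : Measurable f)
    (hg : Measurable g) (t : ℝ) :
    sliceNorm 2 (fun y => nonlin p (f y) - nonlin p (g y)) t
      ≤ ENNReal.ofReal p * (sliceNorm (2 * p) f t + sliceNorm (2 * p) g t) ^ (p - 1)
        * sliceNorm (2 * p) (fun y => f y - g y) t := by
  simp only [sliceNorm, ENNReal.ofReal_ofNat]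
  exact eLpNorm_nonlin_sub_le hp (measurable_slice hf t).aestronglyMeasurable
    (measurable_slice hg t).aestronglyMeasurable

/-- Regular solutions are unique: the difference of two of them vanishes by Grönwall's inequality
for its `H¹` norm, whose weight `(‖f₁‖ + ‖f₂‖)^{p-1}`, in `L^{2p}` norms, is integrable in time. -/
theorem IsRegularSolution.unique {p T : ℝ} (hp : 1 < p) {a b : Coeffs} {w₁ w₂ : ℝ → Coeffs}
    {f₁ f₂ : ℝ × Torus → ℂ} (h₁ : IsRegularSolution p T a b w₁ f₁)
    (h₂ : IsRegularSolution p T a b w₂ f₂) : ∀ t ∈ Set.Icc 0 T, w₁ t = w₂ t := by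
  have hm₁ := measurable_nonlin_comp hp h₁.measurable
  have hm₂ := measurable_nonlin_comp hp h₂.measurable
  set G : ℝ × Torus → ℂ := fun y => nonlin p (f₂ y) - nonlin p (f₁ y) with hG
  have hGm : Measurable G := hm₂.sub hm₁
  have hdiff : ∀ t ∈ Set.Icc 0 T, w₁ t - w₂ t = duhamel G t := fun t ht => by
    rw [h₁.eq t ht, h₂.eq t ht, hG, ← duhamel_sub hm₂ hm₁ (h₂.lintegral_nonlin hp)
      (h₁.lintegral_nonlin hp) ht]
    abel
  have hs₁ := measurable_sliceNorm (by linarith : 0 < 2 * p) h₁.measurable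
  have hs₂ := measurable_sliceNorm (by linarith : 0 < 2 * p) h₂.measurable
  set D : ℝ → ℝ≥0∞ := fun t => sobolevNorm 1 (w₁ t - w₂ t) with hD
  set k : ℝ → ℝ≥0∞ := fun t => ENNReal.ofReal p * sobolevConst (2 * p) *
    (sliceNorm (2 * p) f₂ t + sliceNorm (2 * p) f₁ t) ^ (p - 1) with hk
  have hcs := sobolevConst_ne_top (by linarith : 0 < 2 * p)
  have hk_fin : ∫⁻ t in Set.Icc 0 T, k t ≠ ∞ := by
    rw [hk, lintegral_const_mul' _ _ (by finiteness)]
    refine ENNReal.mul_ne_top (by finiteness) ?_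
    have hle : ∀ t, (sliceNorm (2 * p) f₂ t + sliceNorm (2 * p) f₁ t) ^ (p - 1)
        ≤ 1 + 2 ^ (p - 1) * (sliceNorm (2 * p) f₂ t ^ p + sliceNorm (2 * p) f₁ t ^ p) :=
      fun t => (rpow_le_one_add_rpow (by linarith) (by linarith : p - 1 ≤ p) _).trans (by
        gcongr; exact ENNReal.rpow_add_le_mul_rpow_add_rpow _ _ hp.le)
    refine ne_top_of_le_ne_top ?_ (lintegral_mono hle)
    rw [lintegral_add_left measurable_const, lintegral_const_mul' _ _ (by finiteness),
      lintegral_add_left (hs₂.pow_const _)]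
    have h1 := h₁.finite
    have h2 := h₂.finite
    have h3 : ∫⁻ _ in Set.Icc 0 T, (1 : ℝ≥0∞) ≠ ∞ := by simp
    finiteness
  -- the two functions differ by the function with coefficients `w₁ - w₂`, to which the
  -- Sobolev embedding applies
  have hG_le : ∀ᵐ t ∂(volume.restrict (Set.Icc 0 T)), sliceNorm 2 G t ≤ k t * D t := by
    filter_upwards [h₁.given.2, h₂.given.2] with t h1 h2
    refine (sliceNorm_nonlin_sub_le hp h₂.measurable h₁.measurable t).trans ?_
    have hc : mFourierCoeff (fun x => f₂ (t, x) - f₁ (t, x)) = -(w₁ t - w₂ t) := by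
      ext n
      rw [mFourierCoeff_sub h2.1 h1.1, h1.2, h2.2]; simp
    have h3 := eLpNorm_le_sobolevNorm (by linarith : 2 ≤ 2 * p) (h2.1.sub h1.1)
    rw [show (fun x => f₂ (t, x)) - (fun x => f₁ (t, x)) = fun x => f₂ (t, x) - f₁ (t, x)
      from rfl, hc, sobolevNorm_neg] at h3
    calc _ ≤ ENNReal.ofReal p * (sliceNorm (2 * p) f₂ t + sliceNorm (2 * p) f₁ t) ^ (p - 1)
          * (sobolevConst (2 * p) * D t) := by gcongr; exact h3
      _ = _ := by rw [hk]; ring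
  have hD_le : ∀ t ∈ Set.Icc 0 T, D t ≤ ∫⁻ t' in Set.Icc 0 t, sliceNorm 2 G t' := fun t ht => by
    rw [hD]; simp only
    rw [hdiff t ht]
    exact sobolevNorm_duhamel_le hGm ht.1
  have hB : ∫⁻ t in Set.Icc 0 T, sliceNorm 2 G t ≠ ∞ := by
    have hle : ∀ t, sliceNorm 2 G t ≤ sliceNorm 2 (fun y => nonlin p (f₂ y)) t
        + sliceNorm 2 (fun y => nonlin p (f₁ y)) t := fun t => by
      simp only [sliceNorm, ENNReal.ofReal_ofNat]
      exact eLpNorm_sub_le (measurable_slice hm₂ t).aestronglyMeasurable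
        (measurable_slice hm₁ t).aestronglyMeasurable (by norm_num)
    refine ne_top_of_le_ne_top ?_ (lintegral_mono hle)
    rw [lintegral_add_left (measurable_sliceNorm two_pos hm₂)]
    exact ENNReal.add_ne_top.2 ⟨h₂.lintegral_nonlin hp, h₁.lintegral_nonlin hp⟩
  have hzero := eq_zero_of_le_lintegral_mul hB hk_fin
    (fun t ht => (hD_le t ht).trans (lintegral_mono_set (Set.Icc_subset_Icc_right ht.2)))
    (fun t ht => (hD_le t ht).trans (lintegral_mono_ae (ae_of_ae_restrict_Icc ht hG_le)))
  intro t ht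
  exact sub_eq_zero.1 (sobolevNorm_eq_zero (hzero t ht))

theorem mFourierCoeff_conj (f : Torus → ℂ) (n : Freq) :
    mFourierCoeff (fun x => starRingEnd ℂ (f x)) n = starRingEnd ℂ (mFourierCoeff f (-n)) := by
  rw [mFourierCoeff_def, mFourierCoeff_def, ← integral_conj]
  refine integral_congr_ae (Eventually.of_forall fun x => ?_)
  simp only [map_mul, ← UnitAddTorus.mFourier_neg, neg_neg]

/-- For real data the complex conjugate of a solution is a solution. -/
theorem IsRegularSolution.conj {p T : ℝ} {a b : Coeffs} {w : ℝ → Coeffs} {f : ℝ × Torus → ℂ}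
    (h : IsRegularSolution p T a b w f) (ha : IsRealDistribution a) (hb : IsRealDistribution b) :
    IsRegularSolution p T a b (fun t n => starRingEnd ℂ (w t (-n)))
      (fun y => starRingEnd ℂ (f y)) := by
  have hcm : Measurable (starRingEnd ℂ) := Complex.continuous_conj.measurable
  refine ⟨hcm.comp h.measurable,
    ⟨(hcm.comp h.measurable).aestronglyMeasurable, h.given.2.mono fun t ht => ?_⟩, ?_,
    fun t ht => ?_⟩
  · refine ⟨⟨(hcm.comp_aemeasurable ht.1.1.aemeasurable).aestronglyMeasurable, ?_⟩, fun n => ?_⟩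
    · refine ht.1.2.congr' ?_
      exact Eventually.of_forall fun x => by simp
    · rw [mFourierCoeff_conj, ht.2]
  · convert! h.finite using 4 with t
    exact eLpNorm_congr_norm_ae (Eventually.of_forall fun x => by simp)
  · ext n
    rw [h.eq t ht]
    simp only [Pi.sub_apply, map_sub, propV_apply, map_add, map_mul, Complex.conj_ofReal,
      symV_neg, symS_neg, ha n, hb n, Complex.conj_conj]
    congr 1
    simp only [duhamel, intervalIntegral.integral_of_le ht.1]
    rw [← integral_conj]
    refine integral_congr_ae (Eventually.of_forall fun t' => ?_)
    simp only [map_mul, Complex.conj_ofReal, symS_neg, nonlin_conj]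
    rw [mFourierCoeff_conj]

theorem IsRegularSolution.isRealDistribution {p T : ℝ} (hp : 1 < p) {a b : Coeffs}
    {w : ℝ → Coeffs} {f : ℝ × Torus → ℂ} (h : IsRegularSolution p T a b w f)
    (ha : IsRealDistribution a) (hb : IsRealDistribution b) {t : ℝ} (ht : t ∈ Set.Icc 0 T) :
    IsRealDistribution (w t) := fun n => by
  have := congrFun (h.unique hp (h.conj ha hb) t ht) (-n)
  simpa using this

/-! ### Existence -/

/-- The space `ℓ²(ℤ²)`, which parametrizes `H¹(𝕋²)` through `x ↦ ⟨n⟩⁻¹ x(n)`. -/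
abbrev EllTwo : Type := lp (fun _ : Freq => ℂ) 2

/-- The element of `H¹` parametrized by a square-summable sequence. -/
def ofEllTwo (x : EllTwo) : Coeffs := fun n => ((bracket n)⁻¹ : ℝ) * x n

theorem ofEllTwo_sub (x y : EllTwo) : ofEllTwo (x - y) = ofEllTwo x - ofEllTwo y := by
  ext n; simp [ofEllTwo, mul_sub]

theorem enorm_sq_ellTwo (x : EllTwo) : ‖x‖ₑ ^ 2 = ∑' n, ‖x n‖ₑ ^ 2 := by
  have h2 : 0 < (2 : ℝ≥0∞).toReal := by norm_num
  have h := lp.norm_rpow_eq_tsum h2 x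
  have hs := (lp.memℓp x).summable h2
  simp only [ENNReal.toReal_ofNat, Real.rpow_ofNat] at h hs
  have e : ∀ {E : Type} [NormedAddCommGroup E] (z : E), ‖z‖ₑ ^ 2 = ENNReal.ofReal (‖z‖ ^ 2) :=
    fun z => by rw [ENNReal.ofReal_pow (norm_nonneg _), ofReal_norm]
  simp only [e]
  rw [h, ENNReal.ofReal_tsum_of_nonneg (fun n => by positivity) hs]

theorem sobolevNorm_ofEllTwo (x : EllTwo) : sobolevNorm 1 (ofEllTwo x) = ‖x‖ₑ := by
  refine (ENNReal.pow_right_strictMono two_ne_zero).injective ?_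
  rw [sobolevNorm_one_sq, enorm_sq_ellTwo]
  refine tsum_congr fun n => ?_
  have hb := bracket_pos n
  rw [ofEllTwo, enorm_mul, ← mul_assoc, ← ofReal_norm (E := ℂ) ((bracket n)⁻¹ : ℝ),
    Complex.norm_real, Real.norm_of_nonneg (by positivity), ← ENNReal.ofReal_mul hb.le,
    mul_inv_cancel₀ hb.ne', ENNReal.ofReal_one, one_mul]

theorem exists_ofEllTwo_eq {a : Coeffs} (ha : MemH 1 a) : ∃ x : EllTwo, ofEllTwo x = a := by
  have hm : Memℓp (fun n => (bracket n : ℂ) * a n) 2 := by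
    refine memℓp_gen ?_
    have h : ∑' n, ENNReal.ofReal (‖(bracket n : ℂ) * a n‖ ^ 2) ≠ ∞ := by
      have h1 : sobolevNorm 1 a ^ 2 ≠ ∞ := ENNReal.pow_ne_top ha.ne
      rw [sobolevNorm_one_sq] at h1
      convert h1 using 3 with n
      rw [ENNReal.ofReal_pow (norm_nonneg _), norm_mul, ENNReal.ofReal_mul (norm_nonneg _),
        ofReal_norm (a n), Complex.norm_real, Real.norm_of_nonneg (bracket_pos n).le]
    have h2 := ENNReal.summable_toReal h
    simp only [ENNReal.toReal_ofNat, Real.rpow_ofNat]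
    exact h2.congr fun n => ENNReal.toReal_ofReal (by positivity)
  refine ⟨⟨_, hm⟩, ?_⟩
  ext n
  have : (bracket n : ℂ) ≠ 0 := by exact_mod_cast (bracket_pos n).ne'
  change ((bracket n)⁻¹ : ℝ) * ((bracket n : ℂ) * a n) = a n
  push_cast
  field_simp

section Curve

variable {T : ℝ}

/-- The curve in `H¹` parametrized by a continuous curve in `ℓ²` on `[0,T]`, extended to all times
by its values at the end points. -/
def curve (hT : 0 ≤ T) (h : C(Set.Icc 0 T, EllTwo)) (t : ℝ) : Coeffs :=
  ofEllTwo (h (Set.projIcc 0 T hT t))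

theorem measurable_curve (hT : 0 ≤ T) (h : C(Set.Icc 0 T, EllTwo)) (n : Freq) :
    Measurable fun t => curve hT h t n := by
  have h1 : Continuous fun t => h (Set.projIcc 0 T hT t) :=
    h.continuous.comp continuous_projIcc
  have h2 : Continuous fun x : EllTwo => x n :=
    (lp.uniformContinuous_coe (E := fun _ : Freq => ℂ) (p := 2)).continuous |>.comp
      continuous_id |> (continuous_apply n).comp
  exact (continuous_const.mul (h2.comp h1)).measurable

theorem sobolevNorm_curve_sub_le (hT : 0 ≤ T) (h g : C(Set.Icc 0 T, EllTwo)) (t : ℝ) :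
    sobolevNorm 1 (curve hT h t - curve hT g t) ≤ edist h g := by
  rw [curve, curve, ← ofEllTwo_sub, sobolevNorm_ofEllTwo, ← edist_eq_enorm_sub, edist_dist,
    edist_dist]
  exact ENNReal.ofReal_le_ofReal (ContinuousMap.dist_apply_le_dist _)

theorem sobolevNorm_curve_le (hT : 0 ≤ T) (h : C(Set.Icc 0 T, EllTwo)) (t : ℝ) :
    sobolevNorm 1 (curve hT h t) ≤ ‖h‖ₑ := by
  rw [curve, sobolevNorm_ofEllTwo, ← ofReal_norm, ← ofReal_norm]
  exact ENNReal.ofReal_le_ofReal (ContinuousMap.norm_coe_le_norm h _)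

theorem memH_curve (hT : 0 ≤ T) (h : C(Set.Icc 0 T, EllTwo)) (t : ℝ) : MemH 1 (curve hT h t) :=
  (sobolevNorm_curve_le hT h t).trans_lt enorm_lt_top

theorem sliceNorm_synthCurve_curve_le (hT : 0 ≤ T) {r : ℝ} (hr : 2 ≤ r)
    (h : C(Set.Icc 0 T, EllTwo)) (t : ℝ) :
    sliceNorm r (synthCurve (curve hT h)) t ≤ sobolevConst r * ‖h‖ₑ := by
  have hb := BlockSummable.of_memH (memH_curve hT h t)
  refine (eLpNorm_le_sobolevNorm hr hb.integrable_synth).trans ?_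
  rw [funext hb.mFourierCoeff_synth]
  gcongr
  exact sobolevNorm_curve_le hT h t

theorem sliceNorm_synthCurve_curve_sub_le (hT : 0 ≤ T) {r : ℝ} (hr : 2 ≤ r)
    (h g : C(Set.Icc 0 T, EllTwo)) (t : ℝ) :
    sliceNorm r (fun y => synthCurve (curve hT h) y - synthCurve (curve hT g) y) t
      ≤ sobolevConst r * edist h g := by
  have hb := BlockSummable.of_memH (memH_curve hT h t)
  have hb' := BlockSummable.of_memH (memH_curve hT g t)
  refine (eLpNorm_le_sobolevNorm hr (hb.integrable_synth.sub hb'.integrable_synth)).trans ?_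
  have : mFourierCoeff (synth (curve hT h t) - synth (curve hT g t))
      = curve hT h t - curve hT g t := by
    ext n
    rw [show synth (curve hT h t) - synth (curve hT g t) = fun x => synth (curve hT h t) x -
      synth (curve hT g t) x from rfl, mFourierCoeff_sub hb.integrable_synth hb'.integrable_synth,
      hb.mFourierCoeff_synth, hb'.mFourierCoeff_synth]
    rfl
  rw [this]
  gcongr
  exact sobolevNorm_curve_sub_le hT h g t

/-- The Duhamel integral of a forcing in `L¹([0,T]; L²)` is a continuous curve in `H¹`. -/
theorem exists_curve_eq_neg_duhamel (hT : 0 ≤ T) {F : ℝ × Torus → ℂ} (hF : Measurable F)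
    (hFT : ∫⁻ t in Set.Icc 0 T, sliceNorm 2 F t ≠ ∞) :
    ∃ h : C(Set.Icc 0 T, EllTwo), ∀ t ∈ Set.Icc 0 T, curve hT h t = -duhamel F t := by
  have hC := memCH_duhamel hF le_rfl hFT
  have hmem : ∀ t : Set.Icc 0 T, MemH 1 (-duhamel F t) := fun t => by
    rw [MemH, sobolevNorm_neg]; exact hC.1 t t.2
  choose x hx using fun t : Set.Icc 0 T => exists_ofEllTwo_eq (hmem t)
  have hcont : Continuous x := by
    rw [continuous_iff_continuousAt]
    intro t₀
    rw [ContinuousAt, tendsto_iff_edist_tendsto_0]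
    have h1 := hC.2 t₀ t₀.2
    have h2 : Tendsto (fun t : Set.Icc 0 T => (t : ℝ)) (𝓝 t₀) (𝓝[Set.Icc 0 T] (t₀ : ℝ)) :=
      tendsto_nhdsWithin_of_tendsto_nhds_of_eventually_within _
        (continuous_subtype_val.tendsto _) (Eventually.of_forall fun t => t.2)
    refine (h1.comp h2).congr fun t => ?_
    rw [edist_eq_enorm_sub, ← sobolevNorm_ofEllTwo, ofEllTwo_sub, hx, hx, Function.comp_apply,
      ← sobolevNorm_neg]
    congr 1; abel
  refine ⟨⟨x, hcont⟩, fun t ht => ?_⟩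
  rw [curve, Set.projIcc_of_mem hT ht]
  exact hx ⟨t, ht⟩

theorem edist_le_of_sobolevNorm_curve_sub_le (hT : 0 ≤ T) {h g : C(Set.Icc 0 T, EllTwo)}
    {B : ℝ≥0∞} (hB : ∀ t ∈ Set.Icc 0 T, sobolevNorm 1 (curve hT h t - curve hT g t) ≤ B) :
    edist h g ≤ B := by
  by_cases hBt : B = ∞
  · rw [hBt]; exact le_top
  rw [edist_dist]
  refine ENNReal.ofReal_le_of_le_toReal ?_
  rw [ContinuousMap.dist_le ENNReal.toReal_nonneg]
  intro t
  have h1 := hB t t.2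
  rw [curve, curve, ← ofEllTwo_sub, sobolevNorm_ofEllTwo, ← edist_eq_enorm_sub,
    Set.projIcc_of_mem hT t.2, edist_dist] at h1
  exact (ENNReal.ofReal_le_iff_le_toReal hBt).1 h1

theorem curve_zero (hT : 0 ≤ T) (t : ℝ) : curve hT 0 t = 0 := by
  ext n; simp [curve, ofEllTwo]

end Curve

/-- Existence by contraction in the unit ball of `C([0,T]; H¹)`, under a smallness condition on
the length of the time interval and on the linear evolution in `L^p([0,T]; L^{2p})`. -/
theorem exists_isRegularSolution {p : ℝ} (hp : 1 < p) :
    ∃ c₀ : ℝ, 0 < c₀ ∧ ∀ (s T : ℝ) (hT : 0 ≤ T) (a b : Coeffs), s < 1 → T ≤ c₀ → MemHH s a b →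
      ∫⁻ t in Set.Icc 0 T, sliceNorm (2 * p) (synthCurve fun t => propV t a b) t ^ p
        ≤ ENNReal.ofReal c₀ →
      ∃ h : C(Set.Icc 0 T, EllTwo),
        IsRegularSolution p T a b (fun t => propV t a b + curve hT h t)
          (fun y => synthCurve (fun t => propV t a b) y + synthCurve (curve hT h) y) ∧
        ∀ t ∈ Set.Icc 0 T, curve hT h t = -duhamel (fun y => nonlin p
          (synthCurve (fun t => propV t a b) y + synthCurve (curve hT h) y)) t := by
  have h2p : 2 ≤ 2 * p := by linarith
  set S := sobolevConst (2 * p) with hS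
  have hSfin : S ≠ ∞ := sobolevConst_ne_top (by linarith)
  set L : ℝ≥0∞ := 1 + 2 ^ (p - 1) * ((2 * S) ^ p + 2 ^ p) with hL
  have hLfin : L ≠ ∞ := by
    have : (2 * S) ^ p ≠ ∞ := ENNReal.rpow_ne_top_of_nonneg (by linarith) (by finiteness)
    have : (2 : ℝ≥0∞) ^ p ≠ ∞ := by finiteness
    finiteness
  set A : ℝ≥0∞ := (1 + ENNReal.ofReal p * S) * L with hA
  have hAfin : A ≠ ∞ := by finiteness
  set c₀ : ℝ := (2 * (A.toReal + 1))⁻¹ with hc₀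
  have hA0 : 0 ≤ A.toReal := ENNReal.toReal_nonneg
  have hc₀pos : 0 < c₀ := by positivity
  have hAc : A * ENNReal.ofReal c₀ ≤ 1 / 2 := by
    rw [← ENNReal.ofReal_toReal hAfin, ← ENNReal.ofReal_mul hA0,
      show (1 / 2 : ℝ≥0∞) = ENNReal.ofReal (1 / 2) by
        rw [ENNReal.ofReal_div_of_pos two_pos, ENNReal.ofReal_one, ENNReal.ofReal_ofNat]]
    refine ENNReal.ofReal_le_ofReal ?_
    rw [hc₀, ← div_eq_mul_inv, div_le_div_iff₀ (by positivity) two_pos]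
    linarith
  refine ⟨c₀, hc₀pos, fun s T hT a b hs hTc hab hZ => ?_⟩
  set z := synthCurve fun t => propV t a b with hz
  have hzm : Measurable z := measurable_synthCurve (measurable_propV a b)
  set ζ := sliceNorm (2 * p) z with hζ
  have hζm : Measurable ζ := measurable_sliceNorm (by linarith) hzm
  -- the weight that dominates both the size and the Lipschitz constant of the nonlinearity
  set κ : ℝ → ℝ≥0∞ := fun t => 1 + (2 * S + 2 * ζ t) ^ p with hκ
  have hκint : ∫⁻ t in Set.Icc 0 T, κ t ≤ L * ENNReal.ofReal c₀ := by
    have hle : ∀ t, κ t ≤ 1 + 2 ^ (p - 1) * ((2 * S) ^ p + 2 ^ p * ζ t ^ p) := fun t => by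
      rw [hκ, ← ENNReal.mul_rpow_of_nonneg 2 (ζ t) (by linarith)]
      simp only
      gcongr
      exact ENNReal.rpow_add_le_mul_rpow_add_rpow _ _ hp.le
    refine (lintegral_mono hle).trans ?_
    rw [lintegral_add_left measurable_const, lintegral_const_mul' _ _ (by finiteness),
      lintegral_add_left measurable_const, lintegral_const_mul' _ _ (by finiteness)]
    simp only [lintegral_const, Measure.restrict_apply MeasurableSet.univ, Set.univ_inter,
      Real.volume_Icc, sub_zero, one_mul]
    have hT' : ENNReal.ofReal T ≤ ENNReal.ofReal c₀ := ENNReal.ofReal_le_ofReal hTc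
    calc _ ≤ ENNReal.ofReal c₀ + 2 ^ (p - 1) * ((2 * S) ^ p * ENNReal.ofReal c₀
          + 2 ^ p * ENNReal.ofReal c₀) := by gcongr
      _ = _ := by rw [hL]; ring
  have hκ1 : ∫⁻ t in Set.Icc 0 T, κ t ≤ 1 / 2 := by
    refine hκint.trans (le_trans ?_ hAc)
    gcongr
    rw [hA]
    exact le_mul_of_one_le_left' le_self_add
  have hκ2 : ENNReal.ofReal p * S * ∫⁻ t in Set.Icc 0 T, κ t ≤ 1 / 2 := by
    refine le_trans ?_ hAc
    rw [hA, mul_assoc (1 + _)]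
    gcongr
    exact le_add_self
  -- the iteration map
  set f : C(Set.Icc 0 T, EllTwo) → ℝ × Torus → ℂ := fun h y => z y + synthCurve (curve hT h) y
    with hf
  have hfm : ∀ h, Measurable (f h) := fun h =>
    hzm.add (measurable_synthCurve (measurable_curve hT h))
  have hfle : ∀ h t, sliceNorm (2 * p) (f h) t ≤ S * ‖h‖ₑ + ζ t := fun h t => by
    rw [add_comm]
    refine (eLpNorm_add_le (measurable_slice hzm t).aestronglyMeasurable
      (measurable_slice (measurable_synthCurve (measurable_curve hT h)) t).aestronglyMeasurable
      ?_).trans ?_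
    · rw [← ENNReal.ofReal_one]; exact ENNReal.ofReal_le_ofReal (by linarith)
    · exact add_le_add le_rfl (sliceNorm_synthCurve_curve_le hT h2p h t)
  have hFm : ∀ h, Measurable fun y => nonlin p (f h y) := fun h =>
    measurable_nonlin_comp hp (hfm h)
  have hfin : ∀ h, ∫⁻ t in Set.Icc 0 T, sliceNorm (2 * p) (f h) t ^ p ≠ ∞ := fun h => by
    have hle : ∀ t, sliceNorm (2 * p) (f h) t ^ p
        ≤ 2 ^ (p - 1) * ((S * ‖h‖ₑ) ^ p + ζ t ^ p) := fun t =>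
      (ENNReal.rpow_le_rpow (hfle h t) (by linarith)).trans
        (ENNReal.rpow_add_le_mul_rpow_add_rpow _ _ hp.le)
    refine ne_top_of_le_ne_top ?_ (lintegral_mono hle)
    rw [lintegral_const_mul' _ _ (by finiteness), lintegral_add_left measurable_const]
    have h1 : (S * ‖h‖ₑ) ^ p ≠ ∞ :=
      ENNReal.rpow_ne_top_of_nonneg (by linarith) (ENNReal.mul_ne_top hSfin enorm_ne_top)
    have h2 : ∫⁻ t in Set.Icc 0 T, ζ t ^ p ≠ ∞ := ne_top_of_le_ne_top ENNReal.ofReal_ne_top hZ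
    have h3 : ∫⁻ _ in Set.Icc 0 T, (S * ‖h‖ₑ) ^ p ≠ ∞ := by
      rw [lintegral_const]; simp [ENNReal.mul_eq_top, h1]
    finiteness
  have hFfin : ∀ h, ∫⁻ t in Set.Icc 0 T, sliceNorm 2 (fun y => nonlin p (f h y)) t ≠ ∞ :=
    fun h => by simpa only [sliceNorm_nonlin hp] using hfin h
  choose Φ hΦ using fun h => exists_curve_eq_neg_duhamel hT (hFm h) (hFfin h)
  have hball : ∀ h : C(Set.Icc 0 T, EllTwo), h ∈ Metric.closedBall 0 1 → ‖h‖ₑ ≤ 1 := fun h hh => by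
    rw [mem_closedBall_zero_iff] at hh
    rw [← ofReal_norm, ← ENNReal.ofReal_one]
    exact ENNReal.ofReal_le_ofReal hh
  have hmaps : Set.MapsTo Φ (Metric.closedBall 0 1) (Metric.closedBall 0 1) := fun h hh => by
    have hle : edist (Φ h) 0 ≤ 1 := by
      refine edist_le_of_sobolevNorm_curve_sub_le hT fun t ht => ?_
      rw [hΦ h t ht, curve_zero, sub_zero, sobolevNorm_neg]
      refine (sobolevNorm_duhamel_le (hFm h) ht.1).trans ?_
      calc _ ≤ ∫⁻ t' in Set.Icc 0 T, sliceNorm 2 (fun y => nonlin p (f h y)) t' :=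
            lintegral_mono_set (Set.Icc_subset_Icc_right ht.2)
        _ ≤ ∫⁻ t' in Set.Icc 0 T, κ t' := by
            refine lintegral_mono fun t' => ?_
            rw [sliceNorm_nonlin hp, hκ]
            refine le_trans (ENNReal.rpow_le_rpow ?_ (by linarith)) le_add_self
            refine (hfle h t').trans ?_
            rw [mul_comm S]
            have h12 : (1 : ℝ≥0∞) ≤ 2 := one_le_two
            exact add_le_add (mul_le_mul' ((hball h hh).trans h12) le_rfl)
              (le_mul_of_one_le_left' h12)
        _ ≤ 1 := hκ1.trans (by norm_num)
    rw [edist_dist] at hle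
    rw [Metric.mem_closedBall]
    exact (ENNReal.ofReal_le_one).1 hle
  have hcontr : ContractingWith (1 / 2 : NNReal) (hmaps.restrict Φ _ _) := by
    refine ⟨by rw [div_lt_one two_pos]; exact one_lt_two, fun h g => ?_⟩
    rw [Subtype.edist_eq, Subtype.edist_eq]
    simp only [Set.MapsTo.val_restrict_apply]
    obtain ⟨h, hh⟩ := h
    obtain ⟨g, hg⟩ := g
    simp only
    refine edist_le_of_sobolevNorm_curve_sub_le hT fun t ht => ?_
    rw [hΦ h t ht, hΦ g t ht, neg_sub_neg, duhamel_sub (hFm g) (hFm h) (hFfin g) (hFfin h) ht]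
    refine (sobolevNorm_duhamel_le ((hFm g).sub (hFm h)) ht.1).trans ?_
    calc _ ≤ ∫⁻ t' in Set.Icc 0 T, sliceNorm 2
            (fun y => nonlin p (f g y) - nonlin p (f h y)) t' :=
          lintegral_mono_set (Set.Icc_subset_Icc_right ht.2)
      _ ≤ ∫⁻ t' in Set.Icc 0 T, (ENNReal.ofReal p * S * edist h g) * κ t' := by
          refine lintegral_mono fun t' => ?_
          refine (sliceNorm_nonlin_sub_le hp (hfm g) (hfm h) t').trans ?_
          have h1 : sliceNorm (2 * p) (fun y => f g y - f h y) t' ≤ S * edist h g := by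
            have : (fun y => f g y - f h y) = fun y => synthCurve (curve hT g) y
                - synthCurve (curve hT h) y := by
              ext y; simp [hf]
            rw [this, edist_comm]
            exact sliceNorm_synthCurve_curve_sub_le hT h2p g h t'
          have h2 : (sliceNorm (2 * p) (f g) t' + sliceNorm (2 * p) (f h) t') ^ (p - 1)
              ≤ κ t' := by
            refine le_trans ?_ (rpow_le_one_add_rpow (by linarith) (by linarith : p - 1 ≤ p) _)
            refine ENNReal.rpow_le_rpow ?_ (by linarith)
            calc _ ≤ (S * ‖g‖ₑ + ζ t') + (S * ‖h‖ₑ + ζ t') := add_le_add (hfle g t') (hfle h t')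
              _ ≤ (S * 1 + ζ t') + (S * 1 + ζ t') := by
                  gcongr
                  · exact hball g hg
                  · exact hball h hh
              _ = 2 * S + 2 * ζ t' := by ring
          calc _ ≤ ENNReal.ofReal p * κ t' * (S * edist h g) := by gcongr
            _ = _ := by ring
      _ = (ENNReal.ofReal p * S * ∫⁻ t' in Set.Icc 0 T, κ t') * edist h g := by
          rw [lintegral_const_mul' _ _ (by finiteness)]; ring
      _ ≤ _ := by
          gcongr
          refine hκ2.trans (le_of_eq ?_)
          rw [ENNReal.coe_div two_ne_zero]; simp
  obtain ⟨h, -, hfix, -⟩ := hcontr.exists_fixedPoint' Metric.isClosed_closedBall.isComplete hmaps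
    (x := 0) (Metric.mem_closedBall_self zero_le_one) (edist_ne_top _ _)
  have hcurve : ∀ t ∈ Set.Icc 0 T, curve hT h t = -duhamel (fun y => nonlin p (f h y)) t :=
    fun t ht => by
      have := hΦ h t ht
      rwa [show Φ h = h from hfix] at this
  refine ⟨h, ⟨hfm h, ?_, hfin h, fun t ht => ?_⟩, hcurve⟩
  · exact (isGivenBy_propV hs hab).add (isGivenBy_synthCurve (measurable_curve hT h)
      (Eventually.of_forall fun t => memH_curve hT h t))
  · rw [hcurve t ht]; abel

theorem IsRegularSolution.isSolution {p T : ℝ} (hp : 1 < p) {a b : Coeffs} {w : ℝ → Coeffs}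
    {f : ℝ × Torus → ℂ} (h : IsRegularSolution p T a b w f) : IsSolution p T a b w := by
  refine ⟨f, h.given, ?_, fun t ht n => by rw [h.eq t ht]; rfl⟩
  have hm := measurable_nonlin_comp hp h.measurable
  refine ⟨hm.aestronglyMeasurable, ?_⟩
  rw [hasFiniteIntegral_iff_enorm, lintegral_prod _ hm.enorm.aemeasurable]
  refine lt_of_le_of_lt (lintegral_mono fun t => ?_) (h.lintegral_nonlin hp).lt_top
  rw [← eLpNorm_one_eq_lintegral_enorm, sliceNorm]
  refine eLpNorm_le_eLpNorm_of_exponent_le ?_ (measurable_slice hm t).aestronglyMeasurable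
  rw [ENNReal.ofReal_ofNat]; norm_num

theorem hasDerivAt_symV_zero (n : Freq) : HasDerivAt (fun t => symV t n) 0 0 := by
  have hJ := (symJ_pos n).ne'
  have h1 : HasDerivAt (fun t : ℝ => Real.exp (-(symD n / 2) * t)) (-(symD n / 2)) 0 := by
    simpa using ((hasDerivAt_id (0 : ℝ)).const_mul (-(symD n / 2))).exp
  have h0 : HasDerivAt (fun t : ℝ => t * symJ n) (symJ n) 0 := by
    simpa using (hasDerivAt_id (0 : ℝ)).mul_const (symJ n)
  have h2 := h1.mul (h0.cos.add (h0.sin.const_mul (symD n / (2 * symJ n))))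
  unfold symV
  refine h2.congr_deriv ?_
  simp
  field_simp
  ring

theorem hasDerivAt_symS_zero (n : Freq) : HasDerivAt (fun t => symS t n) 1 0 := by
  have hJ := (symJ_pos n).ne'
  have h1 : HasDerivAt (fun t : ℝ => Real.exp (-(symD n / 2) * t)) (-(symD n / 2)) 0 := by
    simpa using ((hasDerivAt_id (0 : ℝ)).const_mul (-(symD n / 2))).exp
  have h0 : HasDerivAt (fun t : ℝ => t * symJ n) (symJ n) 0 := by
    simpa using (hasDerivAt_id (0 : ℝ)).mul_const (symJ n)
  have h2 := h1.mul (h0.sin.div_const (symJ n))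
  unfold symS
  refine h2.congr_deriv ?_
  simp [hJ]

theorem hasDerivAt_propV_zero (a b : Coeffs) (n : Freq) :
    HasDerivAt (fun t => propV t a b n) (b n) 0 := by
  simp only [propV_apply]
  have := ((hasDerivAt_symV_zero n).ofReal_comp.mul_const (a n)).add
    ((hasDerivAt_symS_zero n).ofReal_comp.mul_const (b n))
  simp only [Complex.ofReal_zero, zero_mul, Complex.ofReal_one, one_mul, zero_add] at this
  exact this

/-- Local well-posedness for data whose linear evolution is small in `L^p([0,T]; L^{2p})`. -/
theorem exists_hasUniqueSolution {p : ℝ} (hp : 1 < p) :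
    ∃ c₀ : ℝ, 0 < c₀ ∧ ∀ (s T q r σ : ℝ) (a b : Coeffs), 0 < T → s < 1 → p ≤ q → 2 * p ≤ r →
      σ ≤ 1 → T ≤ c₀ → MemHH s a b → IsRealDistribution a → IsRealDistribution b →
      ∫⁻ t in Set.Icc 0 T, sliceNorm (2 * p) (synthCurve fun t => propV t a b) t ^ p
        ≤ ENNReal.ofReal c₀ →
      HasUniqueSolution p T q r σ a b := by
  obtain ⟨c₀, hc₀, H⟩ := exists_isRegularSolution hp
  refine ⟨c₀, hc₀, fun s T q r σ a b hT hs hpq hpr hσ hTc hab ha hb hZ => ?_⟩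
  obtain ⟨h, hreg, hcurve⟩ := H s T hT.le a b hs hTc hab hZ
  have hm := measurable_nonlin_comp hp hreg.measurable
  have hfin := hreg.lintegral_nonlin hp
  have h0 : (0 : ℝ) ∈ Set.Icc 0 T := ⟨le_rfl, hT.le⟩
  refine ⟨_, hreg.isSolution hp, ⟨?_, ?_⟩, fun t ht => hreg.isRealDistribution hp ha hb ht, ?_,
    fun n => ?_, fun w hw hwc t ht => ?_⟩
  · simp only [add_sub_cancel_left]
    have hC := memCH_duhamel hm hσ hfin
    refine ⟨fun t ht => ?_, fun t₀ ht₀ => ?_⟩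
    · simp only
      rw [hcurve t ht, MemH, sobolevNorm_neg]; exact hC.1 t ht
    · refine (hC.2 t₀ ht₀).congr' ?_
      filter_upwards [self_mem_nhdsWithin] with t ht
      rw [hcurve t ht, hcurve t₀ ht₀, ← sobolevNorm_neg]
      congr 1; abel
  · simp only [add_sub_cancel_left]
    refine ⟨synthCurve (curve hT.le h), isGivenBy_synthCurve (measurable_curve hT.le h)
      (Eventually.of_forall fun t => memH_curve hT.le h t), ?_⟩
    have hle : ∀ t, sliceNorm r (synthCurve (curve hT.le h)) t ≤ sobolevConst r * ‖h‖ₑ :=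
      sliceNorm_synthCurve_curve_le hT.le (by linarith) h
    refine (eLpNorm_mono_enorm (g := fun _ => sobolevConst r * ‖h‖ₑ) fun t => ?_).trans_lt ?_
    · simpa only [enorm_eq_self] using! hle t
    · have h1 : sobolevConst r * ‖h‖ₑ ≠ ∞ :=
        ENNReal.mul_ne_top (sobolevConst_ne_top (by linarith)) enorm_ne_top
      rw [eLpNorm_const' _ (by simpa using (by linarith : 0 < q)) ENNReal.ofReal_ne_top]
      rw [enorm_eq_self]
      refine ENNReal.mul_lt_top h1.lt_top (ENNReal.rpow_lt_top_of_nonneg (by positivity) ?_)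
      simp
  · rw [hreg.eq 0 h0, propV_zero]
    ext n
    simp [duhamel]
  · have h1 := (hasDerivAt_propV_zero a b n).hasDerivWithinAt (s := Set.Icc 0 T)
    have h2 := h1.sub (hasDerivWithinAt_duhamel hm hT.le hfin n)
    rw [sub_zero] at h2
    refine h2.congr (fun t ht => ?_) ?_
    · exact congrFun (hreg.eq t ht) n
    · exact congrFun (hreg.eq 0 h0) n
  · obtain ⟨g, hg⟩ := hw.exists_isRegularSolution hp hs hpq hpr hab
      (ne_top_of_le_ne_top ENNReal.ofReal_ne_top hZ) hwc.2
    exact hg.unique hp hreg t ht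

/-! ### Moments of random linear combinations -/

section Moments

variable {Ω : Type*} [MeasurableSpace Ω] {P : Measure Ω}

theorem hasSubgaussianMGF_mono {Y : Ω → ℝ} {c c' : NNReal} (h : HasSubgaussianMGF Y c P)
    (hc : c ≤ c') : HasSubgaussianMGF Y c' P :=
  ⟨h.integrable_exp_mul, fun t => (h.mgf_le t).trans (by gcongr)⟩

theorem hasSubgaussianMGF_of_lintegral_exp_le {Y : Ω → ℝ} (hY : Measurable Y) {K : ℝ}
    (hK : 0 ≤ K)
    (h : ∀ t, ∫⁻ ω, ENNReal.ofReal (Real.exp (t * Y ω)) ∂P ≤ ENNReal.ofReal (Real.exp (K * t ^ 2))) :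
    HasSubgaussianMGF Y (2 * K).toNNReal P := by
  have hint : ∀ t, Integrable (fun ω => Real.exp (t * Y ω)) P := fun t => by
    refine ⟨(by fun_prop : Measurable fun ω => Real.exp (t * Y ω)).aestronglyMeasurable, ?_⟩
    rw [hasFiniteIntegral_iff_ofReal (Eventually.of_forall fun ω => (Real.exp_pos _).le)]
    exact (h t).trans_lt ENNReal.ofReal_lt_top
  refine ⟨hint, fun t => ?_⟩
  rw [mgf, integral_eq_lintegral_of_nonneg_ae (Eventually.of_forall fun ω => (Real.exp_pos _).le)
    (hint t).1]
  refine (ENNReal.toReal_mono ENNReal.ofReal_ne_top (h t)).trans (le_of_eq ?_)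
  rw [ENNReal.toReal_ofReal (Real.exp_pos _).le, Real.coe_toNNReal _ (by linarith)]
  congr 1; ring

theorem hasSubgaussianMGF_add_of_le {X Y : Ω → ℝ} {a b : ℝ} (ha : 0 ≤ a) (hb : 0 ≤ b)
    (hX : HasSubgaussianMGF X a.toNNReal P) (hY : HasSubgaussianMGF Y b.toNNReal P) :
    HasSubgaussianMGF (fun ω => X ω + Y ω) (2 * (a + b)).toNNReal P := by
  refine hasSubgaussianMGF_mono (hX.add hY) ?_
  rw [← NNReal.coe_le_coe, Real.coe_toNNReal _ (by linarith)]
  push_cast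
  rw [Real.coe_toNNReal _ ha, Real.coe_toNNReal _ hb]
  nlinarith [sq_nonneg (Real.sqrt a - Real.sqrt b), Real.sq_sqrt ha, Real.sq_sqrt hb]

/-- The even moments of a sub-Gaussian variable, by optimizing `y^{2m} / (2m)! ≤ e^{|y|}`. -/
theorem lintegral_pow_le_of_hasSubgaussianMGF {Y : Ω → ℝ} {σ : ℝ} (hσ : 0 < σ)
    (h : HasSubgaussianMGF Y σ.toNNReal P) {m : ℕ} (hm : 0 < m) :
    ∫⁻ ω, ENNReal.ofReal (Y ω ^ (2 * m)) ∂P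
      ≤ ENNReal.ofReal (2 * (2 * Real.exp 1 * m * σ) ^ m) := by
  have hm' : (0 : ℝ) < m := Nat.cast_pos.2 hm
  set t : ℝ := Real.sqrt (2 * m / σ) with ht
  have ht2 : t ^ 2 = 2 * m / σ := Real.sq_sqrt (by positivity)
  have htpos : 0 < t := Real.sqrt_pos.2 (by positivity)
  set A : ℝ := (2 * m).factorial / t ^ (2 * m) with hA
  have hA0 : 0 ≤ A := by positivity
  have hpt : ∀ y : ℝ, y ^ (2 * m) ≤ A * (Real.exp (t * y) + Real.exp (-t * y)) := fun y => by
    have h1 := Real.pow_div_factorial_le_exp |t * y| (abs_nonneg _) (2 * m)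
    have h2 : Real.exp |t * y| ≤ Real.exp (t * y) + Real.exp (-t * y) := by
      rw [neg_mul]
      rcases abs_choice (t * y) with h | h <;> rw [h]
      · linarith [Real.exp_pos (-(t * y))]
      · linarith [Real.exp_pos (t * y)]
    have h3 : |t * y| ^ (2 * m) = t ^ (2 * m) * y ^ (2 * m) := by
      rw [pow_mul, sq_abs, ← pow_mul, mul_pow]
    rw [h3] at h1
    have h4 : y ^ (2 * m) = A * (t ^ (2 * m) * y ^ (2 * m) / (2 * m).factorial) := by
      rw [hA]; field_simp
    rw [h4]
    exact mul_le_mul_of_nonneg_left (h1.trans h2) hA0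
  have hint : Integrable (fun ω => A * (Real.exp (t * Y ω) + Real.exp (-t * Y ω))) P :=
    ((h.integrable_exp_mul t).add (h.integrable_exp_mul (-t))).const_mul A
  calc _ ≤ ∫⁻ ω, ENNReal.ofReal (A * (Real.exp (t * Y ω) + Real.exp (-t * Y ω))) ∂P :=
        lintegral_mono fun ω => ENNReal.ofReal_le_ofReal (hpt _)
    _ = ENNReal.ofReal (∫ ω, A * (Real.exp (t * Y ω) + Real.exp (-t * Y ω)) ∂P) :=
        (ofReal_integral_eq_lintegral_ofReal hint (Eventually.of_forall fun ω => by positivity)).symm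
    _ ≤ _ := ENNReal.ofReal_le_ofReal ?_
  rw [integral_const_mul, integral_add (h.integrable_exp_mul t) (h.integrable_exp_mul (-t))]
  have h1 := h.mgf_le t
  have h2 := h.mgf_le (-t)
  rw [neg_sq] at h2
  have h3 : (σ.toNNReal : ℝ) * t ^ 2 / 2 = m := by
    rw [Real.coe_toNNReal _ hσ.le, ht2]; field_simp
  rw [h3] at h1 h2
  have h4 : t ^ (2 * m) = (2 * m / σ) ^ m := by rw [pow_mul, ht2]
  have h5 : ((2 * m).factorial : ℝ) ≤ (2 * m) ^ (2 * m) := by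
    exact_mod_cast Nat.factorial_le_pow (2 * m)
  calc A * (mgf Y P t + mgf Y P (-t)) ≤ A * (Real.exp m + Real.exp m) := by gcongr
    _ ≤ ((2 * m) ^ (2 * m) / t ^ (2 * m)) * (Real.exp m + Real.exp m) := by
        rw [hA]; gcongr
    _ = 2 * (2 * Real.exp 1 * m * σ) ^ m := by
        rw [h4, show Real.exp (m : ℝ) = Real.exp 1 ^ m by rw [← Real.exp_nat_mul]; simp,
          pow_mul, ← div_pow]
        rw [show (2 * (m : ℝ)) ^ 2 / (2 * m / σ) = 2 * m * σ by field_simp]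
        rw [show 2 * Real.exp 1 * m * σ = (2 * m * σ) * Real.exp 1 by ring, mul_pow (2 * m * σ)]
        ring

variable {K : ℝ} {g : Fin 2 → Freq → Ω → ℂ}

theorem IsRandomization.hasSubgaussianMGF_re (hg : IsRandomization P K g) (hK : 0 ≤ K) (j : Fin 2)
    (n : Freq) : HasSubgaussianMGF (fun ω => (g j n ω).re) (2 * K).toNNReal P :=
  hasSubgaussianMGF_of_lintegral_exp_le (Complex.measurable_re.comp (hg.measurable j n)) hK
    fun t => by simpa using hg.exp_moment j n t 0

theorem IsRandomization.hasSubgaussianMGF_im (hg : IsRandomization P K g) (hK : 0 ≤ K) (j : Fin 2)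
    (n : Freq) : HasSubgaussianMGF (fun ω => (g j n ω).im) (2 * K).toNNReal P :=
  hasSubgaussianMGF_of_lintegral_exp_le (Complex.measurable_im.comp (hg.measurable j n)) hK
    fun t => by simpa using hg.exp_moment j n 0 t

/-- Over frequencies in the half lattice the coefficients are independent, so the sub-Gaussian
constants add up. -/
theorem IsRandomization.hasSubgaussianMGF_sum_half (hg : IsRandomization P K g) (hK : 0 ≤ K)
    (j : Fin 2) (F : Finset {n : Freq // n = 0 ∨ n ∈ posHalf}) (α β : Freq → ℝ) :
    HasSubgaussianMGF (fun ω => ∑ n ∈ F, (α n * (g j n ω).re + β n * (g j n ω).im))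
      (2 * K * ∑ n ∈ F, (α n ^ 2 + β n ^ 2)).toNNReal P := by
  let w : {n : Freq // n = 0 ∨ n ∈ posHalf} × Bool → ℝ := fun k => if k.2 then α k.1 else β k.1
  have hind := (hg.indep.precomp (g := fun k : {n : Freq // n = 0 ∨ n ∈ posHalf} × Bool => (j, k))
    (fun k k' h => (Prod.mk.injEq _ _ _ _ ▸ h).2)).comp (fun k x => w k * x)
    (fun k => measurable_const_mul _)
  have hsub := HasSubgaussianMGF.sum_of_iIndepFun hind
    (c := fun k => (w k ^ 2).toNNReal * (2 * K).toNNReal) (s := F ×ˢ Finset.univ) (fun k _ => by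
      have h1 : HasSubgaussianMGF (fun ω => if k.2 then (g j k.1 ω).re else (g j k.1 ω).im)
          (2 * K).toNNReal P := by
        obtain ⟨n, b⟩ := k
        cases b
        · simpa using hg.hasSubgaussianMGF_im hK j n
        · simpa using hg.hasSubgaussianMGF_re hK j n
      refine hasSubgaussianMGF_mono (h1.const_mul (w k)) (le_of_eq ?_)
      rw [Real.toNNReal_of_nonneg (sq_nonneg (w k))]
      rfl)
  have hc : (∑ k ∈ F ×ˢ Finset.univ, (w k ^ 2).toNNReal * (2 * K).toNNReal : NNReal)
      = (2 * K * ∑ n ∈ F, (α n ^ 2 + β n ^ 2)).toNNReal := by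
    rw [← NNReal.coe_inj, Real.coe_toNNReal _ (mul_nonneg (by linarith)
      (Finset.sum_nonneg fun n _ => by positivity))]
    push_cast
    simp only [Real.coe_toNNReal _ (sq_nonneg _), Real.coe_toNNReal (2 * K) (by linarith)]
    rw [Finset.sum_product, Finset.mul_sum]
    refine Finset.sum_congr rfl fun n _ => ?_
    simp [w]; ring
  rw [hc] at hsub
  refine hsub.congr (Eventually.of_forall fun ω => ?_)
  simp only [Function.comp_apply]
  rw [Finset.sum_product]
  refine Finset.sum_congr rfl fun n _ => ?_
  simp [w]

theorem neg_mem_posHalf {n : Freq} (hn : ¬(n = 0 ∨ n ∈ posHalf)) : -n = 0 ∨ -n ∈ posHalf := by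
  refine Or.inr ?_
  simp only [posHalf, Set.mem_ofPred_eq, not_or, not_and, not_lt, Pi.neg_apply] at hn ⊢
  obtain ⟨h0, h1, h2⟩ := hn
  by_cases h : n 1 = 0
  · refine Or.inl ⟨?_, by omega⟩
    have : n 0 ≠ 0 := fun h' => h0 (by ext i; fin_cases i <;> simp [h, h'])
    by_contra hc
    exact h1 (by omega) h
  · exact Or.inr (by omega)

/-- The symmetry `g_{-n} = conj g_n` makes a sum over arbitrary frequencies a sum of two sums over
the half lattice. -/
theorem IsRandomization.hasSubgaussianMGF_sum (hg : IsRandomization P K g) (hK : 0 ≤ K)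
    (j : Fin 2) (F : Finset Freq) (α β : Freq → ℝ) :
    HasSubgaussianMGF (fun ω => ∑ n ∈ F, (α n * (g j n ω).re + β n * (g j n ω).im))
      (4 * K * ∑ n ∈ F, (α n ^ 2 + β n ^ 2)).toNNReal P := by
  classical
  let p : Freq → Prop := fun n => n = 0 ∨ n ∈ posHalf
  let F₁ : Finset {n // p n} := F.subtype p
  let F₂ : Finset {n // p n} := ((F.filter fun n => ¬p n).image Neg.neg).subtype p
  have hF₁ : ∀ φ : Freq → ℝ, ∑ n ∈ F₁, φ n = ∑ n ∈ F.filter p, φ n := fun φ => by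
    rw [Finset.sum_subtype_eq_sum_filter]
  have hF₂ : ∀ φ : Freq → ℝ, ∑ n ∈ F₂, φ n = ∑ n ∈ F.filter (fun n => ¬p n), φ (-n) := fun φ => by
    rw [Finset.sum_subtype_eq_sum_filter, Finset.filter_true_of_mem, Finset.sum_image]
    · exact fun x _ y _ h => neg_injective h
    · intro m hm
      obtain ⟨n, hn, rfl⟩ := Finset.mem_image.1 hm
      exact neg_mem_posHalf (Finset.mem_filter.1 hn).2
  have h1 := hg.hasSubgaussianMGF_sum_half hK j F₁ α β
  have h2 := hg.hasSubgaussianMGF_sum_half hK j F₂ (fun n => α (-n)) (fun n => -β (-n))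
  have h3 := hasSubgaussianMGF_add_of_le
    (mul_nonneg (by linarith) (Finset.sum_nonneg fun n _ => by positivity))
    (mul_nonneg (by linarith) (Finset.sum_nonneg fun n _ => by positivity)) h1 h2
  have e := fun φ : Freq → ℝ => Finset.sum_filter_add_sum_filter_not F p φ
  rw [hF₁ fun n => α n ^ 2 + β n ^ 2, hF₂ fun n => α (-n) ^ 2 + (-β (-n)) ^ 2] at h3
  simp only [neg_neg, neg_sq, ← mul_add, e] at h3
  convert! h3 using 2 with ω
  · rw [hF₁ fun n => α n * (g j n ω).re + β n * (g j n ω).im,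
      hF₂ fun n => α (-n) * (g j n ω).re + -β (-n) * (g j n ω).im, ← e]
    congr 1
    refine Finset.sum_congr rfl fun n _ => ?_
    rw [hg.conj_symm j n ω]
    simp
  · ring

/-- Khintchine's inequality for the randomization: the moments of a random linear combination. -/
theorem IsRandomization.lintegral_enorm_pow_le (hg : IsRandomization P K g) (hK : 0 < K)
    (F : Finset Freq) (c d : Freq → ℂ) {V : ℝ} (hV0 : 0 < V)
    (hV : ∑ n ∈ F, (‖c n‖ ^ 2 + ‖d n‖ ^ 2) ≤ V) {m : ℕ} (hm : 0 < m) :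
    ∫⁻ ω, ‖∑ n ∈ F, (g 0 n ω * c n + g 1 n ω * d n)‖ₑ ^ (2 * m) ∂P
      ≤ ENNReal.ofReal (4 * (32 * Real.exp 1 * K * m * V) ^ m) := by
  set Y : Ω → ℂ := fun ω => ∑ n ∈ F, (g 0 n ω * c n + g 1 n ω * d n) with hY
  have hns : ∀ z : ℂ, z.re ^ 2 + z.im ^ 2 = ‖z‖ ^ 2 := fun z => by
    rw [← Complex.normSq_eq_norm_sq, Complex.normSq_apply]; ring
  have hre : HasSubgaussianMGF (fun ω => (Y ω).re) (8 * K * V).toNNReal P := by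
    have h0 := hg.hasSubgaussianMGF_sum hK.le 0 F (fun n => (c n).re) (fun n => -(c n).im)
    have h1 := hg.hasSubgaussianMGF_sum hK.le 1 F (fun n => (d n).re) (fun n => -(d n).im)
    have h2 := hasSubgaussianMGF_add_of_le
      (mul_nonneg (by linarith) (Finset.sum_nonneg fun n _ => by positivity))
      (mul_nonneg (by linarith) (Finset.sum_nonneg fun n _ => by positivity)) h0 h1
    refine (hasSubgaussianMGF_mono h2 (Real.toNNReal_le_toNNReal ?_)).congr
      (Eventually.of_forall fun ω => ?_)
    · simp only [neg_sq, hns, ← mul_add, ← Finset.sum_add_distrib]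
      nlinarith
    · simp only [hY, Complex.re_sum, ← Finset.sum_add_distrib]
      refine Finset.sum_congr rfl fun n _ => ?_
      simp only [Complex.add_re, Complex.mul_re]; ring
  have him : HasSubgaussianMGF (fun ω => (Y ω).im) (8 * K * V).toNNReal P := by
    have h0 := hg.hasSubgaussianMGF_sum hK.le 0 F (fun n => (c n).im) (fun n => (c n).re)
    have h1 := hg.hasSubgaussianMGF_sum hK.le 1 F (fun n => (d n).im) (fun n => (d n).re)
    have h2 := hasSubgaussianMGF_add_of_le
      (mul_nonneg (by linarith) (Finset.sum_nonneg fun n _ => by positivity))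
      (mul_nonneg (by linarith) (Finset.sum_nonneg fun n _ => by positivity)) h0 h1
    refine (hasSubgaussianMGF_mono h2 (Real.toNNReal_le_toNNReal ?_)).congr
      (Eventually.of_forall fun ω => ?_)
    · simp only [add_comm _ (_root_.Complex.re _ ^ 2), hns, ← mul_add, ← Finset.sum_add_distrib]
      nlinarith
    · simp only [hY, Complex.im_sum, ← Finset.sum_add_distrib]
      refine Finset.sum_congr rfl fun n _ => ?_
      simp only [Complex.add_im, Complex.mul_im]; ring
  have hσ : 0 < 8 * K * V := by positivity
  have h1 := lintegral_pow_le_of_hasSubgaussianMGF hσ hre hm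
  have h2 := lintegral_pow_le_of_hasSubgaussianMGF hσ him hm
  have hYm : Measurable Y := Finset.measurable_sum _ fun n _ =>
    ((hg.measurable 0 n).mul_const _).add ((hg.measurable 1 n).mul_const _)
  have hpt : ∀ z : ℂ, ‖z‖ₑ ^ (2 * m) ≤ ENNReal.ofReal (2 ^ m)
      * (ENNReal.ofReal (z.re ^ (2 * m)) + ENNReal.ofReal (z.im ^ (2 * m))) := fun z => by
    rw [← ENNReal.ofReal_add (by rw [pow_mul]; positivity) (by rw [pow_mul]; positivity),
      ← ENNReal.ofReal_mul (by positivity), ← ofReal_norm, ← ENNReal.ofReal_pow (norm_nonneg _)]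
    refine ENNReal.ofReal_le_ofReal ?_
    rw [pow_mul, pow_mul, pow_mul, ← hns]
    refine (add_pow_le (sq_nonneg _) (sq_nonneg _) m).trans ?_
    gcongr
    · norm_num
    · omega
  calc _ ≤ ∫⁻ ω, ENNReal.ofReal (2 ^ m) * (ENNReal.ofReal ((Y ω).re ^ (2 * m))
          + ENNReal.ofReal ((Y ω).im ^ (2 * m))) ∂P := lintegral_mono fun ω => hpt _
    _ = ENNReal.ofReal (2 ^ m) * (∫⁻ ω, ENNReal.ofReal ((Y ω).re ^ (2 * m)) ∂P
          + ∫⁻ ω, ENNReal.ofReal ((Y ω).im ^ (2 * m)) ∂P) := by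
        rw [lintegral_const_mul' _ _ ENNReal.ofReal_ne_top, lintegral_add_left]
        exact ((Complex.measurable_re.comp hYm).pow_const _).ennreal_ofReal
    _ ≤ ENNReal.ofReal (2 ^ m) * (ENNReal.ofReal (2 * (2 * Real.exp 1 * m * (8 * K * V)) ^ m)
          + ENNReal.ofReal (2 * (2 * Real.exp 1 * m * (8 * K * V)) ^ m)) := by gcongr
    _ = _ := by
        rw [← ENNReal.ofReal_add (by positivity) (by positivity),
          ← ENNReal.ofReal_mul (by positivity)]
        congr 1
        rw [← two_mul, show 32 * Real.exp 1 * K * m * V = 2 * (2 * Real.exp 1 * m * (8 * K * V)) by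
          ring, mul_pow 2 (2 * Real.exp 1 * m * (8 * K * V))]
        ring

end Moments

/-! ### The linear evolution of random data -/

theorem sum_sq_le_sobolevNorm_sq {s : ℝ} {a : Coeffs} (ha : MemH s a) (F : Finset Freq) :
    ∑ n ∈ F, (bracket n ^ s * ‖a n‖) ^ 2 ≤ (sobolevNorm s a).toReal ^ 2 := by
  rw [← ENNReal.toReal_pow]
  refine (ENNReal.ofReal_le_iff_le_toReal (ENNReal.pow_ne_top ha.ne)).1 ?_
  rw [ENNReal.ofReal_sum_of_nonneg fun n _ => sq_nonneg _, sobolevNorm_sq]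
  refine le_trans (le_of_eq (Finset.sum_congr rfl fun n _ => ?_)) (ENNReal.sum_le_tsum F)
  have hb := bracket_pos n
  rw [ENNReal.ofReal_pow (by positivity), ENNReal.ofReal_mul (by positivity), ofReal_norm]

theorem normHH_sq (s : ℝ) (a b : Coeffs) : normHH s a b ^ 2
    = (sobolevNorm s a).toReal ^ 2 + (sobolevNorm (s - 1) b).toReal ^ 2 :=
  Real.sq_sqrt (by positivity)

theorem normHH_nonneg (s : ℝ) (a b : Coeffs) : 0 ≤ normHH s a b := Real.sqrt_nonneg _

theorem eq_zero_of_normHH_eq_zero {s : ℝ} {a b : Coeffs} (hab : MemHH s a b)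
    (h : normHH s a b = 0) : a = 0 ∧ b = 0 := by
  have h1 := normHH_sq s a b
  rw [h] at h1
  have h2 : (sobolevNorm s a).toReal = 0 := by
    nlinarith [sq_nonneg (sobolevNorm s a).toReal, sq_nonneg (sobolevNorm (s - 1) b).toReal]
  have h3 : (sobolevNorm (s - 1) b).toReal = 0 := by
    nlinarith [sq_nonneg (sobolevNorm s a).toReal, sq_nonneg (sobolevNorm (s - 1) b).toReal]
  exact ⟨sobolevNorm_eq_zero (((ENNReal.toReal_eq_zero_iff _).1 h2).resolve_right hab.1.ne),
    sobolevNorm_eq_zero (((ENNReal.toReal_eq_zero_iff _).1 h3).resolve_right hab.2.ne)⟩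

/-- The variance of the Fourier series of the random linear evolution at a point. -/
theorem sum_variance_le {s t : ℝ} (hs : -1 ≤ s) (hs0 : s ≤ 0) (ht : 0 < t) (ht1 : t ≤ 1)
    {a b : Coeffs} (hab : MemHH s a b) (F : Finset Freq) (x : Torus) :
    ∑ n ∈ F, (‖(symV t n : ℂ) * a n * mFourier n x‖ ^ 2
      + ‖(symS t n : ℂ) * b n * mFourier n x‖ ^ 2) ≤ 4 * (t ^ s) ^ 2 * normHH s a b ^ 2 := by
  have h1 : ∀ n, ‖(symV t n : ℂ) * a n * mFourier n x‖ ^ 2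
      ≤ 4 * (t ^ s) ^ 2 * (bracket n ^ s * ‖a n‖) ^ 2 := fun n => by
    have hb := bracket_pos n
    rw [norm_mul, norm_mul, norm_mFourier_apply, Complex.norm_real, Real.norm_eq_abs, mul_one]
    calc _ ≤ (2 * (t ^ s * bracket n ^ s) * ‖a n‖) ^ 2 := by
          gcongr; exact abs_symV_le_rpow hs hs0 ht ht1 n
      _ = _ := by ring
  have h2 : ∀ n, ‖(symS t n : ℂ) * b n * mFourier n x‖ ^ 2
      ≤ 4 * (t ^ s) ^ 2 * (bracket n ^ (s - 1) * ‖b n‖) ^ 2 := fun n => by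
    have hb := bracket_pos n
    rw [norm_mul, norm_mul, norm_mFourier_apply, Complex.norm_real, Real.norm_eq_abs, mul_one]
    calc _ ≤ (t ^ s * bracket n ^ (s - 1) * ‖b n‖) ^ 2 := by
          gcongr; exact abs_symS_le_rpow hs hs0 ht ht1 n
      _ ≤ 4 * (t ^ s * bracket n ^ (s - 1) * ‖b n‖) ^ 2 := by
          linarith [sq_nonneg (t ^ s * bracket n ^ (s - 1) * ‖b n‖)]
      _ = _ := by ring
  calc _ ≤ ∑ n ∈ F, (4 * (t ^ s) ^ 2 * (bracket n ^ s * ‖a n‖) ^ 2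
          + 4 * (t ^ s) ^ 2 * (bracket n ^ (s - 1) * ‖b n‖) ^ 2) :=
        Finset.sum_le_sum fun n _ => add_le_add (h1 n) (h2 n)
    _ = 4 * (t ^ s) ^ 2 * (∑ n ∈ F, (bracket n ^ s * ‖a n‖) ^ 2
          + ∑ n ∈ F, (bracket n ^ (s - 1) * ‖b n‖) ^ 2) := by
        rw [Finset.sum_add_distrib, ← Finset.mul_sum, ← Finset.mul_sum, mul_add]
    _ ≤ _ := by
        rw [normHH_sq]
        gcongr
        · exact sum_sq_le_sobolevNorm_sq hab.1 F
        · exact sum_sq_le_sobolevNorm_sq hab.2 F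

/-- Where the series of dyadic blocks diverges `synth` vanishes, so its moments are bounded by
those of the partial sums at every point. -/
theorem enorm_synth_pow_le_liminf (a : Coeffs) (x : Torus) {k : ℕ} (hk : k ≠ 0) :
    ‖synth a x‖ₑ ^ k ≤ liminf (fun N =>
      ‖trigPoly ((Finset.range N).biUnion block) a x‖ₑ ^ k) atTop := by
  have hsum : ∀ N, trigPoly ((Finset.range N).biUnion block) a x
      = ∑ j ∈ Finset.range N, trigPoly (block j) a x := fun N => by
    unfold trigPoly
    refine Finset.sum_biUnion fun i _ j _ hij => Finset.disjoint_left.2 fun n hi hj => hij ?_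
    rw [← mem_block.1 hi, mem_block.1 hj]
  by_cases h : Summable fun j => trigPoly (block j) a x
  · have h1 := h.hasSum.tendsto_sum_nat
    have h2 : Tendsto (fun N => ‖trigPoly ((Finset.range N).biUnion block) a x‖ₑ ^ k) atTop
        (𝓝 (‖synth a x‖ₑ ^ k)) := by
      simp only [hsum]
      exact (((ENNReal.continuous_pow k).comp continuous_enorm).tendsto _).comp h1
    exact h2.liminf_eq.ge
  · rw [synth, tsum_eq_zero_of_not_summable h, enorm_zero, zero_pow hk]
    exact zero_le

theorem lintegral_rpow_Ioc {k T : ℝ} (hk : -1 < k) (hT : 0 < T) :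
    ∫⁻ t in Set.Ioc 0 T, ENNReal.ofReal (t ^ k) = ENNReal.ofReal (T ^ (1 + k) / (1 + k)) := by
  rw [← ofReal_integral_eq_lintegral_ofReal, ← intervalIntegral.integral_of_le hT.le,
    integral_rpow (Or.inl hk), Real.zero_rpow (by linarith), sub_zero, add_comm k]
  · exact (intervalIntegrable_iff_integrableOn_Ioc_of_le hT.le).1
      (intervalIntegral.intervalIntegrable_rpow' hk)
  · exact (ae_restrict_mem measurableSet_Ioc).mono fun t ht => Real.rpow_nonneg ht.1.le _

section RandomEvolution

variable {Ω : Type*} {g : Fin 2 → Freq → Ω → ℂ}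

/-- The evolution at time `t` of the randomized data. -/
def randomEvolution (g : Fin 2 → Freq → Ω → ℂ) (a b : Coeffs) (ω : Ω) (t : ℝ) : Coeffs :=
  propV t (randomize (g 0) a ω) (randomize (g 1) b ω)

theorem trigPoly_randomEvolution (a b : Coeffs) (ω : Ω) (t : ℝ) (F : Finset Freq) (x : Torus) :
    trigPoly F (randomEvolution g a b ω t) x
      = ∑ n ∈ F, (g 0 n ω * ((symV t n : ℂ) * a n * mFourier n x)
        + g 1 n ω * ((symS t n : ℂ) * b n * mFourier n x)) := by
  refine Finset.sum_congr rfl fun n _ => ?_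
  rw [randomEvolution, propV_apply, randomize, randomize]; ring

/-- The weighted space-time moment of the random linear evolution. The weight is chosen so that
its expectation is a multiple of `∫_0^T t^{sp} dt`. -/
def weightedMoment (p s T : ℝ) (m : ℕ) (g : Fin 2 → Freq → Ω → ℂ) (a b : Coeffs) (ω : Ω) : ℝ≥0∞ :=
  ∫⁻ t in Set.Ioc 0 T, ∫⁻ x, ENNReal.ofReal (t ^ (s * p - s * (2 * m : ℕ)))
    * ‖synth (randomEvolution g a b ω t) x‖ₑ ^ (2 * m) ∂torusMeasure

/-- Hölder's inequality in time and the inclusion `L^{2m} ⊂ L^{2p}` on the torus bound the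
`L^p_t L^{2p}_x` norm by the weighted moment. -/
theorem lintegral_sliceNorm_randomEvolution_le {p s T : ℝ} (hp : 1 < p) {m : ℕ}
    (hpm : p ≤ m) (a b : Coeffs) (ω : Ω) :
    ∫⁻ t in Set.Icc 0 T, sliceNorm (2 * p) (synthCurve (randomEvolution g a b ω)) t ^ p
      ≤ (∫⁻ t in Set.Ioc 0 T, ENNReal.ofReal (t ^ (s * p))) ^ (1 - p / (2 * m))
        * weightedMoment p s T m g a b ω ^ (p / (2 * m)) := by
  have hm : (0 : ℝ) < m := by linarith
  set θ : ℝ := p / (2 * m) with hθ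
  have hθ0 : 0 < θ := by positivity
  have hθ1 : θ ≤ 1 := by rw [hθ, div_le_one (by positivity)]; linarith
  set H : ℝ → ℝ≥0∞ := fun t => ∫⁻ x, ‖synth (randomEvolution g a b ω t) x‖ₑ ^ (2 * m)
    ∂torusMeasure with hH
  have hsynth : Measurable fun y : ℝ × Torus => synth (randomEvolution g a b ω y.1) y.2 :=
    measurable_synthCurve (measurable_propV _ _)
  have hHm : Measurable H := (hsynth.enorm.pow_const (2 * m)).lintegral_prod_right'
  have hslice : ∀ t, sliceNorm (2 * p) (synthCurve (randomEvolution g a b ω)) t ^ p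
      ≤ H t ^ θ := fun t => by
    have h1 : sliceNorm (2 * p) (synthCurve (randomEvolution g a b ω)) t
        ≤ H t ^ (1 / (2 * m : ℝ)) := by
      have h2 : AEStronglyMeasurable (synth (randomEvolution g a b ω t)) torusMeasure :=
        (measurable_synth_apply _).aestronglyMeasurable
      have hle : ENNReal.ofReal (2 * p) ≤ ENNReal.ofReal (2 * m) :=
        ENNReal.ofReal_le_ofReal (by linarith)
      refine (eLpNorm_le_eLpNorm_of_exponent_le hle h2).trans (le_of_eq ?_)
      rw [eLpNorm_eq_lintegral_rpow_enorm_toReal (by simpa using Nat.cast_pos.1 hm |>.ne') ENNReal.ofReal_ne_top,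
        ENNReal.toReal_ofReal (by positivity)]
      congr 1
      refine lintegral_congr fun x => ?_
      rw [← ENNReal.rpow_natCast]; push_cast; rfl
    refine (ENNReal.rpow_le_rpow h1 (by linarith)).trans (le_of_eq ?_)
    rw [← ENNReal.rpow_mul, hθ]; congr 1; ring
  have hwm : weightedMoment p s T m g a b ω
      = ∫⁻ t in Set.Ioc 0 T, ENNReal.ofReal (t ^ (s * p - s * (2 * m : ℕ))) * H t :=
    lintegral_congr fun t => lintegral_const_mul' _ _ ENNReal.ofReal_ne_top
  rw [hwm, ← restrict_Ioc_eq_restrict_Icc]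
  refine le_trans ?_ (ENNReal.lintegral_mul_norm_pow_le (p := 1 - θ) (q := θ)
    (f := fun t : ℝ => ENNReal.ofReal (t ^ (s * p)))
    (by fun_prop : Measurable fun t : ℝ => ENNReal.ofReal (t ^ (s * p))).aemeasurable
    ((by fun_prop : Measurable fun t : ℝ => ENNReal.ofReal
      (t ^ (s * p - s * (2 * m : ℕ)))).mul hHm).aemeasurable
    (by linarith) hθ0.le (by ring))
  refine setLIntegral_mono_ae' measurableSet_Ioc (Eventually.of_forall fun t ht => ?_)
  refine (hslice t).trans (le_of_eq ?_)
  rw [Pi.mul_apply, ENNReal.mul_rpow_of_nonneg _ _ hθ0.le, ← mul_assoc,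
    ENNReal.ofReal_rpow_of_nonneg (Real.rpow_nonneg ht.1.le _) (by linarith),
    ENNReal.ofReal_rpow_of_nonneg (Real.rpow_nonneg ht.1.le _) hθ0.le,
    ← ENNReal.ofReal_mul (Real.rpow_nonneg (Real.rpow_nonneg ht.1.le _) _),
    ← Real.rpow_mul ht.1.le, ← Real.rpow_mul ht.1.le, ← Real.rpow_add ht.1]
  have : s * p * (1 - θ) + (s * p - s * (2 * m : ℕ)) * θ = 0 := by
    rw [hθ]; push_cast; field_simp; ring
  rw [this, Real.rpow_zero, ENNReal.ofReal_one, one_mul]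

variable [MeasurableSpace Ω] {P : Measure Ω} {K : ℝ}

theorem measurable_randomEvolution (hg : IsRandomization P K g) (a b : Coeffs) (n : Freq) :
    Measurable fun y : Ω × ℝ => randomEvolution g a b y.1 y.2 n := by
  have h0 := hg.measurable 0 n
  have h1 := hg.measurable 1 n
  have h2 := (continuous_symV n).measurable
  have h3 := (continuous_symS n).measurable
  simp only [randomEvolution, propV_apply, randomize]
  fun_prop

theorem lintegral_enorm_synth_randomEvolution_le (hg : IsRandomization P K g) (hK : 0 < K)
    {s t : ℝ} (hs : -1 ≤ s) (hs0 : s ≤ 0) (ht : 0 < t) (ht1 : t ≤ 1) {a b : Coeffs}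
    (hab : MemHH s a b) (h0 : 0 < normHH s a b) (x : Torus) {m : ℕ} (hm : 0 < m) :
    ∫⁻ ω, ‖synth (randomEvolution g a b ω t) x‖ₑ ^ (2 * m) ∂P
      ≤ ENNReal.ofReal (4 * (128 * Real.exp 1 * K * m * normHH s a b ^ 2) ^ m)
        * ENNReal.ofReal (t ^ s) ^ (2 * m) := by
  have hmeas : ∀ N : ℕ, Measurable fun ω =>
      ‖trigPoly ((Finset.range N).biUnion block) (randomEvolution g a b ω t) x‖ₑ ^ (2 * m) :=
    fun N => ((measurable_trigPoly _ (fun n => (measurable_randomEvolution hg a b n).comp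
      measurable_prodMk_right) measurable_const).enorm.pow_const _)
  refine (lintegral_mono fun ω => enorm_synth_pow_le_liminf _ x (by omega)).trans
    ((lintegral_liminf_le hmeas).trans ?_)
  refine liminf_le_of_le (by isBoundedDefault) fun B hB => ?_
  obtain ⟨N, hN⟩ := hB.exists
  refine hN.trans ?_
  simp only [trigPoly_randomEvolution]
  have hts : 0 < t ^ s := Real.rpow_pos_of_pos ht s
  refine (hg.lintegral_enorm_pow_le hK _ _ _ (by positivity)
    (sum_variance_le hs hs0 ht ht1 hab _ x) hm).trans (le_of_eq ?_)
  rw [← ENNReal.ofReal_pow hts.le, ← ENNReal.ofReal_mul (by positivity)]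
  congr 1
  rw [show 32 * Real.exp 1 * K * m * (4 * (t ^ s) ^ 2 * normHH s a b ^ 2)
    = (128 * Real.exp 1 * K * m * normHH s a b ^ 2) * (t ^ s) ^ 2 by ring, mul_pow, ← pow_mul]
  ring

theorem measurable_weightedIntegrand (hg : IsRandomization P K g) (p s : ℝ) (m : ℕ)
    (a b : Coeffs) : Measurable fun y : (Ω × ℝ) × Torus =>
      ENNReal.ofReal (y.1.2 ^ (s * p - s * (2 * m : ℕ)))
        * ‖synth (randomEvolution g a b y.1.1 y.1.2) y.2‖ₑ ^ (2 * m) := by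
  refine Measurable.mul (by fun_prop) (Measurable.pow_const (Measurable.enorm ?_) _)
  exact measurable_synth (v := fun y : (Ω × ℝ) × Torus => randomEvolution g a b y.1.1 y.1.2)
    (fun n => (measurable_randomEvolution hg a b n).comp measurable_fst) measurable_snd

theorem measurable_weightedMoment (hg : IsRandomization P K g) (p s T : ℝ) (m : ℕ)
    (a b : Coeffs) : Measurable (weightedMoment p s T m g a b) :=
  ((measurable_weightedIntegrand hg p s m a b).lintegral_prod_right'
    (ν := torusMeasure)).lintegral_prod_right' (ν := volume.restrict (Set.Ioc 0 T))

theorem lintegral_weightedMoment_le [SFinite P] (hg : IsRandomization P K g) (hK : 0 < K)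
    {p s T : ℝ} (hs : -1 ≤ s) (hs0 : s ≤ 0) (hT1 : T ≤ 1) {a b : Coeffs}
    (hab : MemHH s a b) (h0 : 0 < normHH s a b) {m : ℕ} (hm : 0 < m) :
    ∫⁻ ω, weightedMoment p s T m g a b ω ∂P
      ≤ ENNReal.ofReal (4 * (128 * Real.exp 1 * K * m * normHH s a b ^ 2) ^ m)
        * ∫⁻ t in Set.Ioc 0 T, ENNReal.ofReal (t ^ (s * p)) := by
  have hmeas := measurable_weightedIntegrand hg p s m a b
  simp only [weightedMoment]
  rw [lintegral_lintegral_swap (hmeas.lintegral_prod_right' (ν := torusMeasure)).aemeasurable,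
    ← lintegral_const_mul' _ _ ENNReal.ofReal_ne_top]
  refine setLIntegral_mono_ae' measurableSet_Ioc (Eventually.of_forall fun t ht => ?_)
  have hmeas_t : Measurable (Function.uncurry fun (ω : Ω) (x : Torus) =>
      ENNReal.ofReal (t ^ (s * p - s * (2 * m : ℕ)))
        * ‖synth (randomEvolution g a b ω t) x‖ₑ ^ (2 * m)) :=
    hmeas.comp (by fun_prop : Measurable fun y : Ω × Torus => ((y.1, t), y.2))
  rw [lintegral_lintegral_swap hmeas_t.aemeasurable]
  have hw : ENNReal.ofReal (t ^ (s * p - s * (2 * m : ℕ))) * ENNReal.ofReal (t ^ s) ^ (2 * m)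
      = ENNReal.ofReal (t ^ (s * p)) := by
    have hts : 0 ≤ t ^ s := (Real.rpow_pos_of_pos ht.1 s).le
    rw [← ENNReal.ofReal_pow hts, ← ENNReal.ofReal_mul (Real.rpow_nonneg ht.1.le _),
      ← Real.rpow_natCast (t ^ s), ← Real.rpow_mul ht.1.le, ← Real.rpow_add ht.1, sub_add_cancel]
  calc _ ≤ ∫⁻ _, ENNReal.ofReal (t ^ (s * p - s * (2 * m : ℕ)))
          * (ENNReal.ofReal (4 * (128 * Real.exp 1 * K * m * normHH s a b ^ 2) ^ m)
            * ENNReal.ofReal (t ^ s) ^ (2 * m)) ∂torusMeasure := by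
        refine lintegral_mono fun x => ?_
        rw [lintegral_const_mul' _ _ ENNReal.ofReal_ne_top]
        gcongr
        exact lintegral_enorm_synth_randomEvolution_le hg hK hs hs0 ht.1 (ht.2.trans hT1) hab h0
          x hm
    _ = _ := by
        rw [lintegral_const, measure_univ, mul_one, mul_left_comm, hw]

/-- Chebyshev's inequality for the `L^p_t L^{2p}_x` norm of the random linear evolution, with a free
moment parameter `m`. -/
theorem measure_lintegral_sliceNorm_gt_le [SFinite P] (hg : IsRandomization P K g) (hK : 0 < K)
    {p s T c₀ : ℝ} (hp : 1 < p) (hs : -1 ≤ s) (hs0 : s ≤ 0) (hsp : -1 < s * p) (hT : 0 < T)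
    (hT1 : T ≤ 1) (hc₀ : 0 < c₀) {a b : Coeffs} (hab : MemHH s a b) (h0 : 0 < normHH s a b)
    {m : ℕ} (hpm : p ≤ m) :
    P {ω | ENNReal.ofReal c₀ < ∫⁻ t in Set.Icc 0 T,
        sliceNorm (2 * p) (synthCurve (randomEvolution g a b ω)) t ^ p}
      ≤ ENNReal.ofReal (4 * (128 * Real.exp 1 * K * m * normHH s a b ^ 2
        * (T ^ (1 + s * p) / (1 + s * p) / c₀) ^ (2 / p)) ^ m) := by
  have hm : (0 : ℝ) < m := by linarith
  have hm' : 0 < m := Nat.cast_pos.1 hm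
  set M : ℝ := T ^ (1 + s * p) / (1 + s * p) with hM
  have hM0 : 0 < M := div_pos (Real.rpow_pos_of_pos hT _) (by linarith)
  set θ : ℝ := p / (2 * m) with hθ
  have hθ0 : 0 < θ := by positivity
  set A := ENNReal.ofReal (4 * (128 * Real.exp 1 * K * m * normHH s a b ^ 2) ^ m) with hA
  set B := ENNReal.ofReal (c₀ ^ (1 / θ) * M ^ (-(1 - θ) / θ)) with hB
  have hB0 : B ≠ 0 := by
    rw [hB, Ne, ENNReal.ofReal_eq_zero, not_le]; positivity
  have hsub : {ω | ENNReal.ofReal c₀ < ∫⁻ t in Set.Icc 0 T,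
      sliceNorm (2 * p) (synthCurve (randomEvolution g a b ω)) t ^ p}
      ⊆ {ω | B ≤ weightedMoment p s T m g a b ω} := fun ω hω => by
    have h1 := lt_of_lt_of_le hω
      (lintegral_sliceNorm_randomEvolution_le (s := s) (T := T) (g := g) hp hpm a b ω)
    rw [lintegral_rpow_Ioc hsp hT, ← hM, ← hθ] at h1
    have h2 := ENNReal.rpow_le_rpow h1.le (by positivity : 0 ≤ 1 / θ)
    rw [ENNReal.mul_rpow_of_nonneg _ _ (by positivity), ← ENNReal.rpow_mul, ← ENNReal.rpow_mul,
      mul_one_div_cancel hθ0.ne', ENNReal.rpow_one, ENNReal.ofReal_rpow_of_pos hc₀,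
      ENNReal.ofReal_rpow_of_pos hM0] at h2
    rw [Set.mem_ofPred_eq, hB, ENNReal.ofReal_mul (by positivity)]
    calc _ ≤ ENNReal.ofReal (M ^ ((1 - θ) * (1 / θ))) * weightedMoment p s T m g a b ω
          * ENNReal.ofReal (M ^ (-(1 - θ) / θ)) := by gcongr
      _ = ENNReal.ofReal (M ^ ((1 - θ) * (1 / θ)) * M ^ (-(1 - θ) / θ))
          * weightedMoment p s T m g a b ω := by
          rw [ENNReal.ofReal_mul (by positivity)]; ring
      _ = _ := by
          rw [← Real.rpow_add hM0, show (1 - θ) * (1 / θ) + -(1 - θ) / θ = 0 by ring,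
            Real.rpow_zero, ENNReal.ofReal_one, one_mul]
  have hE := lintegral_weightedMoment_le (p := p) hg hK hs hs0 hT1 hab h0 hm'
  rw [lintegral_rpow_Ioc hsp hT, ← hM, ← hA] at hE
  calc _ ≤ P {ω | B ≤ weightedMoment p s T m g a b ω} := measure_mono hsub
    _ ≤ (∫⁻ ω, weightedMoment p s T m g a b ω ∂P) / B :=
        meas_ge_le_lintegral_div (measurable_weightedMoment hg p s T m a b).aemeasurable hB0
          ENNReal.ofReal_ne_top
    _ ≤ A * ENNReal.ofReal M / B := by gcongr
    _ = _ := by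
        rw [hA, hB, ← ENNReal.ofReal_mul (by positivity),
          ← ENNReal.ofReal_div_of_pos (by positivity)]
        congr 1
        have e1 : ((M / c₀) ^ (2 / p)) ^ m = (M / c₀) ^ (1 / θ) := by
          rw [← Real.rpow_natCast, ← Real.rpow_mul (by positivity)]
          congr 1
          rw [hθ]; field_simp
        have e2 : M ^ (-(1 - θ) / θ) = M / M ^ (1 / θ) := by
          rw [eq_div_iff (by positivity), ← Real.rpow_add hM0,
            show -(1 - θ) / θ + 1 / θ = 1 by field_simp; ring, Real.rpow_one]
        rw [mul_pow (128 * Real.exp 1 * K * m * normHH s a b ^ 2), e1, e2,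
          Real.div_rpow hM0.le hc₀.le]
        field_simp

/-- Randomization preserves the regularity of the data almost surely. -/
theorem ae_memH_randomize (hg : IsRandomization P K g) (hK : 0 < K) (j : Fin 2) {s : ℝ}
    {a : Coeffs} (ha : MemH s a) : ∀ᵐ ω ∂P, MemH s (randomize (g j) a ω) := by
  have hbound : ∀ n, ∫⁻ ω, ‖g j n ω‖ₑ ^ 2 ∂P
      ≤ ENNReal.ofReal (4 * (32 * Real.exp 1 * K)) := fun n => by
    have h := hg.lintegral_enorm_pow_le hK {n} (fun _ => if j = 0 then 1 else 0)
      (fun _ => if j = 0 then 0 else 1) one_pos (by fin_cases j <;> simp) one_pos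
    fin_cases j <;> simpa using h
  have hmeas : ∀ n, Measurable fun ω =>
      (ENNReal.ofReal (bracket n ^ s) * ‖randomize (g j) a ω n‖ₑ) ^ 2 := fun n => by
    have := hg.measurable j n
    simp only [randomize]
    fun_prop
  have hE : ∫⁻ ω, sobolevNorm s (randomize (g j) a ω) ^ 2 ∂P ≠ ∞ := by
    simp only [sobolevNorm_sq]
    rw [lintegral_tsum fun n => (hmeas n).aemeasurable]
    refine ne_top_of_le_ne_top (ENNReal.mul_ne_top ENNReal.ofReal_ne_top
      (ENNReal.pow_ne_top (n := 2) ha.ne)) (?_ : _ ≤ ENNReal.ofReal (4 * (32 * Real.exp 1 * K)) * _)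
    rw [sobolevNorm_sq, ← ENNReal.tsum_mul_left]
    refine ENNReal.tsum_le_tsum fun n => ?_
    calc _ = ∫⁻ ω, (ENNReal.ofReal (bracket n ^ s) * ‖a n‖ₑ) ^ 2 * ‖g j n ω‖ₑ ^ 2 ∂P := by
          refine lintegral_congr fun ω => ?_
          rw [randomize, enorm_mul]; ring
      _ = (ENNReal.ofReal (bracket n ^ s) * ‖a n‖ₑ) ^ 2 * ∫⁻ ω, ‖g j n ω‖ₑ ^ 2 ∂P :=
          lintegral_const_mul' _ _ (by finiteness)
      _ ≤ _ := by rw [mul_comm]; gcongr; exact hbound n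
  have hm : Measurable fun ω => sobolevNorm s (randomize (g j) a ω) ^ 2 := by
    simp only [sobolevNorm_sq]
    exact Measurable.tsum hmeas
  filter_upwards [ae_lt_top hm hE] with ω hω
  exact lt_top_iff_ne_top.2 fun h => by simp [h] at hω

end RandomEvolution

/-! ### Almost sure local well-posedness -/

/-- Optimizing the moment parameter `m` in Chebyshev's inequality gives an exponential tail. -/
theorem lt_exp_of_forall_le_pow {p X y : ℝ} (hp : 1 < p) (hX : 0 < X) (hy1 : y ≤ 1)
    (hy : ∀ m : ℕ, p ≤ m → y ≤ 4 * (m / X) ^ m) :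
    y < 8 * Real.exp (p + 1) * Real.exp (-(X / Real.exp 1)) := by
  have he := Real.exp_pos 1
  rw [mul_assoc, ← Real.exp_add]
  rcases le_or_gt (⌈p⌉₊ : ℝ) (X / Real.exp 1) with h | h
  · set m := ⌊X / Real.exp 1⌋₊ with hm
    have hpm : p ≤ m := (Nat.le_ceil p).trans (Nat.cast_le.2 (Nat.le_floor h))
    have h1 : (m : ℝ) ≤ X / Real.exp 1 := Nat.floor_le (by positivity)
    have h2 : X / Real.exp 1 < m + 1 := Nat.lt_floor_add_one _
    have h3 : (m : ℝ) / X ≤ Real.exp (-1) := by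
      rw [Real.exp_neg, div_le_iff₀ hX]
      rw [le_div_iff₀ he] at h1
      rw [inv_mul_eq_div, le_div_iff₀ he]
      exact h1
    calc y ≤ 4 * (m / X) ^ m := hy m hpm
      _ ≤ 4 * Real.exp (-1) ^ m := by gcongr
      _ = 4 * Real.exp (-m) := by rw [← Real.exp_nat_mul]; ring_nf
      _ < 8 * Real.exp (-m) := by linarith [Real.exp_pos (-m)]
      _ ≤ _ := by
          gcongr
          linarith
  · have h1 : X / Real.exp 1 < p + 1 := h.trans (Nat.ceil_lt_add_one (by linarith))
    have h2 : 1 ≤ Real.exp (p + 1 + -(X / Real.exp 1)) := Real.one_le_exp (by linarith)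
    linarith

theorem isRealDistribution_randomize {Ω : Type*} [MeasurableSpace Ω] {P : Measure Ω} {K : ℝ}
    {g : Fin 2 → Freq → Ω → ℂ} (hg : IsRandomization P K g) (j : Fin 2) {a : Coeffs}
    (ha : IsRealDistribution a) (ω : Ω) : IsRealDistribution (randomize (g j) a ω) := fun n => by
  rw [randomize, randomize, hg.conj_symm, ha n, map_mul]

theorem sliceNorm_synthCurve_zero {r : ℝ} (t : ℝ) :
    sliceNorm r (synthCurve fun t => propV t 0 0) t = 0 := by
  have : ∀ y, synthCurve (fun t => propV t 0 0) y = 0 := fun y => by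
    simp [synthCurve, synth, trigPoly, propV_apply]
  simp [sliceNorm, this]

/-- The event on which the randomized data are in `𝓗^s` and their linear evolution satisfies the
smallness condition of the deterministic theory. -/
def goodEvent {Ω : Type*} (p s c₀ T : ℝ) (g : Fin 2 → Freq → Ω → ℂ) (a b : Coeffs) : Set Ω :=
  {ω | MemHH s (randomize (g 0) a ω) (randomize (g 1) b ω) ∧
    ∫⁻ t in Set.Icc 0 T, sliceNorm (2 * p) (synthCurve (randomEvolution g a b ω)) t ^ p
      ≤ ENNReal.ofReal c₀}

theorem measure_goodEvent_compl_le {Ω : Type*} [MeasurableSpace Ω] {P : Measure Ω} {K : ℝ}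
    {g : Fin 2 → Freq → Ω → ℂ} (hg : IsRandomization P K g) (hK : 0 < K) (p c₀ T : ℝ) {s : ℝ}
    {a b : Coeffs} (hab : MemHH s a b) :
    P (goodEvent p s c₀ T g a b)ᶜ ≤ P {ω | ENNReal.ofReal c₀ < ∫⁻ t in Set.Icc 0 T,
      sliceNorm (2 * p) (synthCurve (randomEvolution g a b ω)) t ^ p} := by
  refine measure_mono_ae ?_
  filter_upwards [ae_memH_randomize hg hK 0 hab.1, ae_memH_randomize hg hK 1 hab.2] with ω h0 h1 hω
  by_contra hc
  exact hω ⟨⟨h0, h1⟩, not_lt.1 hc⟩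

/-- The tail bound. The exponent `2 * (1 + s * p) / p` of `T` comes from `∫_0^T t^{sp} dt`, which is
finite because `s > -1/p`. -/
theorem measureReal_goodEvent_compl_lt {Ω : Type*} [MeasurableSpace Ω] {P : Measure Ω}
    [IsProbabilityMeasure P] {K : ℝ} {g : Fin 2 → Freq → Ω → ℂ} (hg : IsRandomization P K g)
    (hK : 0 < K) {p s T c₀ : ℝ} (hp : 1 < p) (hs : -(1 / p) < s) (hs0 : s ≤ 0) (hT : 0 < T)
    (hT1 : T ≤ 1) (hc₀ : 0 < c₀) {a b : Coeffs} (hab : MemHH s a b) (h0 : normHH s a b ≠ 0) :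
    P.real (goodEvent p s c₀ T g a b)ᶜ < 8 * Real.exp (p + 1) *
      Real.exp (-(((1 + s * p) * c₀) ^ (2 / p) / (128 * Real.exp 1 * K) / Real.exp 1
        / (T ^ (2 * (1 + s * p) / p) * normHH s a b ^ 2))) := by
  have hp0 : 0 < p := by linarith
  have hsp : -1 < s * p := by
    have := mul_lt_mul_of_pos_right hs hp0
    rwa [neg_mul, one_div_mul_cancel hp0.ne'] at this
  have hs1 : -1 ≤ s := by
    have : 1 / p ≤ 1 := by rw [div_le_one hp0]; exact hp.le
    linarith
  have hA : 0 < normHH s a b := lt_of_le_of_ne (normHH_nonneg s a b) h0.symm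
  have hsp' : 0 < 1 + s * p := by linarith
  set X := ((1 + s * p) * c₀) ^ (2 / p) / (128 * Real.exp 1 * K)
    / (T ^ (2 * (1 + s * p) / p) * normHH s a b ^ 2) with hX
  have hX0 : 0 < X := by positivity
  have key := lt_exp_of_forall_le_pow hp hX0
    (measureReal_le_one (μ := P) (s := (goodEvent p s c₀ T g a b)ᶜ)) fun m hpm => by
      have h1 := (measure_goodEvent_compl_le hg hK p c₀ T hab).trans
        (measure_lintegral_sliceNorm_gt_le hg hK hp hs1 hs0 hsp hT hT1 hc₀ hab hA hpm)
      refine (ENNReal.toReal_mono ENNReal.ofReal_ne_top h1).trans (le_of_eq ?_)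
      have hm : (0 : ℝ) < m := by linarith
      rw [ENNReal.toReal_ofReal (by positivity)]
      congr 2
      have e1 : (T ^ (1 + s * p) / (1 + s * p) / c₀) ^ (2 / p)
          = T ^ (2 * (1 + s * p) / p) / ((1 + s * p) * c₀) ^ (2 / p) := by
        rw [div_div, Real.div_rpow (by positivity) (by positivity), ← Real.rpow_mul hT.le]
        congr 2; ring
      rw [e1, hX]
      field_simp
  refine key.trans_le (le_of_eq ?_)
  rw [hX]
  congr 2
  field_simp

theorem measureReal_goodEvent_compl_eq_zero {Ω : Type*} [MeasurableSpace Ω] {P : Measure Ω}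
    {K : ℝ} {g : Fin 2 → Freq → Ω → ℂ} (hg : IsRandomization P K g)
    (hK : 0 < K) {p s T c₀ : ℝ} (hp : 1 < p) {a b : Coeffs} (hab : MemHH s a b)
    (h0 : normHH s a b = 0) : P.real (goodEvent p s c₀ T g a b)ᶜ = 0 := by
  obtain ⟨rfl, rfl⟩ := eq_zero_of_normHH_eq_zero hab h0
  have hz : ∀ ω t, sliceNorm (2 * p) (synthCurve (randomEvolution g 0 0 ω)) t = 0 := fun ω t => by
    have e : ∀ j, randomize (g j) 0 ω = 0 := fun j => by ext n; simp [randomize]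
    have : randomEvolution g 0 0 ω = fun t => propV t 0 0 := by
      ext t : 1
      rw [randomEvolution, e, e]
    rw [this]
    exact sliceNorm_synthCurve_zero t
  have h := measure_goodEvent_compl_le hg hK p c₀ T hab
  simp only [hz, ENNReal.zero_rpow_of_pos (zero_lt_one.trans hp), lintegral_zero, not_lt_zero,
    Set.ofPred_false, measure_empty, nonpos_iff_eq_zero] at h
  rw [Measure.real, h, ENNReal.toReal_zero]

/-- For small `δ` the class of the theorem is contained in `L^p([0,T]; L^{2p})` and contains
`C([0,T]; H¹)`. For `p < 2` the condition `2 * p ≤ expR p δ` is where `δ` has to be small. -/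
theorem expQ_expR_expσ_bounds {p δ : ℝ} (hp : 1 < p) (hδ : 0 < δ)
    (hδ' : p < 2 → δ < (2 - p) / (p - 1)) :
    p ≤ expQ p δ ∧ 2 * p ≤ expR p δ ∧ expσ p δ ≤ 1 := by
  unfold expQ expR expσ
  split_ifs with h
  · refine ⟨by linarith, ?_, zero_le_one⟩
    have h1 := hδ' h
    rw [lt_div_iff₀ (by linarith)] at h1
    rw [le_div_iff₀ (by linarith)]
    nlinarith
  · refine ⟨by linarith, le_rfl, ?_⟩
    have h1 : 0 < 1 / (p + δ) := by positivity
    have h2 : 0 < 1 / p := by positivity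
    linarith

/-- The probability of the bad event tends to `0` with `T`, so almost surely some `T` is good. -/
theorem ae_exists_mem_goodEvent {Ω : Type*} [MeasurableSpace Ω] {P : Measure Ω}
    [IsProbabilityMeasure P] {K : ℝ} {g : Fin 2 → Freq → Ω → ℂ} (hg : IsRandomization P K g)
    (hK : 0 < K) {p s c₀ T₀ : ℝ} (hp : 1 < p) (hs : -(1 / p) < s) (hs0 : s ≤ 0) (hc₀ : 0 < c₀)
    (hT₀ : 0 < T₀) {a b : Coeffs} (hab : MemHH s a b) :
    ∀ᵐ ω ∂P, ∃ T, 0 < T ∧ T ≤ T₀ ∧ ω ∈ goodEvent p s c₀ T g a b := by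
  have hp0 : 0 < p := by linarith
  have hsp : 0 < 1 + s * p := by
    have := mul_lt_mul_of_pos_right hs hp0
    rw [neg_mul, one_div_mul_cancel hp0.ne'] at this
    linarith
  set N := {ω | ¬∃ T, 0 < T ∧ T ≤ T₀ ∧ ω ∈ goodEvent p s c₀ T g a b} with hN
  have hsub : ∀ T, 0 < T → T ≤ T₀ → P.real N ≤ P.real (goodEvent p s c₀ T g a b)ᶜ := fun T hT hT' =>
    measureReal_mono (fun ω hω h => hω ⟨T, hT, hT', h⟩)
  suffices h : P.real N = 0 from (measureReal_eq_zero_iff (by finiteness)).1 h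
  refine le_antisymm ?_ measureReal_nonneg
  by_cases h0 : normHH s a b = 0
  · exact (hsub T₀ hT₀ le_rfl).trans (measureReal_goodEvent_compl_eq_zero hg hK hp hab h0).le
  have hA : 0 < normHH s a b := lt_of_le_of_ne (normHH_nonneg s a b) (Ne.symm h0)
  have hγ : 0 < 2 * (1 + s * p) / p := by positivity
  have hc : 0 < ((1 + s * p) * c₀) ^ (2 / p) / (128 * Real.exp 1 * K) / Real.exp 1 := by
    positivity
  have hlim : Tendsto (fun T : ℝ => 8 * Real.exp (p + 1) *
      Real.exp (-(((1 + s * p) * c₀) ^ (2 / p) / (128 * Real.exp 1 * K) / Real.exp 1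
        / (T ^ (2 * (1 + s * p) / p) * normHH s a b ^ 2)))) (𝓝[>] 0) (𝓝 0) := by
    rw [show 𝓝 (0 : ℝ) = 𝓝 (8 * Real.exp (p + 1) * 0) by rw [mul_zero]]
    refine (Real.tendsto_exp_neg_atTop_nhds_zero.comp ?_).const_mul _
    simp only [div_eq_mul_inv _ (_ * normHH s a b ^ 2)]
    refine Tendsto.const_mul_atTop hc (tendsto_inv_nhdsGT_zero.comp
      (tendsto_nhdsWithin_iff.2 ⟨?_, ?_⟩))
    · have : Tendsto (fun T : ℝ => T ^ (2 * (1 + s * p) / p)) (𝓝 0) (𝓝 0) := by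
        have := (Real.continuous_rpow_const hγ.le).tendsto (0 : ℝ)
        rwa [Real.zero_rpow hγ.ne'] at this
      simpa using (this.mono_left nhdsWithin_le_nhds).mul_const (normHH s a b ^ 2)
    · filter_upwards [self_mem_nhdsWithin] with T hT
      have : (0 : ℝ) < T := hT
      exact Set.mem_Ioi.2 (by positivity)
  refine ge_of_tendsto hlim ?_
  filter_upwards [Ioc_mem_nhdsGT (lt_min hT₀ one_pos)] with T hT
  exact (hsub T hT.1 (hT.2.trans (min_le_left _ _))).trans
    (measureReal_goodEvent_compl_lt hg hK hp hs hs0 hT.1 (hT.2.trans (min_le_right _ _)) hc₀ hab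
      h0).le

end ViscousNLW

end

theorem theorem1p3 (p s : ℝ) (hp : 1 < p) (hs : -(1 / p) < s) (hs0 : s ≤ 0) :
    ∃ δ₀ : ℝ, 0 < δ₀ ∧ ∀ δ : ℝ, 0 < δ → δ < δ₀ → ∀ K : ℝ, 0 < K →
      ∃ C c γ T₀ : ℝ, 0 < C ∧ 0 < c ∧ 0 < γ ∧ 0 < T₀ ∧
        ∀ (Ω : Type*) [MeasurableSpace Ω] (P : Measure Ω) [IsProbabilityMeasure P]
          (g : Fin 2 → ViscousNLW.Freq → Ω → ℂ) (u₀ u₁ : ViscousNLW.Coeffs),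
          ViscousNLW.IsRandomization P K g →
          ViscousNLW.MemHH s u₀ u₁ →
          ViscousNLW.IsRealDistribution u₀ → ViscousNLW.IsRealDistribution u₁ →
          -- almost sure local well-posedness
          (∀ᵐ ω ∂P, ∃ T : ℝ, 0 < T ∧
            ViscousNLW.HasUniqueSolution p T
              (ViscousNLW.expQ p δ) (ViscousNLW.expR p δ) (ViscousNLW.expσ p δ)
              (ViscousNLW.randomize (g 0) u₀ ω) (ViscousNLW.randomize (g 1) u₁ ω)) ∧
          -- quantitative form
          ∀ T : ℝ, 0 < T → T ≤ T₀ →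
            ∃ ΩT : Set Ω, MeasurableSet ΩT ∧
              (ViscousNLW.normHH s u₀ u₁ ≠ 0 →
                P.real ΩTᶜ <
                  C * Real.exp (-(c / (T ^ γ * ViscousNLW.normHH s u₀ u₁ ^ 2)))) ∧
              (ViscousNLW.normHH s u₀ u₁ = 0 → P.real ΩTᶜ = 0) ∧
              ∀ ω ∈ ΩT,
                ViscousNLW.MemHH s
                  (ViscousNLW.randomize (g 0) u₀ ω) (ViscousNLW.randomize (g 1) u₁ ω) ∧
                ViscousNLW.HasUniqueSolution p T
                  (ViscousNLW.expQ p δ) (ViscousNLW.expR p δ) (ViscousNLW.expσ p δ)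
                  (ViscousNLW.randomize (g 0) u₀ ω) (ViscousNLW.randomize (g 1) u₁ ω) := by
  have hp0 : 0 < p := by linarith
  have hsp : 0 < 1 + s * p := by
    have := mul_lt_mul_of_pos_right hs hp0
    rw [neg_mul, one_div_mul_cancel hp0.ne'] at this
    linarith
  obtain ⟨c₀, hc₀, hwp⟩ := ViscousNLW.exists_hasUniqueSolution hp
  refine ⟨if p < 2 then (2 - p) / (p - 1) else 1, ?_, fun δ hδ hδ' K hK => ?_⟩
  · split_ifs with h
    · exact div_pos (by linarith) (by linarith)
    · exact one_pos
  obtain ⟨hq, hr, hσ⟩ := ViscousNLW.expQ_expR_expσ_bounds hp hδ fun h => by rwa [if_pos h] at hδ'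
  refine ⟨8 * Real.exp (p + 1),
    ((1 + s * p) * c₀) ^ (2 / p) / (128 * Real.exp 1 * K) / Real.exp 1,
    2 * (1 + s * p) / p, min 1 c₀, by positivity, by positivity, by positivity,
    lt_min one_pos hc₀, ?_⟩
  intro Ω _ P _ g u₀ u₁ hg hu hu₀ hu₁
  have hgood : ∀ T, 0 < T → T ≤ min 1 c₀ → ∀ ω ∈ ViscousNLW.goodEvent p s c₀ T g u₀ u₁,
      ViscousNLW.HasUniqueSolution p T
        (ViscousNLW.expQ p δ) (ViscousNLW.expR p δ) (ViscousNLW.expσ p δ)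
        (ViscousNLW.randomize (g 0) u₀ ω) (ViscousNLW.randomize (g 1) u₁ ω) :=
    fun T hT hT' ω hω => hwp s T _ _ _ _ _ hT (by linarith) hq hr hσ (hT'.trans (min_le_right _ _))
      hω.1 (ViscousNLW.isRealDistribution_randomize hg 0 hu₀ ω)
      (ViscousNLW.isRealDistribution_randomize hg 1 hu₁ ω) hω.2
  refine ⟨?_, fun T hT hT' => ?_⟩
  · filter_upwards [ViscousNLW.ae_exists_mem_goodEvent hg hK hp hs hs0 hc₀
      (lt_min one_pos hc₀) hu] with ω ⟨T, hT, hT', hω⟩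
    exact ⟨T, hT, hgood T hT hT' ω hω⟩
  -- The good event need not be measurable: remove a measurable hull of its complement.
  · have hΩ : P.real (toMeasurable P (ViscousNLW.goodEvent p s c₀ T g u₀ u₁)ᶜ)ᶜᶜ
        = P.real (ViscousNLW.goodEvent p s c₀ T g u₀ u₁)ᶜ := by
      rw [compl_compl, Measure.real, measure_toMeasurable, Measure.real]
    refine ⟨(toMeasurable P (ViscousNLW.goodEvent p s c₀ T g u₀ u₁)ᶜ)ᶜ,
      (measurableSet_toMeasurable _ _).compl, fun h0 => ?_, fun h0 => ?_, fun ω hω => ?_⟩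
    · rw [hΩ]
      exact ViscousNLW.measureReal_goodEvent_compl_lt hg hK hp hs hs0 hT
        (hT'.trans (min_le_left _ _)) hc₀ hu h0
    · rw [hΩ]
      exact ViscousNLW.measureReal_goodEvent_compl_eq_zero hg hK hp hu h0
    · have hω' : ω ∈ ViscousNLW.goodEvent p s c₀ T g u₀ u₁ :=
        Set.compl_subset_comm.1 (subset_toMeasurable P _) hω
      exact ⟨hω'.1, hgood T hT hT' ω hω'⟩
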